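/- **Proposition (confluence of the connection formula for the quintic).** Let $D=\mathbb{C}\setminus[0,\infty)$, and on $D$ let $\log Q$ be the branch with $\log(-Q)=\log Q+\pi i$, where $\log(-Q)$ is principal (so $\operatorname{Im}\log Q\in(-2\pi,0)$); put $Q^{\mu}=e^{\mu\log Q}$. All functions of $H$ below are holomorphic near $H=0$, all series occurring converge in the indicated ranges (for $H$ near $0$), and congruences and limits modulo $H^4$ mean: for the Taylor coefficients of $H^0,\dots,H^3$ at $H=0$ (i.e. $H$ is the hyperplane class, $H^4=0$). Put $$I(H,Q)=Q^{H}\sum_{d\ge0}\frac{\prod_{k=1}^{5d}(5H+k)}{\prod_{k=1}^{d}(H+k)^5}\Big(\frac{Q}{5^5}\Big)^{d}\quad(|Q|<1),\qquad \widetilde W_k(1/Q)=\sum_{d\ge0}\frac{\prod_{l=0}^{d-1}(\frac k5+l)^5}{\prod_{l=0}^{5d-1}(k+l)}\Big(\frac{5^5}{Q}\Big)^{d}\quad(|Q|>1),$$ $$R(H,Q)=\frac{5^{5H}\,\Gamma(H+1)^5}{\Gamma(5H+1)}\sum_{k=1}^{4}\frac{5^{k-1}\,\Gamma(5-k)}{\prod_{1\le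 i\le 4,\,i\ne k}(i-k)\;\Gamma(1-\frac k5)^5}\;\frac{\pi e^{-\pi i(H+k/5)}}{\sin(\pi(H+\frac k5))}\;Q^{-k/5}\,\widetilde W_k(1/Q)\quad(|Q|>1).$$ (1) Connection formula: $I(H,Q)= R(H,Q)$ modulo $H^4$ on $D$, in the sense of analytic continuation: for each $i<4$ there is a holomorphic function on $D$ equal to the coefficient of $H^i$ in $I(H,Q)$ for $|Q|<1$ and to the coefficient of $H^i$ in $R(H,Q)$ for $|Q|>1$. (2) Confluence: for $0<q<1$ and $P=q^H$, let $(a;q)_d=\prod_{l=0}^{d-1}(1-aq^l)$ for $d\in\mathbb{N}\cup\{\infty\}$, $\theta_q(x)=\sum_{d\in\mathbb{Z}}q^{d(d-1)/2}x^d$, $\ell_q(x)=-x\theta_q'(x)/\theta_q(x)$, $e_{q,\lambda}(x)=\theta_q(x)/\theta_q(\lambda x)$, $\Gamma_q(x)=\frac{(q;q)_\infty}{(q^x;q)_\infty}(1-q)^{1-x}$, and $$W_k(1/Q)=e_{q,q^{k/5}}(1/Q)\sum_{d\ge0}\frac{(q^{k/5};q)_d^4}{\prod_{i=1}^4(q^{1+(k-i)/5};q)_d}\Big(\frac{q^2}{Q}\Big)^d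 .$$ Let $\operatorname{Im}Q<0$ and let $q=e^{-t}$, $t\to0^+$. Then, modulo $H^4$, the two sides of the $q$-Gamma form of the $n=m=4$, $\alpha_i=q^{i/5}$ connection formula converge to the two sides of (1): for $|Q|<1$, $$P^{\ell_q(Q)}\sum_{d\ge0}\frac{\prod_{i=1}^4(Pq^{i/5};q)_d}{(Pq;q)_d^4}Q^d\longrightarrow I(H,Q),$$ and for $|Q|>1$, $$P^{\ell_q(Q)}\frac{\Gamma_q(H+1)^4}{\prod_{i=1}^4\Gamma_q(H+\frac i5)}\sum_{k=1}^4\frac{\prod_{i\ne k}\Gamma_q(\frac{i-k}5)}{\Gamma_q(1-\frac k5)^4}\,\Gamma_q\big(H+\tfrac k5\big)\Gamma_q\big(1-H-\tfrac k5\big)\frac{\theta_q(-q^{H+k/5}Q)}{\theta_q(-Q)}\,e_{q,q^{k/5}}(1/Q)^{-1}W_k(1/Q)\longrightarrow R(H,Q).$$ -/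

import Mathlib

open Filter Topology

noncomputable section

namespace QuinticConfluence

/-! ### Expansion in the hyperplane class -/

/-- The coefficient of `H ^ i` in the Taylor expansion at `0` of a function of `H`. A holomorphic
germ `f` is evaluated at the hyperplane class (with `H ^ 4 = 0`) through its coefficients
`hCoeff i f`, `i < 4`; equality of these four numbers is equality modulo `H ^ 4`. -/
def hCoeff (i : ℕ) (f : ℂ → ℂ) : ℂ :=
  iteratedDeriv i f 0 / (i.factorial : ℂ)

/-! ### Domain and branch of the logarithm -/

/-- The plane cut along `[0, ∞)`, that is `|arg (-Q)| < π`. -/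
def cutPlane : Set ℂ := {Q | -Q ∈ Complex.slitPlane}

/-- The branch of `log Q` on the cut plane with `log (-Q) = log Q + π i`, where `log (-Q)` is
principal; its imaginary part lies in `(-2π, 0)`. It is the principal branch for `Im Q < 0`. -/
def logQ (Q : ℂ) : ℂ := Complex.log (-Q) - Real.pi * Complex.I

/-- `Q ^ μ` for the branch `logQ`. -/
def powQ (Q μ : ℂ) : ℂ := Complex.exp (μ * logQ Q)

/-! ### The two sides of the limit formula -/

/-- `∏_{k=1}^{5d} (5H + k) / ∏_{k=1}^{d} (H + k)^5 * (Q / 5^5)^d`. -/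
def iTerm (H Q : ℂ) (d : ℕ) : ℂ :=
  (∏ k ∈ Finset.Icc 1 (5 * d), (5 * H + (k : ℂ))) /
    (∏ k ∈ Finset.Icc 1 d, (H + (k : ℂ)) ^ 5) * (Q / 5 ^ 5) ^ d

/-- The cohomological `I`-function of the quintic. -/
def iFun (H Q : ℂ) : ℂ := powQ Q H * ∑' d : ℕ, iTerm H Q d

/-- `∏_{l=0}^{d-1} (k/5 + l)^5 / ∏_{l=0}^{5d-1} (k + l) * (5^5 w)^d`. -/
def wTerm (k : ℕ) (w : ℂ) (d : ℕ) : ℂ :=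
  (∏ l ∈ Finset.range d, ((k : ℂ) / 5 + (l : ℂ)) ^ 5) /
    (∏ l ∈ Finset.range (5 * d), ((k : ℂ) + (l : ℂ))) * (5 ^ 5 * w) ^ d

/-- The series `W̃_k(w)`, to be used at `w = 1/Q`. -/
def wTilde (k : ℕ) (w : ℂ) : ℂ := ∑' d : ℕ, wTerm k w d

/-- The Gamma function combination of the functions `Q^{-k/5} W̃_k(1/Q)`. -/
def gammaSide (H Q : ℂ) : ℂ :=
  (5 : ℂ) ^ (5 * H) * Complex.Gamma (H + 1) ^ 5 / Complex.Gamma (5 * H + 1) *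
    ∑ k ∈ Finset.Icc (1 : ℕ) 4,
      (5 : ℂ) ^ (k - 1) * Complex.Gamma (5 - (k : ℂ)) /
        ((∏ i ∈ (Finset.Icc (1 : ℕ) 4).erase k, ((i : ℂ) - (k : ℂ))) *
          Complex.Gamma (1 - (k : ℂ) / 5) ^ 5) *
      (Real.pi * Complex.exp (-(Real.pi * Complex.I * (H + (k : ℂ) / 5))) /
        Complex.sin (Real.pi * (H + (k : ℂ) / 5))) *
      (powQ Q (-((k : ℂ) / 5)) * wTilde k (1 / Q))

/-! ### `q`-functions, for `0 < q < 1` -/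

/-- `(a; q)_d`. -/
def qPoch (a : ℂ) (q : ℝ) (d : ℕ) : ℂ := ∏ l ∈ Finset.range d, (1 - a * (q : ℂ) ^ l)

/-- `(a; q)_∞`. -/
def qPochInf (a : ℂ) (q : ℝ) : ℂ := ∏' l : ℕ, (1 - a * (q : ℂ) ^ l)

/-- Jacobi's theta function `∑_{d ∈ ℤ} q^{d(d-1)/2} Q^d`. -/
def theta (q : ℝ) (Q : ℂ) : ℂ := ∑' d : ℤ, (q : ℂ) ^ (d * (d - 1) / 2) * Q ^ d

/-- The `q`-logarithm `-Q θ_q'(Q) / θ_q(Q)`. -/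
def qLog (q : ℝ) (Q : ℂ) : ℂ := -Q * deriv (theta q) Q / theta q Q

/-- The `q`-character `e_{q,lam}(Q) = θ_q(Q) / θ_q(lam Q)`. -/
def qChar (q : ℝ) (lam Q : ℂ) : ℂ := theta q Q / theta q (lam * Q)

/-- The `q`-Gamma function `(q;q)_∞ / (q^x;q)_∞ * (1-q)^{1-x}`. -/
def qGamma (q : ℝ) (x : ℂ) : ℂ :=
  qPochInf (q : ℂ) q / qPochInf ((q : ℂ) ^ x) q * ((1 - q : ℝ) : ℂ) ^ (1 - x)

/-! ### The two sides of the `q`-connection formula, with `P = q^H` -/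

/-- `∏_{i=1}^4 (P q^{i/5}; q)_d / (P q; q)_d^4 * Q^d` with `P = q^H`. -/
def qTerm (q : ℝ) (H Q : ℂ) (d : ℕ) : ℂ :=
  (∏ i ∈ Finset.Icc (1 : ℕ) 4, qPoch ((q : ℂ) ^ (H + (i : ℂ) / 5)) q d) /
    qPoch ((q : ℂ) ^ (H + 1)) q d ^ 4 * Q ^ d

/-- `P^{ℓ_q(Q)} ∑_d ∏_{i=1}^4 (P q^{i/5}; q)_d / (P q; q)_d^4 * Q^d` with `P = q^H`. -/
def qSeriesSide (q : ℝ) (H Q : ℂ) : ℂ :=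
  (q : ℂ) ^ (H * qLog q Q) * ∑' d : ℕ, qTerm q H Q d

/-- The terms of the basic hypergeometric series `₄φ₃` with upper parameters `q^{k/5}` (four
times), lower parameters `q^{1+(k-i)/5}`, `i ≠ k` (the factor `i = k` is `(q;q)_d`), at `q² w`. -/
def qWTerm (q : ℝ) (k : ℕ) (w : ℂ) (d : ℕ) : ℂ :=
  qPoch ((q : ℂ) ^ ((k : ℂ) / 5)) q d ^ 4 /
    (∏ i ∈ Finset.Icc (1 : ℕ) 4, qPoch ((q : ℂ) ^ (1 + ((k : ℂ) - (i : ℂ)) / 5)) q d) *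
    ((q : ℂ) ^ 2 * w) ^ d

/-- The solution `W_k(w)` of the `q`-difference equation at `w = 1/Q = 0`. -/
def qW (q : ℝ) (k : ℕ) (w : ℂ) : ℂ :=
  qChar q ((q : ℂ) ^ ((k : ℂ) / 5)) w * ∑' d : ℕ, qWTerm q k w d

/-- The `q`-Gamma form of the right-hand side of the connection formula, with `P = q^H`. -/
def qGammaSide (q : ℝ) (H Q : ℂ) : ℂ :=
  (q : ℂ) ^ (H * qLog q Q) *
    (qGamma q (H + 1) ^ 4 / ∏ i ∈ Finset.Icc (1 : ℕ) 4, qGamma q (H + (i : ℂ) / 5)) *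
    ∑ k ∈ Finset.Icc (1 : ℕ) 4,
      (∏ i ∈ (Finset.Icc (1 : ℕ) 4).erase k, qGamma q (((i : ℂ) - (k : ℂ)) / 5)) /
        qGamma q (1 - (k : ℂ) / 5) ^ 4 *
      (qGamma q (H + (k : ℂ) / 5) * qGamma q (-H + 1 - (k : ℂ) / 5)) *
      (theta q (-(q : ℂ) ^ (H + (k : ℂ) / 5) * Q) / theta q (-Q)) *
      ((qChar q ((q : ℂ) ^ ((k : ℂ) / 5)) (1 / Q))⁻¹ * qW q k (1 / Q))

end QuinticConfluence

end

open Filter Topology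

noncomputable section

namespace QuinticConfluence

/-! ### Taylor coefficients of holomorphic families -/

/-! The connection formula rests on the Gamma quotient `gammaRatio s` = ∏ Γ(s+i/5) / Γ(s+1)^4. By
the multiplication formula for the factor 5, the coefficients of the `I`-function are `gammaRatio (H
+ d) / gammaRatio H`. The quotient has simple poles at s = -k/5 - n and decays like s^(-2), so it is
the sum of its principal parts `wCoeff k n * gCoeff k / (s + k/5 + n)` (`gammaRatio_eq_sum`).
Summing these against Q^d turns the `I`-series into a superposition of integrals ∫_0^1
x^(a-1)/(1-xQ) dx with a = H + k/5 + n, and these are holomorphic in Q on the whole cut plane.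

For |Q| > 1 each integral is the integral over the half-line, a Beta integral equal to π/sin(πa) ·
(-Q)^(-a), plus a series in 1/Q. The half-line parts add up to `gammaSide`. The series recombine,
again by partial fractions, into values `gammaRatio (H - (m + 1))`, and these carry a factor H^4
because 1/Γ(s+1)^4 has zeros of order four at the negative integers. Hence the two sides agree
modulo H^4 although not identically (`lerchSum_eq_of_one_lt_norm`, `norm_gammaRatio_sub_le`).

The confluence statements are proved for each side separately, without the q-connection formula. The
logarithm of Γ_q is a telescoped series dominated by a multiple of 1/(n+1)^2 uniformly in t, so Γ_q
tends to Γ (`tendsto_qGamma`). The modular transformation writes θ_q as an explicit Gaussian times a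
dual theta function tending to 1, which gives the limits of P^(ℓ_q(Q)) and of theta quotients
(`tendsto_cpow_qLog`, `tendsto_theta_div`). The q-hypergeometric series have geometric majorants
independent of t. All limits are taken jointly in (t, H), hence are locally uniform in H, and so
pass to Taylor coefficients (`tendsto_hCoeff`). -/

theorem hCoeff_congr {f g : ℂ → ℂ} (h : f =ᶠ[𝓝 0] g) (i : ℕ) : hCoeff i f = hCoeff i g := by
  rw [hCoeff, hCoeff, h.iteratedDeriv_eq]

theorem hCoeff_eq_circleIntegral {f : ℂ → ℂ} {r : ℝ} (hr : 0 < r)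
    (hf : DifferentiableOn ℂ f (Metric.closedBall 0 r)) (i : ℕ) :
    hCoeff i f = (2 * Real.pi * Complex.I)⁻¹ * ∮ z in C(0, r), (1 / (z - 0) ^ (i + 1)) • f z := by
  have h := (hf.diffContOnCl_ball subset_rfl).circleIntegral_one_div_sub_center_pow_smul hr i
  rw [h, hCoeff, smul_eq_mul]
  have := Complex.two_pi_I_ne_zero
  have h3 : (i.factorial : ℂ) ≠ 0 := by exact_mod_cast i.factorial_ne_zero
  field_simp

/-- A parametric integral of holomorphic functions is holomorphic if it is locally dominated. -/
theorem differentiableOn_integral_of_dominated {α : Type*} [MeasurableSpace α]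
    {μ : MeasureTheory.Measure α} {F : ℂ → α → ℂ} {U : Set ℂ} (hU : IsOpen U)
    (hmeas : ∀ z ∈ U, MeasureTheory.AEStronglyMeasurable (F z) μ)
    (hdiff : ∀ᵐ x ∂μ, DifferentiableOn ℂ (fun z => F z x) U)
    (hb : ∀ z₀ ∈ U, ∃ bound : α → ℝ, MeasureTheory.Integrable bound μ ∧
      ∃ ε > 0, ∀ᵐ x ∂μ, ∀ z ∈ Metric.ball z₀ ε, ‖F z x‖ ≤ bound x) :
    DifferentiableOn ℂ (fun z => ∫ x, F z x ∂μ) U := by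
  intro z₀ hz₀
  obtain ⟨bound, hint, ε, hε, hbd⟩ := hb z₀ hz₀
  obtain ⟨δ, hδ, hδU⟩ := Metric.isOpen_iff.1 hU z₀ hz₀
  -- With 2ρ at most ε and δ, every closed disc of radius ρ/2 centred in the ρ-ball stays where the
  -- bound and the holomorphy are both available.
  set ρ := min ε δ / 2 with hρ
  have hρ0 : 0 < ρ := by positivity
  have hρε : 2 * ρ ≤ ε := by rw [hρ]; linarith [min_le_left ε δ]
  have hρδ : 2 * ρ ≤ δ := by rw [hρ]; linarith [min_le_right ε δ]
  have hsub : ∀ z ∈ Metric.ball z₀ ρ, Metric.closedBall z (ρ / 2) ⊆ Metric.ball z₀ (2 * ρ) := by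
    intro z hz w hw
    rw [Metric.mem_ball] at *
    rw [Metric.mem_closedBall] at hw
    linarith [dist_triangle w z z₀]
  -- The derivative in the parameter is measurable as an a.e. limit of difference quotients along
  -- the sequence z₀ + ρ/(n+1).
  have hF' : MeasureTheory.AEStronglyMeasurable (fun x => deriv (fun z => F z x) z₀) μ := by
    let u : ℕ → ℂ := fun n => z₀ + ((ρ / (n + 1) : ℝ) : ℂ)
    have hu_mem : ∀ n, u n ∈ U := fun n => hδU (by
      have h1 : (0 : ℝ) < n + 1 := by positivity
      simp only [u, Metric.mem_ball, dist_eq_norm, add_sub_cancel_left, Complex.norm_real,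
        Real.norm_eq_abs, abs_of_pos (div_pos hρ0 h1)]
      have : ρ / (n + 1) ≤ ρ := div_le_self hρ0.le (by linarith [n.cast_nonneg (α := ℝ)])
      linarith)
    have hu : Tendsto u atTop (𝓝[≠] z₀) := by
      refine tendsto_nhdsWithin_iff.2 ⟨?_, Eventually.of_forall fun n => ?_⟩
      · have h1 : Tendsto (fun n : ℕ => ρ / ((n : ℝ) + 1)) atTop (𝓝 0) := by
          have := (tendsto_one_div_add_atTop_nhds_zero_nat (𝕜 := ℝ)).const_mul ρ
          simpa [div_eq_mul_inv] using this
        have h2 := (Complex.continuous_ofReal.tendsto 0).comp h1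
        have := h2.const_add z₀
        simpa [u, Function.comp_def] using this
      · have h1 : (0 : ℝ) < n + 1 := by positivity
        simp only [u, Set.mem_compl_iff, Set.mem_singleton_iff, add_eq_left]
        exact_mod_cast (div_pos hρ0 h1).ne'
    refine aestronglyMeasurable_of_tendsto_ae atTop
      (f := fun n x => slope (fun z => F z x) z₀ (u n)) (fun n => ?_) ?_
    · simp only [slope_def_module]
      exact ((hmeas _ (hu_mem n)).sub (hmeas _ hz₀)).const_smul ((u n - z₀)⁻¹)
    · filter_upwards [hdiff] with x hx
      exact (hasDerivAt_iff_tendsto_slope.1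
        ((hx z₀ hz₀).differentiableAt (hU.mem_nhds hz₀)).hasDerivAt).comp hu
  have hball : Metric.ball z₀ ρ ∈ 𝓝 z₀ := Metric.ball_mem_nhds _ hρ0
  have key := hasDerivAt_integral_of_dominated_loc_of_deriv_le (μ := μ) (F := F)
    (F' := fun z x => deriv (fun z => F z x) z) (x₀ := z₀) (s := Metric.ball z₀ ρ)
    (bound := fun x => bound x / (ρ / 2)) hball ?_ ?_ hF' ?_ (hint.div_const _) ?_
  · exact key.2.differentiableAt.differentiableWithinAt
  · filter_upwards [hU.mem_nhds hz₀] with z hz using hmeas z hz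
  · refine hint.mono' (hmeas z₀ hz₀) ?_
    filter_upwards [hbd] with x hx using hx z₀ (Metric.mem_ball_self hε)
  · filter_upwards [hdiff, hbd] with x hx hx2 z hz
    -- Cauchy's estimate on a circle of radius ρ/2 converts the bound on F into one on its
    -- derivative, so no hypothesis on the derivative is required.
    refine Complex.norm_deriv_le_of_forall_mem_sphere_norm_le (by positivity) ?_ ?_
    · refine DifferentiableOn.diffContOnCl_ball (U := U) hx ?_
      exact (hsub z hz).trans ((Metric.ball_subset_ball hρδ).trans hδU)
    · intro w hw
      exact hx2 w (Metric.ball_subset_ball hρε (hsub z hz (Metric.sphere_subset_closedBall hw)))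
  · filter_upwards [hdiff] with x hx z hz
    have : z ∈ U := hδU (Metric.ball_subset_ball (by linarith) hz)
    exact ((hx z this).differentiableAt (hU.mem_nhds this)).hasDerivAt

/-- Taylor coefficients in H are Cauchy integrals over one fixed circle, and these depend
holomorphically on the parameter Q once the family is locally bounded in Q uniformly on the closed
disc. -/
theorem differentiableOn_hCoeff {h : ℂ → ℂ → ℂ} {V : Set ℂ} (hV : IsOpen V) {r : ℝ} (hr : 0 < r)
    (h1 : ∀ Q ∈ V, DifferentiableOn ℂ (fun H => h H Q) (Metric.closedBall 0 r))
    (h2 : ∀ H ∈ Metric.closedBall (0 : ℂ) r, DifferentiableOn ℂ (h H) V)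
    (h3 : ∀ Q₀ ∈ V, ∃ C, ∀ᶠ Q in 𝓝 Q₀, ∀ H ∈ Metric.closedBall (0 : ℂ) r, ‖h H Q‖ ≤ C) (i : ℕ) :
    DifferentiableOn ℂ (fun Q => hCoeff i (fun H => h H Q)) V := by
  have hmem : ∀ θ, circleMap 0 r θ ∈ Metric.closedBall (0 : ℂ) r := fun θ =>
    Metric.sphere_subset_closedBall (circleMap_mem_sphere _ hr.le θ)
  have key : DifferentiableOn ℂ (fun Q => ∫ θ in Set.Ioc 0 (2 * Real.pi),
      deriv (circleMap 0 r) θ • ((1 / (circleMap 0 r θ - 0) ^ (i + 1)) • h (circleMap 0 r θ) Q))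
      V := by
    refine differentiableOn_integral_of_dominated hV ?_ ?_ ?_
    · intro Q hQ
      refine Continuous.aestronglyMeasurable ?_
      have hc : Continuous fun θ => h (circleMap 0 r θ) Q :=
        (h1 Q hQ).continuousOn.comp_continuous (continuous_circleMap 0 r) hmem
      simp only [deriv_circleMap, sub_zero]
      refine ((continuous_circleMap 0 r).mul continuous_const).smul
        (Continuous.smul (continuous_const.div ((continuous_circleMap 0 r).pow _) fun θ => ?_) hc)
      exact pow_ne_zero _ (circleMap_ne_center hr.ne')
    · refine Eventually.of_forall fun θ => ?_
      exact ((h2 _ (hmem θ)).const_smul (1 / (circleMap 0 r θ - 0) ^ (i + 1))).const_smul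
        (deriv (circleMap 0 r) θ)
    · intro Q₀ hQ₀
      obtain ⟨C, hC⟩ := h3 Q₀ hQ₀
      obtain ⟨ε, hε, hb⟩ := Metric.eventually_nhds_iff_ball.1 hC
      refine ⟨fun _ => r * (1 / r ^ (i + 1) * C), MeasureTheory.integrable_const _, ε, hε,
        Eventually.of_forall fun θ Q hQ => ?_⟩
      have hn : ‖circleMap 0 r θ‖ = r := by simp [abs_of_pos hr]
      rw [norm_smul, norm_smul, deriv_circleMap, norm_mul, Complex.norm_I, sub_zero, norm_div,
        norm_pow, hn, norm_one, mul_one]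
      exact mul_le_mul_of_nonneg_left
        (mul_le_mul_of_nonneg_left (hb Q hQ _ (hmem θ)) (by positivity)) hr.le
  refine (key.const_mul (2 * Real.pi * Complex.I)⁻¹).congr fun Q hQ => ?_
  rw [hCoeff_eq_circleIntegral hr (h1 Q hQ), circleIntegral,
    intervalIntegral.integral_of_le (by positivity)]

/-- Cauchy's estimate on the circle of radius r bounds the i-th derivative by a multiple of r^(n-i),
which tends to 0 with r. The bound is only asked on a punctured neighbourhood, since the formulas it
is applied to break down at H = 0. -/
theorem hCoeff_eq_zero_of_norm_le {f : ℂ → ℂ} (hf : AnalyticAt ℂ f 0) {n : ℕ} {C : ℝ}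
    (hb : ∀ᶠ z in 𝓝[≠] (0 : ℂ), ‖f z‖ ≤ C * ‖z‖ ^ n) {i : ℕ} (hi : i < n) : hCoeff i f = 0 := by
  have key : ∀ᶠ r : ℝ in 𝓝[>] 0, ‖iteratedDeriv i f 0‖ ≤ i.factorial * C * r ^ (n - i) := by
    obtain ⟨ε, hε, h1⟩ := Metric.eventually_nhds_iff_ball.1 hf.eventually_analyticAt
    obtain ⟨δ, hδ, h2⟩ := Metric.eventually_nhds_iff_ball.1 (eventually_nhdsWithin_iff.1 hb)
    have : Set.Ioo (0 : ℝ) (min ε δ) ∈ 𝓝[>] 0 := Ioo_mem_nhdsGT (lt_min hε hδ)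
    filter_upwards [this] with r hr
    have hd : DifferentiableOn ℂ f (Metric.closedBall 0 r) := fun z hz =>
      (h1 z (Metric.closedBall_subset_ball (hr.2.trans_le (min_le_left _ _)) hz)
        ).differentiableAt.differentiableWithinAt
    have := Complex.norm_iteratedDeriv_le_of_forall_mem_sphere_norm_le i hr.1
      (hd.diffContOnCl_ball subset_rfl) (C := C * r ^ n) (fun z hz => by
        have hz' : ‖z‖ = r := by simpa using hz
        rw [← hz']
        refine h2 z ?_ ?_
        · rw [mem_ball_zero_iff, hz']
          exact hr.2.trans_le (min_le_right _ _)
        · intro h0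
          rw [Set.mem_singleton_iff.1 h0, norm_zero] at hz'
          exact hr.1.ne hz')
    refine this.trans (le_of_eq ?_)
    have hr0 := hr.1.ne'
    have h3 : r ^ n = r ^ (n - i) * r ^ i := by rw [← pow_add, Nat.sub_add_cancel hi.le]
    rw [h3]
    field_simp
  have hlim : Tendsto (fun r : ℝ => i.factorial * C * r ^ (n - i)) (𝓝[>] 0) (𝓝 0) := by
    have h : Continuous fun r : ℝ => i.factorial * C * r ^ (n - i) := by fun_prop
    have h0 := (h.tendsto 0).mono_left (nhdsWithin_le_nhds (s := Set.Ioi 0))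
    simpa [zero_pow (Nat.sub_ne_zero_of_lt hi)] using h0
  have h0 := ge_of_tendsto hlim key
  rw [hCoeff, norm_le_zero_iff.1 h0, zero_div]

/-- Convergence along `l ×ˢ 𝓝 H` at every H of an open set, to a continuous limit, is locally
uniform convergence; by Weierstrass it is inherited by all derivatives. -/
theorem tendsto_hCoeff {ι : Type*} {l : Filter ι} [l.NeBot] {F : ι → ℂ → ℂ} {f : ℂ → ℂ} {U : Set ℂ}
    (hU : IsOpen U) (h0 : (0 : ℂ) ∈ U) (hF : ∀ᶠ t in l, DifferentiableOn ℂ (F t) U)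
    (hf : ContinuousOn f U)
    (hlim : ∀ H ∈ U, Tendsto (fun p : ι × ℂ => F p.1 p.2) (l ×ˢ 𝓝 H) (𝓝 (f H))) (i : ℕ) :
    Tendsto (fun t => hCoeff i (F t)) l (𝓝 (hCoeff i f)) := by
  have hloc : TendstoLocallyUniformlyOn F f l U := by
    rw [hU.tendstoLocallyUniformlyOn_iff_forall_tendsto]
    intro H hH
    have h1 : Tendsto (fun p : ι × ℂ => f p.2) (l ×ˢ 𝓝 H) (𝓝 (f H)) :=
      (hf.continuousAt (hU.mem_nhds hH)).tendsto.comp tendsto_snd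
    have := h1.prodMk_nhds (hlim H hH)
    exact this.mono_right (nhds_le_uniformity (f H))
  have hit : ∀ i : ℕ, TendstoLocallyUniformlyOn (fun t => iteratedDeriv i (F t))
      (iteratedDeriv i f) l U ∧ ∀ᶠ t in l, DifferentiableOn ℂ (iteratedDeriv i (F t)) U := by
    intro i
    induction i with
    | zero => simpa [iteratedDeriv_zero] using ⟨hloc, hF⟩
    | succ i ih =>
      simp only [iteratedDeriv_succ]
      refine ⟨ih.1.deriv ih.2 hU, ?_⟩
      filter_upwards [ih.2] with t ht using ht.deriv hU
  have := ((hit i).1.tendsto_at h0).div_const (i.factorial : ℂ)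
  exact this

/-! ### The `q`-Gamma function as the exponential of a series, and its classical limit -/

/-- Second-order Taylor estimate on a half-plane. -/
theorem norm_sub_sub_mul_le_of_re {f f' f'' : ℂ → ℂ} {c M : ℝ}
    (hf : ∀ s : ℂ, c ≤ s.re → HasDerivAt f (f' s) s)
    (hf' : ∀ s : ℂ, c ≤ s.re → HasDerivAt f' (f'' s) s)
    (hM : ∀ s : ℂ, c ≤ s.re → ‖f'' s‖ ≤ M) {a b : ℂ} (ha : c ≤ a.re) (hb : c ≤ b.re) :
    ‖f b - f a - f' a * (b - a)‖ ≤ M * ‖b - a‖ ^ 2 := by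
  have hconv : Convex ℝ {s : ℂ | c ≤ s.re} := convex_halfSpace_re_ge c
  have hM0 : 0 ≤ M := (norm_nonneg _).trans (hM a ha)
  have h1 : ∀ s : ℂ, c ≤ s.re → ‖f' s - f' a‖ ≤ M * ‖s - a‖ := fun s hs =>
    hconv.norm_image_sub_le_of_norm_hasDerivWithin_le
      (fun x hx => (hf' x hx).hasDerivWithinAt) hM ha hs
  have hseg : segment ℝ a b ⊆ {s : ℂ | c ≤ s.re} := hconv.segment_subset ha hb
  -- A second mean value inequality, applied to f minus its linear part; on the segment its
  -- derivative is at most M‖b - a‖. The sharp constant M/2 is not needed.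
  have h2 := (convex_segment (𝕜 := ℝ) a b).norm_image_sub_le_of_norm_hasDerivWithin_le
    (f := fun s => f s - f' a * s) (f' := fun s => f' s - f' a) (C := M * ‖b - a‖)
    (fun x hx => (((hf x (hseg hx)).sub ((hasDerivAt_id x).const_mul (f' a))).congr_deriv
      (by rw [mul_one])).hasDerivWithinAt)
    (fun x hx => (h1 x (hseg hx)).trans (by
      have : ‖x - a‖ ≤ ‖b - a‖ := by
        simpa [dist_eq_norm] using (convexOn_dist a (convex_segment (𝕜 := ℝ) a b)).le_max_of_mem_segment
          (left_mem_segment ℝ a b) (right_mem_segment ℝ a b) hx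
      gcongr))
    (left_mem_segment ℝ a b) (right_mem_segment ℝ a b)
  calc ‖f b - f a - f' a * (b - a)‖ = ‖f b - f' a * b - (f a - f' a * a)‖ := by congr 1; ring
    _ ≤ _ := h2
    _ = _ := by ring

/-- The `q`-number `(1 - q^s) / t` with `q = e^{-t}`. -/
def qNum (t : ℝ) (s : ℂ) : ℂ := (1 - Complex.exp (-(t * s))) / t

theorem norm_exp_neg_mul_lt_one {t : ℝ} (ht : 0 < t) {s : ℂ} (hs : 0 < s.re) :
    ‖Complex.exp (-(t * s))‖ < 1 := by
  rw [Complex.norm_exp]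
  simpa using mul_pos ht hs

theorem qNum_re_pos {t : ℝ} (ht : 0 < t) {s : ℂ} (hs : 0 < s.re) : 0 < (qNum t s).re := by
  rw [qNum, Complex.div_ofReal_re]
  refine div_pos ?_ ht
  have := (Complex.abs_re_le_norm _).trans_lt (norm_exp_neg_mul_lt_one ht hs)
  simp only [Complex.sub_re, Complex.one_re]
  linarith [le_abs_self (Complex.exp (-(t * s))).re]

theorem qNum_mem_slitPlane {t : ℝ} (ht : 0 < t) {s : ℂ} (hs : 0 < s.re) :
    qNum t s ∈ Complex.slitPlane := Or.inl (qNum_re_pos ht hs)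

theorem qNum_ne_zero {t : ℝ} (ht : 0 < t) {s : ℂ} (hs : 0 < s.re) : qNum t s ≠ 0 :=
  Complex.slitPlane_ne_zero (qNum_mem_slitPlane ht hs)

theorem exp_sub_one_ne_zero {t : ℝ} (ht : 0 < t) {s : ℂ} (hs : 0 < s.re) :
    Complex.exp (t * s) - 1 ≠ 0 := by
  intro h
  have h1 := norm_exp_neg_mul_lt_one ht hs
  rw [Complex.exp_neg, sub_eq_zero.1 h] at h1
  simp at h1

theorem hasDerivAt_log_qNum {t : ℝ} (ht : 0 < t) {s : ℂ} (hs : 0 < s.re) :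
    HasDerivAt (fun s => Complex.log (qNum t s)) (t / (Complex.exp (t * s) - 1)) s := by
  have h1 : HasDerivAt (qNum t) (Complex.exp (-(t * s))) s := by
    have := (((((hasDerivAt_id s).const_mul (t : ℂ)).neg).cexp).const_sub 1).div_const (t : ℂ)
    refine this.congr_deriv ?_
    have : (t : ℂ) ≠ 0 := by exact_mod_cast ht.ne'
    simp only [Pi.neg_apply, id_eq]
    field_simp
  refine (h1.clog (qNum_mem_slitPlane ht hs)).congr_deriv ?_
  have h2 := exp_sub_one_ne_zero ht hs
  have h4 := Complex.exp_ne_zero (t * s)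
  have h3 : (t : ℂ) ≠ 0 := by exact_mod_cast ht.ne'
  rw [qNum, Complex.exp_neg]
  have h5 : 1 - (Complex.exp (t * s))⁻¹ = (Complex.exp (t * s) - 1) / Complex.exp (t * s) := by
    field_simp
  rw [h5]
  field_simp

theorem hasDerivAt_div_exp_sub_one {t : ℝ} (ht : 0 < t) {s : ℂ} (hs : 0 < s.re) :
    HasDerivAt (fun s => t / (Complex.exp (t * s) - 1))
      (-(t ^ 2 * Complex.exp (t * s) / (Complex.exp (t * s) - 1) ^ 2)) s := by
  have h := ((((hasDerivAt_id s).const_mul (t : ℂ)).cexp).sub_const 1).inv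
    (exp_sub_one_ne_zero ht hs)
  refine (h.const_mul (t : ℂ)).congr_deriv ?_
  simp only [id_eq]
  ring

/-- This is the second derivative of log `qNum t`. Its bound does not depend on t, which makes the
later dominations uniform as t → 0. -/
theorem norm_deriv_div_exp_sub_one_le {t : ℝ} (ht : 0 < t) {s : ℂ} (hs : 0 < s.re) :
    ‖-(t ^ 2 * Complex.exp (t * s) / (Complex.exp (t * s) - 1) ^ 2)‖ ≤ 1 / s.re ^ 2 := by
  set y := t * s.re with hy
  have hy0 : 0 < y := mul_pos ht hs
  have h1 : ‖Complex.exp (t * s)‖ = Real.exp y := by rw [Complex.norm_exp]; simp [hy]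
  have h2 : Real.exp y - 1 ≤ ‖Complex.exp (t * s) - 1‖ := by
    have := norm_sub_norm_le (Complex.exp (t * s)) 1
    rwa [h1, norm_one] at this
  have h3 : 0 < Real.exp y - 1 := by linarith [Real.add_one_lt_exp hy0.ne']
  -- After dividing by e^y and taking square roots this is y/2 ≤ sinh(y/2).
  have h4 : y ^ 2 * Real.exp y ≤ (Real.exp y - 1) ^ 2 := by
    have hsinh : y / 2 ≤ Real.sinh (y / 2) := Real.self_le_sinh_iff.2 (by positivity)
    rw [Real.sinh_eq] at hsinh
    set E := Real.exp (y / 2) with hE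
    have hE0 : 0 < E := Real.exp_pos _
    have hEy : Real.exp y = E * E := by rw [hE, ← Real.exp_add]; congr 1; ring
    rw [Real.exp_neg, ← hE] at hsinh
    have h5 : y * E ≤ E * E - 1 := by
      have := mul_le_mul_of_nonneg_right hsinh hE0.le
      have h6 : (E - E⁻¹) / 2 * E = (E * E - 1) / 2 := by field_simp
      rw [h6] at this
      linarith
    have h7 : 0 ≤ y * E := by positivity
    rw [hEy]
    calc y ^ 2 * (E * E) = (y * E) ^ 2 := by ring
      _ ≤ _ := pow_le_pow_left₀ h7 h5 2
  have h8 := h3.trans_le h2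
  rw [norm_neg, norm_div, norm_mul, norm_pow, norm_pow, h1, Complex.norm_real, Real.norm_eq_abs,
    abs_of_pos ht, div_le_div_iff₀ (by positivity) (by positivity)]
  calc t ^ 2 * Real.exp y * s.re ^ 2 = y ^ 2 * Real.exp y := by rw [hy]; ring
    _ ≤ (Real.exp y - 1) ^ 2 := h4
    _ ≤ 1 * ‖Complex.exp (t * s) - 1‖ ^ 2 := by rw [one_mul]; gcongr

/-- The terms of the series for the logarithm of `Γ_q`, with `q = e^{-t}`. -/
def logQGammaTerm (t : ℝ) (z : ℂ) (n : ℕ) : ℂ :=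
  Complex.log (qNum t (n + 1)) - Complex.log (qNum t (n + z)) +
    (z - 1) * (Complex.log (qNum t (n + 1 + 1)) - Complex.log (qNum t (n + 1)))

/-- The terms of the series for the logarithm of `Γ`. -/
def logGammaTerm (z : ℂ) (n : ℕ) : ℂ :=
  Complex.log (n + 1) - Complex.log (n + z) +
    (z - 1) * (Complex.log (n + 1 + 1) - Complex.log (n + 1))

theorem norm_logQGammaTerm_le {t : ℝ} (ht : 0 < t) {c R : ℝ} (hc : 0 < c) (hc1 : c ≤ 1) {z : ℂ}
    (hz : c ≤ z.re) (hR : ‖z - 1‖ ≤ R) (n : ℕ) :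
    ‖logQGammaTerm t z n‖ ≤ (R ^ 2 + R) / c ^ 2 * (1 / ((n : ℝ) + 1) ^ 2) := by
  have hR0 : 0 ≤ R := (norm_nonneg _).trans hR
  have hn : (0 : ℝ) ≤ n := n.cast_nonneg
  have hcn : 0 < n + c := by linarith
  have T := fun {a b : ℂ} (ha : (n + c) ≤ a.re) (hb : n + c ≤ b.re) =>
    norm_sub_sub_mul_le_of_re (f := fun s => Complex.log (qNum t s)) (M := 1 / (n + c) ^ 2)
      (fun s hs => hasDerivAt_log_qNum ht (hcn.trans_le hs))
      (fun s hs => hasDerivAt_div_exp_sub_one ht (hcn.trans_le hs))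
      (fun s hs => (norm_deriv_div_exp_sub_one_le ht (hcn.trans_le hs)).trans (by gcongr)) ha hb
  have h1 := T (a := n + 1) (b := n + z) (by simpa using hc1) (by simpa using hz)
  have h2 := T (a := n + 1) (b := n + 1 + 1) (by simpa using hc1) (by simp; linarith)
  set A := Complex.log (qNum t (n + z)) - Complex.log (qNum t (n + 1)) -
    t / (Complex.exp (t * (n + 1)) - 1) * (n + z - (n + 1))
  set B := Complex.log (qNum t (n + 1 + 1)) - Complex.log (qNum t (n + 1)) -
    t / (Complex.exp (t * (n + 1)) - 1) * (n + 1 + 1 - (n + 1))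
  -- Both increments of log `qNum` are expanded at the same point n + 1. The linear parts are (z-1)
  -- times the derivative in each and cancel, leaving two second-order remainders.
  have e : logQGammaTerm t z n = (z - 1) * B - A := by
    simp only [logQGammaTerm, A, B]; ring
  have hA : ‖A‖ ≤ 1 / (n + c) ^ 2 * R ^ 2 := h1.trans (by
    rw [show (n : ℂ) + z - (n + 1) = z - 1 by ring]; gcongr)
  have hB : ‖B‖ ≤ 1 / (n + c) ^ 2 := h2.trans (by
    rw [show (n : ℂ) + 1 + 1 - (n + 1) = 1 by ring]; simp)
  have hcc : c * (n + 1) ≤ n + c := by nlinarith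
  calc ‖logQGammaTerm t z n‖ ≤ ‖z - 1‖ * ‖B‖ + ‖A‖ := by
        rw [e, ← norm_mul]; exact norm_sub_le _ _
    _ ≤ R * (1 / (n + c) ^ 2) + 1 / (n + c) ^ 2 * R ^ 2 := by gcongr
    _ = (R ^ 2 + R) * (1 / (n + c) ^ 2) := by ring
    _ ≤ (R ^ 2 + R) * (1 / (c * (n + 1)) ^ 2) := by gcongr
    _ = _ := by field_simp

theorem summable_one_div_add_one_sq : Summable fun n : ℕ => 1 / ((n : ℝ) + 1) ^ 2 := by
  have := (summable_nat_add_iff 1).2 (Real.summable_one_div_nat_pow.2 (le_refl 2))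
  simpa using this

theorem summable_logQGammaTerm {t : ℝ} (ht : 0 < t) {z : ℂ} (hz : 0 < z.re) :
    Summable (logQGammaTerm t z) :=
  (summable_one_div_add_one_sq.mul_left _).of_norm_bounded
    (norm_logQGammaTerm_le ht (lt_min hz one_pos) (min_le_right _ _) (min_le_left _ _) le_rfl)

/-- A version of the limit `(1 - q^s) / t → s`. -/
theorem tendsto_qNum {α : Type*} {l : Filter α} {t : α → ℝ} {s : α → ℂ} {s₀ : ℂ}
    (ht : Tendsto t l (𝓝[>] 0)) (hs : Tendsto s l (𝓝 s₀)) :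
    Tendsto (fun x => qNum (t x) (s x)) l (𝓝 s₀) := by
  have ht0 : Tendsto (fun x => (t x : ℂ)) l (𝓝 0) := by
    have := (Complex.continuous_ofReal.tendsto 0).comp (ht.mono_right nhdsWithin_le_nhds)
    simpa [Function.comp_def] using this
  have htpos : ∀ᶠ x in l, 0 < t x := (tendsto_nhdsWithin_iff.1 ht).2
  have hd : ContinuousAt (dslope Complex.exp 0) 0 :=
    continuousAt_dslope_same.2 Complex.differentiableAt_exp
  have hu : Tendsto (fun x => -((t x : ℂ) * s x)) l (𝓝 0) := by
    simpa using (ht0.mul hs).neg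
  have h1 := (hd.tendsto.comp hu).mul hs
  rw [dslope_same, Complex.deriv_exp, Complex.exp_zero, one_mul] at h1
  refine h1.congr' ?_
  filter_upwards [htpos] with x hx
  have hx' : (t x : ℂ) ≠ 0 := by exact_mod_cast hx.ne'
  have h2 := sub_smul_dslope Complex.exp 0 (-((t x : ℂ) * s x))
  simp only [sub_zero, smul_eq_mul, Complex.exp_zero] at h2
  simp only [Function.comp_apply, qNum]
  rw [eq_div_iff hx']
  linear_combination -h2

theorem tendsto_logQGammaTerm {α : Type*} {l : Filter α} {t : α → ℝ} {z : α → ℂ} {z₀ : ℂ}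
    (ht : Tendsto t l (𝓝[>] 0)) (hz : Tendsto z l (𝓝 z₀)) (hz₀ : 0 < z₀.re) (n : ℕ) :
    Tendsto (fun x => logQGammaTerm (t x) (z x) n) l (𝓝 (logGammaTerm z₀ n)) := by
  have hn : (0 : ℝ) ≤ n := n.cast_nonneg
  have h1 : Tendsto (fun x => Complex.log (qNum (t x) (n + 1))) l (𝓝 (Complex.log (n + 1))) :=
    (tendsto_qNum ht tendsto_const_nhds).clog (Or.inl (by simp; linarith))
  have h2 : Tendsto (fun x => Complex.log (qNum (t x) (n + 1 + 1))) l
      (𝓝 (Complex.log (n + 1 + 1))) :=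
    (tendsto_qNum ht tendsto_const_nhds).clog (Or.inl (by simp; linarith))
  have h3 : Tendsto (fun x => Complex.log (qNum (t x) (n + z x))) l (𝓝 (Complex.log (n + z₀))) :=
    (tendsto_qNum ht (hz.const_add _)).clog (Or.inl (by simp; linarith))
  exact (h1.sub h3).add ((hz.sub_const 1).mul (h2.sub h1))

theorem norm_logGammaTerm_le {c R : ℝ} (hc : 0 < c) (hc1 : c ≤ 1) {z : ℂ}
    (hz : c ≤ z.re) (hR : ‖z - 1‖ ≤ R) (n : ℕ) :
    ‖logGammaTerm z n‖ ≤ (R ^ 2 + R) / c ^ 2 * (1 / ((n : ℝ) + 1) ^ 2) :=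
  le_of_tendsto (tendsto_logQGammaTerm (l := 𝓝[>] (0 : ℝ)) (t := id) (z := fun _ => z) tendsto_id
    tendsto_const_nhds (hc.trans_le hz) n).norm
    (eventually_nhdsWithin_of_forall fun _ ht => norm_logQGammaTerm_le ht hc hc1 hz hR n)

theorem tendsto_tsum_logQGammaTerm {α : Type*} {l : Filter α} {t : α → ℝ} {z : α → ℂ} {z₀ : ℂ}
    (ht : Tendsto t l (𝓝[>] 0)) (hz : Tendsto z l (𝓝 z₀)) (hz₀ : 0 < z₀.re) :
    Tendsto (fun x => ∑' n, logQGammaTerm (t x) (z x) n) l (𝓝 (∑' n, logGammaTerm z₀ n)) := by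
  have h1 : ∀ᶠ x in l, z₀.re / 2 < (z x).re :=
    ((Complex.continuous_re.tendsto z₀).comp hz).eventually_const_lt (by linarith)
  have h2 : ∀ᶠ x in l, ‖z x - 1‖ < ‖z₀ - 1‖ + 1 :=
    ((hz.sub_const 1).norm).eventually_lt_const (by linarith)
  refine tendsto_tsum_of_dominated_convergence (summable_one_div_add_one_sq.mul_left
    (((‖z₀ - 1‖ + 1) ^ 2 + (‖z₀ - 1‖ + 1)) / (min (z₀.re / 2) 1) ^ 2))
    (fun n => tendsto_logQGammaTerm ht hz hz₀ n) ?_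
  filter_upwards [h1, h2, (tendsto_nhdsWithin_iff.1 ht).2] with x hx1 hx2 hx3 n
  exact norm_logQGammaTerm_le hx3 (lt_min (by linarith) one_pos) (min_le_right _ _)
    ((min_le_left _ _).trans hx1.le) hx2.le n

/-- The terms proportional to z - 1 telescope to (z-1) log(N+1), giving Euler's product for Γ up to
factors tending to 1. -/
theorem exp_sum_logGammaTerm {z : ℂ} (hz : 0 < z.re) (N : ℕ) :
    Complex.exp (∑ n ∈ Finset.range N, logGammaTerm z n) =
      (∏ n ∈ Finset.range N, ((n : ℂ) + 1) / (n + z)) *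
        Complex.exp ((z - 1) * Complex.log (N + 1)) := by
  induction N with
  | zero => simp
  | succ N ih =>
    have hN : (0 : ℝ) ≤ N := N.cast_nonneg
    have h1 : (N : ℂ) + 1 ≠ 0 := by exact_mod_cast N.succ_ne_zero
    have h2 : (N : ℂ) + z ≠ 0 := fun h => by
      have := congrArg Complex.re h
      simp at this
      linarith
    rw [Finset.sum_range_succ, Complex.exp_add, ih, Finset.prod_range_succ, logGammaTerm,
      Complex.exp_add, Complex.exp_sub, Complex.exp_log h1, Complex.exp_log h2, mul_sub,
      Complex.exp_sub]
    have := Complex.exp_ne_zero ((z - 1) * Complex.log (N + 1))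
    push_cast
    field_simp

theorem exp_sum_logQGammaTerm {t : ℝ} (ht : 0 < t) {z : ℂ} (hz : 0 < z.re) (N : ℕ) :
    Complex.exp (∑ n ∈ Finset.range N, logQGammaTerm t z n) =
      (∏ n ∈ Finset.range N, qNum t (n + 1) / qNum t (n + z)) *
        Complex.exp ((z - 1) * (Complex.log (qNum t (N + 1)) - Complex.log (qNum t 1))) := by
  induction N with
  | zero => simp
  | succ N ih =>
    have hN : (0 : ℝ) ≤ N := N.cast_nonneg
    have h1 : qNum t (N + 1) ≠ 0 := qNum_ne_zero ht (by simp; linarith)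
    have h2 : qNum t (N + z) ≠ 0 := qNum_ne_zero ht (by simp; linarith)
    rw [Finset.sum_range_succ, Complex.exp_add, ih, Finset.prod_range_succ, logQGammaTerm,
      Complex.exp_add, Complex.exp_sub, Complex.exp_log h1, Complex.exp_log h2]
    simp only [mul_sub, Complex.exp_sub]
    have := Complex.exp_ne_zero ((z - 1) * Complex.log (qNum t (N + 1)))
    push_cast
    field_simp

theorem Gamma_eq_exp_tsum {z : ℂ} (hz : 0 < z.re) :
    Complex.Gamma z = Complex.exp (∑' n, logGammaTerm z n) := by
  have hs : Summable (logGammaTerm z) := (summable_one_div_add_one_sq.mul_left _).of_norm_bounded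
    (norm_logGammaTerm_le (lt_min hz one_pos) (min_le_right _ _) (min_le_left _ _) le_rfl)
  have h1 := (Complex.continuous_exp.tendsto _).comp hs.hasSum.tendsto_sum_nat
  have hinv : Tendsto (fun N : ℕ => ((N : ℂ))⁻¹) atTop (𝓝 0) :=
    tendsto_inv_atTop_nhds_zero_nat
  -- The discrepancy with `Complex.GammaSeq`: Euler's sequence uses N^z where the telescoped sum has
  -- (N+1)^(z-1), and it has one more factor z + N in the denominator.
  have h2 : Tendsto (fun N : ℕ => Complex.exp (-((z - 1) * Complex.log (1 + (N : ℂ)⁻¹))) *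
      (1 + z * (N : ℂ)⁻¹)⁻¹) atTop (𝓝 1) := by
    have a1 : Tendsto (fun N : ℕ => Complex.log (1 + (N : ℂ)⁻¹)) atTop (𝓝 0) := by
      have := (hinv.const_add 1).clog (by simp)
      simpa using this
    have a2 : Tendsto (fun N : ℕ => (1 + z * (N : ℂ)⁻¹)⁻¹) atTop (𝓝 1) := by
      have := ((hinv.const_mul z).const_add 1).inv₀ (by simp)
      simpa using this
    have a3 := (Complex.continuous_exp.tendsto _).comp (a1.const_mul (z - 1)).neg
    simpa [Function.comp_def] using a3.mul a2
  have h3 := h1.mul h2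
  rw [mul_one] at h3
  refine tendsto_nhds_unique (Complex.GammaSeq_tendsto_Gamma z) (h3.congr' ?_)
  filter_upwards [eventually_gt_atTop 0] with N hN
  have hN0 : (N : ℂ) ≠ 0 := by exact_mod_cast hN.ne'
  have hne : ∀ n : ℕ, (n : ℂ) + z ≠ 0 := fun n h => by
    have := congrArg Complex.re h
    have hn : (0 : ℝ) ≤ n := n.cast_nonneg
    simp at this
    linarith
  have hlog : Complex.log (1 + (N : ℂ)⁻¹) = Complex.log (N + 1) - Complex.log N := by
    have e : (1 : ℂ) + (N : ℂ)⁻¹ = (((N + 1 : ℝ) / (N : ℝ) : ℝ) : ℂ) := by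
      push_cast; field_simp
    rw [e, ← Complex.ofReal_log (by positivity), Real.log_div (by positivity) (by positivity)]
    push_cast [Complex.ofReal_log (show (0 : ℝ) ≤ N + 1 by positivity)]
    simp
  simp only [Function.comp_apply]
  rw [exp_sum_logGammaTerm hz, hlog, Complex.GammaSeq, Finset.prod_div_distrib,
    Finset.prod_range_succ, Complex.cpow_def_of_ne_zero hN0]
  have hf : (∏ n ∈ Finset.range N, ((n : ℂ) + 1)) = N.factorial := by
    rw [← Finset.prod_range_add_one_eq_factorial]; push_cast; rfl
  have hp : (∏ j ∈ Finset.range N, (z + (j : ℂ))) = ∏ j ∈ Finset.range N, ((j : ℂ) + z) :=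
    Finset.prod_congr rfl fun j _ => add_comm _ _
  rw [hf, hp]
  have hp0 : (∏ j ∈ Finset.range N, ((j : ℂ) + z)) ≠ 0 := Finset.prod_ne_zero_iff.2 fun n _ => hne n
  have e1 : 1 + z * (N : ℂ)⁻¹ = (z + N) / N := by field_simp; ring
  have e2 : Complex.exp (-((z - 1) * (Complex.log (N + 1) - Complex.log N))) =
      Complex.exp (Complex.log N * z) / N / Complex.exp ((z - 1) * Complex.log (N + 1)) := by
    have : Complex.exp (Complex.log N * z) / N = Complex.exp ((z - 1) * Complex.log N) := by
      nth_rewrite 2 [← Complex.exp_log hN0]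
      rw [← Complex.exp_sub]; congr 1; ring
    rw [this, ← Complex.exp_sub]; congr 1; ring
  have hzN : z + N ≠ 0 := by rw [add_comm]; exact hne N
  have := Complex.exp_ne_zero ((z - 1) * Complex.log (N + 1))
  rw [e1, e2]
  field_simp

/-! ### The infinite products defining `qGamma` and their limit as q → 1. -/

theorem exp_neg_cpow (t : ℝ) (x : ℂ) :
    ((Real.exp (-t) : ℝ) : ℂ) ^ x = Complex.exp (-(t * x)) := by
  rw [Complex.ofReal_exp, Complex.cpow_def_of_ne_zero (Complex.exp_ne_zero _),
    ← Complex.ofReal_exp, ← Complex.ofReal_log (Real.exp_pos _).le, Real.log_exp]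
  congr 1; push_cast; ring

theorem one_sub_cpow_mul_pow {t : ℝ} (ht : 0 < t) (x : ℂ) (l : ℕ) :
    1 - ((Real.exp (-t) : ℝ) : ℂ) ^ x * ((Real.exp (-t) : ℝ) : ℂ) ^ l = t * qNum t (l + x) := by
  have h3 : (t : ℂ) ≠ 0 := by exact_mod_cast ht.ne'
  rw [exp_neg_cpow, Complex.ofReal_exp, ← Complex.exp_nat_mul, ← Complex.exp_add, qNum,
    mul_div_cancel₀ _ h3]
  congr 2; push_cast; ring

theorem exp_neg_mem_Ioo {t : ℝ} (ht : 0 < t) : Real.exp (-t) ∈ Set.Ioo (0 : ℝ) 1 :=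
  ⟨Real.exp_pos _, Real.exp_lt_one_iff.2 (by linarith)⟩

theorem summable_norm_mul_pow (a : ℂ) {q : ℝ} (hq : q ∈ Set.Ioo (0 : ℝ) 1) :
    Summable fun l : ℕ => ‖-(a * (q : ℂ) ^ l)‖ := by
  simp only [norm_neg, norm_mul, norm_pow, Complex.norm_real, Real.norm_eq_abs, abs_of_pos hq.1]
  exact (summable_geometric_of_lt_one hq.1.le hq.2).mul_left _

theorem tendsto_qPoch (a : ℂ) {q : ℝ} (hq : q ∈ Set.Ioo (0 : ℝ) 1) :
    Tendsto (qPoch a q) atTop (𝓝 (qPochInf a q)) := by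
  have h := multipliable_one_add_of_summable (summable_norm_mul_pow a hq)
  simp only [← sub_eq_add_neg] at h
  exact h.hasProd.tendsto_prod_nat

theorem qPochInf_self_ne_zero {q : ℝ} (hq : q ∈ Set.Ioo (0 : ℝ) 1) : qPochInf q q ≠ 0 := by
  have := tprod_one_add_ne_zero_of_summable (f := fun l : ℕ => -((q : ℂ) * (q : ℂ) ^ l))
    (fun l => ?_) (summable_norm_mul_pow q hq)
  · simpa only [qPochInf, ← sub_eq_add_neg] using this
  · rw [← sub_eq_add_neg, ← pow_succ', sub_ne_zero]
    have : q ^ (l + 1) ≠ 1 := (pow_lt_one₀ hq.1.le hq.2 l.succ_ne_zero).ne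
    exact_mod_cast this.symm

theorem qGamma_eq_exp_tsum {t : ℝ} (ht : 0 < t) {z : ℂ} (hz : 0 < z.re) :
    qGamma (Real.exp (-t)) z = Complex.exp (∑' n, logQGammaTerm t z n) := by
  have hq := exp_neg_mem_Ioo ht
  set q := Real.exp (-t) with hqdef
  have h3 : (t : ℂ) ≠ 0 := by exact_mod_cast ht.ne'
  have h1 := (Complex.continuous_exp.tendsto _).comp
    (summable_logQGammaTerm ht hz).hasSum.tendsto_sum_nat
  have hq1 : (q : ℂ) = (q : ℂ) ^ (1 : ℂ) := by rw [Complex.cpow_one]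
  have hre : ∀ n : ℕ, ∀ w : ℂ, 0 < w.re → 0 < ((n : ℂ) + w).re := fun n w hw => by
    have hn : (0 : ℝ) ≤ n := n.cast_nonneg
    simp; linarith
  -- Kept free of division by `qPoch (q ^ z) q N`, so that the limit can be taken before the
  -- infinite product is known to be nonzero.
  have hN : ∀ N, qPoch q q N * Complex.exp ((z - 1) *
      (Complex.log (qNum t (N + 1)) - Complex.log (qNum t 1))) =
      qPoch ((q : ℂ) ^ z) q N * Complex.exp (∑ n ∈ Finset.range N, logQGammaTerm t z n) := by
    intro N
    rw [exp_sum_logQGammaTerm ht hz]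
    have e1 : qPoch q q N = ∏ n ∈ Finset.range N, t * qNum t (n + 1) := by
      rw [qPoch]
      refine Finset.prod_congr rfl fun n _ => ?_
      rw [← one_sub_cpow_mul_pow ht, ← hqdef, Complex.cpow_one]
    have e2 : qPoch ((q : ℂ) ^ z) q N = ∏ n ∈ Finset.range N, t * qNum t (n + z) :=
      Finset.prod_congr rfl fun n _ => one_sub_cpow_mul_pow ht _ _
    rw [e1, e2, ← mul_assoc, ← Finset.prod_mul_distrib]
    congr 1
    refine Finset.prod_congr rfl fun n _ => ?_
    have := qNum_ne_zero ht (hre n z hz)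
    field_simp
  have hlim : Tendsto (fun N : ℕ => qNum t (N + 1)) atTop (𝓝 ((1 / t : ℝ) : ℂ)) := by
    have h0 : Tendsto (fun N : ℕ => (q : ℂ) ^ (N + 1)) atTop (𝓝 0) :=
      (tendsto_pow_atTop_nhds_zero_of_norm_lt_one (by
        rw [Complex.norm_real, Real.norm_eq_abs, abs_of_pos hq.1]; exact hq.2)).comp
        (tendsto_add_atTop_nat 1)
    have := (h0.const_sub 1).div_const (t : ℂ)
    rw [sub_zero] at this
    push_cast
    refine this.congr fun N => ?_
    rw [qNum, hqdef, Complex.ofReal_exp, ← Complex.exp_nat_mul]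
    -- The q-number of N + 1 tends to 1/t, while that of 1 is (1-q)/t; the quotient raised to z - 1
    -- produces the factor (1-q)^(1-z) of Γ_q.
    congr 3; push_cast; ring
  have hlog := ((hlim.clog (Or.inl (by rw [Complex.ofReal_re]; positivity))).sub_const
    (Complex.log (qNum t 1))).const_mul (z - 1)
  have h4 := (tendsto_qPoch q hq).mul ((Complex.continuous_exp.tendsto _).comp hlog)
  have h5 := (tendsto_qPoch ((q : ℂ) ^ z) hq).mul h1
  have h6 := tendsto_nhds_unique (h4.congr hN) h5
  have h1q : 0 < 1 - q := by linarith [hq.2]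
  have e3 : Complex.exp ((z - 1) * (Complex.log ((1 / t : ℝ) : ℂ) - Complex.log (qNum t 1))) =
      ((1 - q : ℝ) : ℂ) ^ (1 - z) := by
    have e4 : qNum t 1 = (((1 - q) / t : ℝ) : ℂ) := by
      rw [qNum, hqdef]; push_cast; simp
    rw [Complex.cpow_def_of_ne_zero (by exact_mod_cast h1q.ne'), e4,
      ← Complex.ofReal_log (by positivity), ← Complex.ofReal_log (by positivity),
      ← Complex.ofReal_log h1q.le, Real.log_div h1q.ne' ht.ne', Real.log_div one_ne_zero ht.ne',
      Real.log_one]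
    congr 1; push_cast; ring
  rw [e3] at h6
  -- If it vanished, the limiting identity would make a product of nonzero factors equal to zero.
  have hne : qPochInf ((q : ℂ) ^ z) q ≠ 0 := by
    intro h0
    rw [h0, zero_mul] at h6
    refine mul_ne_zero (qPochInf_self_ne_zero hq) ?_ h6
    rw [Complex.cpow_def_of_ne_zero (by exact_mod_cast h1q.ne')]
    exact Complex.exp_ne_zero _
  rw [qGamma, div_mul_eq_mul_div, h6, mul_div_cancel_left₀ _ hne]

/-- The functional equation of Γ_q, written so as to extend the limit from Re z > 0 to Re z > -1.
This is needed for the arguments (i-k)/5, which can be negative but exceed -1. -/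
theorem qGamma_add_one {t : ℝ} (ht : 0 < t) {x : ℂ} (hx : qNum t x ≠ 0) :
    qGamma (Real.exp (-t)) x = qGamma (Real.exp (-t)) (x + 1) * (qNum t 1 / qNum t x) := by
  have hq := exp_neg_mem_Ioo ht
  have h3 : (t : ℂ) ≠ 0 := by exact_mod_cast ht.ne'
  have h1q : (0 : ℝ) < 1 - Real.exp (-t) := by linarith [hq.2]
  have h1q' : ((1 - Real.exp (-t) : ℝ) : ℂ) ≠ 0 := by exact_mod_cast h1q.ne'
  set q := Real.exp (-t) with hqdef
  have hq0 : (q : ℂ) ≠ 0 := by exact_mod_cast hq.1.ne'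
  have e1 : qPochInf ((q : ℂ) ^ x) q = t * qNum t x * qPochInf ((q : ℂ) ^ (x + 1)) q := by
    have h := tendsto_qPoch ((q : ℂ) ^ x) hq
    have h2 := (tendsto_qPoch ((q : ℂ) ^ (x + 1)) hq).const_mul (t * qNum t x)
    refine tendsto_nhds_unique ((tendsto_add_atTop_iff_nat 1).2 h) (h2.congr fun N => ?_)
    rw [qPoch, qPoch, Finset.prod_range_succ', mul_comm]
    congr 1
    · refine Finset.prod_congr rfl fun n _ => ?_
      rw [Complex.cpow_add _ _ hq0, Complex.cpow_one, pow_succ]; ring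
    · have := one_sub_cpow_mul_pow ht x 0
      rw [← hqdef] at this
      simpa using this.symm
  have e2 : qNum t 1 = ((1 - q : ℝ) : ℂ) / t := by rw [qNum, hqdef]; push_cast; simp
  have e3 : ((1 - q : ℝ) : ℂ) ^ (1 - x) = ((1 - q : ℝ) : ℂ) ^ (1 - (x + 1)) * ((1 - q : ℝ) : ℂ) := by
    nth_rewrite 3 [← Complex.cpow_one ((1 - q : ℝ) : ℂ)]
    rw [← Complex.cpow_add _ _ h1q']
    congr 1; ring
  rw [qGamma, qGamma, e1, e2, e3]
  -- If the product vanishes, both quotients are 0 by the convention for division by zero.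
  by_cases h0 : qPochInf ((q : ℂ) ^ (x + 1)) q = 0
  · simp [h0]
  · field_simp

theorem tendsto_qGamma_of_re_pos {α : Type*} {l : Filter α} {t : α → ℝ} {z : α → ℂ} {z₀ : ℂ}
    (ht : Tendsto t l (𝓝[>] 0)) (hz : Tendsto z l (𝓝 z₀)) (hz₀ : 0 < z₀.re) :
    Tendsto (fun x => qGamma (Real.exp (-t x)) (z x)) l (𝓝 (Complex.Gamma z₀)) := by
  rw [Gamma_eq_exp_tsum hz₀]
  refine ((Complex.continuous_exp.tendsto _).comp (tendsto_tsum_logQGammaTerm ht hz hz₀)).congr' ?_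
  filter_upwards [(tendsto_nhdsWithin_iff.1 ht).2,
    ((Complex.continuous_re.tendsto z₀).comp hz).eventually_const_lt hz₀] with x hx hx2
  exact (qGamma_eq_exp_tsum hx hx2).symm

theorem tendsto_qGamma {α : Type*} {l : Filter α} {t : α → ℝ} {z : α → ℂ} {z₀ : ℂ}
    (ht : Tendsto t l (𝓝[>] 0)) (hz : Tendsto z l (𝓝 z₀)) (hz₀ : -1 < z₀.re) (hne : z₀ ≠ 0) :
    Tendsto (fun x => qGamma (Real.exp (-t x)) (z x)) l (𝓝 (Complex.Gamma z₀)) := by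
  have h1 := tendsto_qGamma_of_re_pos ht (hz.add_const 1) (by simp; linarith)
  have h2 := (tendsto_qNum ht (tendsto_const_nhds (x := (1 : ℂ)))).div (tendsto_qNum ht hz) hne
  have h3 := h1.mul h2
  rw [Complex.Gamma_add_one _ hne, mul_one_div, mul_div_cancel_left₀ _ hne] at h3
  refine h3.congr' ?_
  filter_upwards [(tendsto_nhdsWithin_iff.1 ht).2, (tendsto_qNum ht hz).eventually_ne hne]
    with x hx hx2
  exact (qGamma_add_one hx hx2).symm

theorem qGamma_ne_zero {t : ℝ} (ht : 0 < t) {z : ℂ} (hz : 0 < z.re) :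
    qGamma (Real.exp (-t)) z ≠ 0 := by
  rw [qGamma_eq_exp_tsum ht hz]; exact Complex.exp_ne_zero _

theorem differentiableOn_qGamma {t : ℝ} (ht : 0 < t) :
    DifferentiableOn ℂ (qGamma (Real.exp (-t))) {z | 0 < z.re} := by
  intro z₀ hz₀
  have hz₀' : 0 < z₀.re := hz₀
  set V : Set ℂ := {z | z₀.re / 2 < z.re} ∩ Metric.ball 1 (‖z₀ - 1‖ + 1) with hV
  have hVo : IsOpen V :=
    (isOpen_lt continuous_const Complex.continuous_re).inter Metric.isOpen_ball
  have hzV : z₀ ∈ V := ⟨by simp only [Set.mem_ofPred_eq]; linarith,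
    by rw [Metric.mem_ball, dist_eq_norm]; linarith⟩
  have hd : DifferentiableOn ℂ (fun z => ∑' n, logQGammaTerm t z n) V := by
    refine Complex.differentiableOn_tsum_of_summable_norm
      (summable_one_div_add_one_sq.mul_left
        (((‖z₀ - 1‖ + 1) ^ 2 + (‖z₀ - 1‖ + 1)) / (min (z₀.re / 2) 1) ^ 2)) (fun n z hz => ?_) hVo
      fun n z hz => ?_
    · have hn : (0 : ℝ) ≤ n := n.cast_nonneg
      have h0 : 0 < ((n : ℂ) + z).re := by
        have : z₀.re / 2 < z.re := hz.1
        simp; linarith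
      have h1 : HasDerivAt (fun z : ℂ => (n : ℂ) + z) 1 z := (hasDerivAt_id z).const_add _
      have := ((hasDerivAt_log_qNum ht h0).comp z h1).differentiableAt
      have h2 : DifferentiableAt ℂ (fun z : ℂ => Complex.log (qNum t (n + z))) z := this
      exact (((differentiableAt_const _).sub h2).add
        ((differentiableAt_id.sub_const 1).mul_const _)).differentiableWithinAt
    · have h1 : z₀.re / 2 < z.re := hz.1
      have h2 : ‖z - 1‖ < ‖z₀ - 1‖ + 1 := by simpa [dist_eq_norm] using hz.2
      exact norm_logQGammaTerm_le ht (lt_min (by linarith) one_pos) (min_le_right _ _)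
        ((min_le_left _ _).trans h1.le) h2.le n
  have h := (hd.differentiableAt (hVo.mem_nhds hzV)).cexp
  refine (h.congr_of_eventuallyEq ?_).differentiableWithinAt
  filter_upwards [hVo.mem_nhds hzV] with z hz
  have h1 : z₀.re / 2 < z.re := hz.1
  exact qGamma_eq_exp_tsum ht (by linarith)

/-! ### Theta functions -/

/-- Completing d(d-1)/2 to d²/2 shifts the elliptic variable by t/2, so θ_q becomes a Jacobi theta
function with modulus it/(2π), to which the modular transformation applies. -/
theorem theta_exp (t : ℝ) (z : ℂ) :
    theta (Real.exp (-t)) (Complex.exp z) =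
      jacobiTheta₂ ((z + t / 2) / (2 * Real.pi * Complex.I)) (Complex.I * t / (2 * Real.pi)) := by
  rw [theta, jacobiTheta₂]
  refine tsum_congr fun d => ?_
  have hpi : (Real.pi : ℂ) ≠ 0 := by exact_mod_cast Real.pi_ne_zero
  have hI := Complex.I_ne_zero
  have he : ((d * (d - 1) / 2 : ℤ) : ℂ) = d * (d - 1) / 2 := by
    rw [Int.cast_div (Int.even_mul_pred_self d).two_dvd (by norm_num)]; push_cast; ring
  rw [Complex.ofReal_exp, ← Complex.exp_int_mul, ← Complex.exp_int_mul, ← Complex.exp_add,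
    jacobiTheta₂_term, he]
  congr 1
  push_cast
  field_simp
  linear_combination ((d : ℂ) ^ 2 * t) * (-Complex.I_sq)

/-- The modular dual of the theta function, normalised to tend to `1` as `t → 0`. -/
def thetaDual (t : ℝ) (z : ℂ) : ℂ :=
  jacobiTheta₂ (-(z + t / 2) / t) (2 * Real.pi * Complex.I / t)

theorem theta_exp_eq_thetaDual {t : ℝ} (ht : 0 < t) (z : ℂ) :
    theta (Real.exp (-t)) (Complex.exp z) =
      1 / ((t / (2 * Real.pi) : ℝ) : ℂ) ^ (1 / 2 : ℂ) *
        Complex.exp ((z + t / 2) ^ 2 / (2 * t)) * thetaDual t z := by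
  have hpi : (Real.pi : ℂ) ≠ 0 := by exact_mod_cast Real.pi_ne_zero
  have hI := Complex.I_ne_zero
  have ht' : (t : ℂ) ≠ 0 := by exact_mod_cast ht.ne'
  rw [theta_exp, jacobiTheta₂_functional_equation, thetaDual]
  congr 2
  · congr 2
    push_cast
    field_simp
    linear_combination -Complex.I_sq
  · congr 1
    field_simp
    linear_combination (-(z * 2 + t) ^ 2) * Complex.I_sq
  · field_simp
    linear_combination (2 * z + t) * Complex.I_sq
  · field_simp
    linear_combination -Complex.I_sq

theorem norm_jacobiTheta₂_term_dual {t : ℝ} (n : ℤ) (z : ℂ) :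
    ‖jacobiTheta₂_term n (-(z + t / 2) / t) (2 * Real.pi * Complex.I / t)‖ =
      Real.exp (-(2 * Real.pi / t) * (Real.pi * n ^ 2 - n * z.im)) := by
  rw [norm_jacobiTheta₂_term, Complex.div_ofReal_im, Complex.div_ofReal_im]
  congr 1
  simp
  ring

theorem norm_jacobiTheta₂_term_dual_le {t S : ℝ} (ht : 0 < t) {z : ℂ}
    (hz : |z.im| ≤ S) (n : ℤ) :
    ‖jacobiTheta₂_term n (-(z + t / 2) / t) (2 * Real.pi * Complex.I / t)‖ ≤
      Real.exp (-(2 * Real.pi / t) * (Real.pi * n ^ 2 - S * |n|)) := by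
  rw [norm_jacobiTheta₂_term_dual]
  have h : (n : ℝ) * z.im ≤ S * |n| := by
    calc (n : ℝ) * z.im ≤ |(n : ℝ) * z.im| := le_abs_self _
      _ = |(n : ℝ)| * |z.im| := abs_mul _ _
      _ ≤ _ := by rw [mul_comm]; push_cast; gcongr
  have := Real.pi_pos
  apply Real.exp_le_exp.2
  rw [neg_mul, neg_mul, neg_le_neg_iff]
  gcongr

/-- The dual term of index n has size exp(-(2π/t)(πn² - n Im z)). For |Im z| ≤ S < π the exponent is
bounded away from 0 unless n = 0, so only that term survives as t → 0. -/
theorem sub_abs_le_of_ne_zero {S : ℝ} (hS : S < Real.pi) {n : ℤ} (hn : n ≠ 0) :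
    Real.pi - S ≤ Real.pi * n ^ 2 - S * |n| := by
  have h1 : (1 : ℝ) ≤ |n| := by exact_mod_cast Int.one_le_abs hn
  have h2 : ((n : ℝ)) ^ 2 = (|n| : ℤ) ^ 2 := by push_cast; rw [sq_abs]
  rw [h2]
  have h3 : 0 ≤ Real.pi * |n| + (Real.pi - S) := by
    have := mul_nonneg Real.pi_pos.le (zero_le_one.trans h1)
    linarith
  nlinarith [mul_nonneg (sub_nonneg.2 h1) h3]

theorem pi_mul_sq_sub_nonneg {S : ℝ} (hS' : S < Real.pi) (n : ℤ) :
    0 ≤ Real.pi * n ^ 2 - S * |n| := by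
  by_cases hn : n = 0
  · simp [hn]
  · linarith [sub_abs_le_of_ne_zero hS' hn]

theorem norm_jacobiTheta₂_term_dual_le_of_le_one {t S : ℝ} (ht : 0 < t) (ht1 : t ≤ 1) {z : ℂ}
    (hz : |z.im| ≤ S) (hS' : S < Real.pi) (n : ℤ) :
    ‖jacobiTheta₂_term n (-(z + t / 2) / t) (2 * Real.pi * Complex.I / t)‖ ≤
      Real.exp (-Real.pi * (2 * Real.pi * n ^ 2 - 2 * S * |n|)) := by
  refine (norm_jacobiTheta₂_term_dual_le ht hz n).trans (Real.exp_le_exp.2 ?_)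
  have h1 := pi_mul_sq_sub_nonneg hS' n
  have h2 : 2 * Real.pi ≤ 2 * Real.pi / t := by
    rw [le_div_iff₀ ht]; nlinarith [Real.pi_pos]
  nlinarith [mul_le_mul_of_nonneg_right h2 h1]

theorem tendsto_jacobiTheta₂_term_dual {α : Type*} {l : Filter α} {t : α → ℝ} {z : α → ℂ} {z₀ : ℂ}
    (ht : Tendsto t l (𝓝[>] 0)) (hz : Tendsto z l (𝓝 z₀)) (hz₀ : |z₀.im| < Real.pi) {n : ℤ}
    (hn : n ≠ 0) :
    Tendsto (fun x => jacobiTheta₂_term n (-(z x + t x / 2) / t x)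
      (2 * Real.pi * Complex.I / t x)) l (𝓝 0) := by
  obtain ⟨S, hS1, hS2⟩ := exists_between hz₀
  have hzS : ∀ᶠ x in l, |(z x).im| < S :=
    (((Complex.continuous_im.tendsto z₀).comp hz).abs).eventually_lt_const hS1
  refine squeeze_zero_norm' (a := fun x => Real.exp (-(2 * Real.pi * (Real.pi - S) * (t x)⁻¹))) ?_ ?_
  · filter_upwards [hzS, (tendsto_nhdsWithin_iff.1 ht).2] with x hx (hx2 : 0 < t x)
    refine (norm_jacobiTheta₂_term_dual_le hx2 hx.le n).trans (Real.exp_le_exp.2 ?_)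
    have h1 := sub_abs_le_of_ne_zero hS2 hn
    have h2 : 0 ≤ 2 * Real.pi / t x := by have := Real.pi_pos; positivity
    have h3 := mul_le_mul_of_nonneg_left h1 h2
    have h4 : 2 * Real.pi * (Real.pi - S) * (t x)⁻¹ = 2 * Real.pi / t x * (Real.pi - S) := by ring
    rw [h4]
    linarith
  · refine Real.tendsto_exp_neg_atTop_nhds_zero.comp ?_
    exact (tendsto_inv_nhdsGT_zero.comp ht).const_mul_atTop
      (mul_pos (by have := Real.pi_pos; positivity) (by linarith))

/-- Dominated convergence with the terms at t = 1 as majorant; only n = 0 survives, and it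
contributes 1 to the function and 0 to its derivative. The strip |Im z| < π corresponds to the slit
plane under z = log Q. -/
theorem tendsto_thetaDual {α : Type*} {l : Filter α} {t : α → ℝ} {z : α → ℂ} {z₀ : ℂ}
    (ht : Tendsto t l (𝓝[>] 0)) (hz : Tendsto z l (𝓝 z₀)) (hz₀ : |z₀.im| < Real.pi) :
    Tendsto (fun x => thetaDual (t x) (z x)) l (𝓝 1) ∧
    Tendsto (fun x => jacobiTheta₂' (-(z x + t x / 2) / t x) (2 * Real.pi * Complex.I / t x))
      l (𝓝 0) := by
  obtain ⟨S, hS1, hS2⟩ := exists_between hz₀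
  have hzS : ∀ᶠ x in l, |(z x).im| < S :=
    (((Complex.continuous_im.tendsto z₀).comp hz).abs).eventually_lt_const hS1
  have hev : ∀ᶠ x in l, ∀ n : ℤ,
      ‖jacobiTheta₂_term n (-(z x + t x / 2) / t x) (2 * Real.pi * Complex.I / t x)‖ ≤
      Real.exp (-Real.pi * (2 * Real.pi * n ^ 2 - 2 * S * |n|)) := by
    filter_upwards [hzS, (tendsto_nhdsWithin_iff.1 ht).2,
      ht.eventually (Ioo_mem_nhdsGT one_pos)] with x hx (hx2 : 0 < t x) hx3 n
    exact norm_jacobiTheta₂_term_dual_le_of_le_one hx2 hx3.2.le hx.le hS2 n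
  have hT : 0 < 2 * Real.pi := by have := Real.pi_pos; positivity
  constructor
  · have h1 : (1 : ℂ) = ∑' n : ℤ, if n = 0 then 1 else 0 := by simp
    rw [h1]
    have hb := summable_pow_mul_jacobiTheta₂_term_bound S hT 0
    simp only [pow_zero, one_mul] at hb
    refine tendsto_tsum_of_dominated_convergence hb (fun n => ?_) hev
    by_cases hn : n = 0
    · simp [hn, jacobiTheta₂_term, tendsto_const_nhds]
    · simpa [hn] using tendsto_jacobiTheta₂_term_dual ht hz hz₀ hn
  · have h1 : (0 : ℂ) = ∑' n : ℤ, (0 : ℂ) := by simp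
    rw [h1]
    have hb := (summable_pow_mul_jacobiTheta₂_term_bound S hT 1).mul_left (2 * Real.pi)
    refine tendsto_tsum_of_dominated_convergence hb (fun n => ?_) ?_
    · by_cases hn : n = 0
      · simp [hn, jacobiTheta₂'_term, tendsto_const_nhds]
      · simpa [jacobiTheta₂'_term] using
          (tendsto_jacobiTheta₂_term_dual ht hz hz₀ hn).const_mul (2 * Real.pi * Complex.I * n)
    · filter_upwards [hev] with x hx n
      rw [jacobiTheta₂'_term, norm_mul]
      have : ‖(2 * Real.pi * Complex.I * n : ℂ)‖ = 2 * Real.pi * |n| := by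
        simp [abs_of_pos Real.pi_pos]
      rw [this, mul_assoc, pow_one]
      have hp := Real.pi_pos
      gcongr
      exact hx n

theorem dual_im_pos {t : ℝ} (ht : 0 < t) : 0 < (2 * Real.pi * Complex.I / t : ℂ).im := by
  rw [Complex.div_ofReal_im]
  have := Real.pi_pos
  simp
  positivity

theorem hasDerivAt_thetaDual {t : ℝ} (ht : 0 < t) (z : ℂ) :
    HasDerivAt (thetaDual t)
      (-(jacobiTheta₂' (-(z + t / 2) / t) (2 * Real.pi * Complex.I / t)) / t) z := by
  have h1 : HasDerivAt (fun z : ℂ => -(z + t / 2) / t) (-1 / t) z :=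
    (((hasDerivAt_id z).add_const _).neg).div_const _
  have := (hasDerivAt_jacobiTheta₂_fst (-(z + t / 2) / t) (dual_im_pos ht)).comp z h1
  refine this.congr_deriv ?_
  ring

theorem thetaPrefactor_ne_zero {t : ℝ} (ht : 0 < t) :
    1 / ((t / (2 * Real.pi) : ℝ) : ℂ) ^ (1 / 2 : ℂ) ≠ 0 := by
  have : (t / (2 * Real.pi) : ℝ) ≠ 0 := by have := Real.pi_pos; positivity
  rw [Complex.cpow_def_of_ne_zero (by exact_mod_cast this)]
  exact div_ne_zero one_ne_zero (Complex.exp_ne_zero _)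

/-! ### The q-logarithm and quotients of theta functions in the limit. -/

/-- Logarithmic derivative of the Gaussian representation of θ_q: the Gaussian gives log Q + t/2,
and the dual theta function gives a correction that vanishes in the limit. Hence P^(ℓ_q(Q)) =
exp(-tHℓ_q(Q)) tends to Q^H. -/
theorem neg_mul_qLog_eq {t : ℝ} (ht : 0 < t) {Q : ℂ} (hQ : Q ∈ Complex.slitPlane)
    (hne : thetaDual t (Complex.log Q) ≠ 0) :
    -(t * qLog (Real.exp (-t)) Q) = Complex.log Q + t / 2 -
      jacobiTheta₂' (-(Complex.log Q + t / 2) / t) (2 * Real.pi * Complex.I / t) /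
        thetaDual t (Complex.log Q) := by
  have hQ0 := Complex.slitPlane_ne_zero hQ
  have ht' : (t : ℂ) ≠ 0 := by exact_mod_cast ht.ne'
  set A := 1 / ((t / (2 * Real.pi) : ℝ) : ℂ) ^ (1 / 2 : ℂ) with hA
  have hA0 : A ≠ 0 := thetaPrefactor_ne_zero ht
  have heq : theta (Real.exp (-t)) =ᶠ[𝓝 Q] fun Q =>
      A * Complex.exp ((Complex.log Q + t / 2) ^ 2 / (2 * t)) * thetaDual t (Complex.log Q) := by
    filter_upwards [Complex.isOpen_slitPlane.mem_nhds hQ] with R hR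
    rw [hA, ← theta_exp_eq_thetaDual ht, Complex.exp_log (Complex.slitPlane_ne_zero hR)]
  have hl := Complex.hasDerivAt_log hQ
  have h1 := ((((hl.add_const ((t : ℂ) / 2)).pow 2).div_const (2 * (t : ℂ))).cexp).const_mul A
  have h2 := (hasDerivAt_thetaDual ht (Complex.log Q)).comp Q hl
  have hd := ((h1.mul h2).congr_of_eventuallyEq heq).deriv
  have hE := Complex.exp_ne_zero ((Complex.log Q + t / 2) ^ 2 / (2 * t))
  rw [qLog, hd, heq.eq_of_nhds]
  simp only [Pi.pow_apply, Function.comp_apply]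
  field_simp
  ring

theorem log_eq_logQ {Q : ℂ} (hQ : Q.im < 0) : Complex.log Q = logQ Q := by
  rw [logQ, Complex.log, Complex.log, Complex.arg_neg_eq_arg_add_pi_of_im_neg hQ, norm_neg]
  push_cast
  ring

theorem im_neg_mem_slitPlane {Q : ℂ} (hQ : Q.im < 0) : Q ∈ Complex.slitPlane := Or.inr hQ.ne

theorem abs_im_log_lt_pi {Q : ℂ} (hQ : Q ∈ Complex.slitPlane) :
    |(Complex.log Q).im| < Real.pi := by
  rw [Complex.log_im, abs_lt]
  exact ⟨Complex.neg_pi_lt_arg Q,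
    lt_of_le_of_ne (Complex.arg_le_pi Q) (Complex.slitPlane_arg_ne_pi hQ)⟩

theorem tendsto_cpow_qLog {α : Type*} {l : Filter α} {t : α → ℝ} {H : α → ℂ} {H₀ Q : ℂ}
    (ht : Tendsto t l (𝓝[>] 0)) (hH : Tendsto H l (𝓝 H₀)) (hQ : Q.im < 0) :
    Tendsto (fun x => ((Real.exp (-t x) : ℝ) : ℂ) ^ (H x * qLog (Real.exp (-t x)) Q)) l
      (𝓝 (powQ Q H₀)) := by
  have hs := im_neg_mem_slitPlane hQ
  have ht0 : Tendsto (fun x => (t x : ℂ)) l (𝓝 0) := by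
    have := (Complex.continuous_ofReal.tendsto 0).comp (ht.mono_right nhdsWithin_le_nhds)
    simpa [Function.comp_def] using this
  obtain ⟨h1, h2⟩ := tendsto_thetaDual (z := fun _ => Complex.log Q) ht tendsto_const_nhds
    (abs_im_log_lt_pi hs)
  have h3 : Tendsto (fun x => -(t x * qLog (Real.exp (-t x)) Q)) l (𝓝 (logQ Q)) := by
    have h4 := ((ht0.div_const 2).const_add (Complex.log Q)).sub (h2.div h1 one_ne_zero)
    rw [← log_eq_logQ hQ]
    simp only [zero_div, add_zero, sub_zero] at h4
    refine h4.congr' ?_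
    filter_upwards [(tendsto_nhdsWithin_iff.1 ht).2, h1.eventually_ne one_ne_zero] with x hx hx2
    exact (neg_mul_qLog_eq hx hs hx2).symm
  rw [powQ]
  refine ((Complex.continuous_exp.tendsto _).comp (hH.mul h3)).congr fun x => ?_
  rw [exp_neg_cpow]
  simp only [Function.comp_apply]
  congr 1; ring

theorem neg_cpow_mul_eq_exp {Q : ℂ} (hQ : Q ∈ cutPlane) (t : ℝ) (a : ℂ) :
    -((Real.exp (-t) : ℝ) : ℂ) ^ a * Q = Complex.exp (Complex.log (-Q) - t * a) := by
  rw [exp_neg_cpow, sub_eq_add_neg, Complex.exp_add, Complex.exp_log (Complex.slitPlane_ne_zero hQ)]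
  ring

theorem tendsto_theta_div {α : Type*} {l : Filter α} {t : α → ℝ} {a : α → ℂ} {a₀ Q : ℂ}
    (ht : Tendsto t l (𝓝[>] 0)) (ha : Tendsto a l (𝓝 a₀)) (hQ : Q ∈ cutPlane) :
    Tendsto (fun x => theta (Real.exp (-t x)) (-((Real.exp (-t x) : ℝ) : ℂ) ^ a x * Q) /
      theta (Real.exp (-t x)) (-Q)) l (𝓝 (Complex.exp (-(a₀ * Complex.log (-Q))))) := by
  have ht0 : Tendsto (fun x => (t x : ℂ)) l (𝓝 0) := by
    have := (Complex.continuous_ofReal.tendsto 0).comp (ht.mono_right nhdsWithin_le_nhds)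
    simpa [Function.comp_def] using this
  have him := abs_im_log_lt_pi hQ
  have h1 := (tendsto_thetaDual (z := fun _ => Complex.log (-Q)) ht tendsto_const_nhds him).1
  have h2 := (tendsto_thetaDual (z := fun x => Complex.log (-Q) - t x * a x)
    (z₀ := Complex.log (-Q)) ht
    (by simpa using (ht0.mul ha).const_sub (Complex.log (-Q))) him).1
  have h3 : Tendsto (fun x => -(a x * (Complex.log (-Q) + t x / 2)) + t x * a x ^ 2 / 2) l
      (𝓝 (-(a₀ * Complex.log (-Q)))) := by
    have := ((ha.mul ((ht0.div_const 2).const_add (Complex.log (-Q)))).neg).add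
      ((ht0.mul (ha.pow 2)).div_const 2)
    simpa using this
  have h4 := ((Complex.continuous_exp.tendsto _).comp h3).mul (h2.div h1 one_ne_zero)
  rw [div_one, mul_one] at h4
  refine h4.congr' ?_
  filter_upwards [(tendsto_nhdsWithin_iff.1 ht).2, h1.eventually_ne one_ne_zero]
    with x (hx : 0 < t x) hx2
  have hx' : (t x : ℂ) ≠ 0 := by exact_mod_cast hx.ne'
  have hQe : theta (Real.exp (-t x)) (-Q) =
      theta (Real.exp (-t x)) (Complex.exp (Complex.log (-Q))) := by
    rw [Complex.exp_log (Complex.slitPlane_ne_zero hQ)]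
  rw [hQe, neg_cpow_mul_eq_exp hQ, theta_exp_eq_thetaDual hx, theta_exp_eq_thetaDual hx]
  have hA := thetaPrefactor_ne_zero hx
  set A := 1 / ((t x / (2 * Real.pi) : ℝ) : ℂ) ^ (1 / 2 : ℂ)
  -- The Gaussian exponents are each of order 1/t, but their difference is -a(log(-Q) + t/2) +
  -- ta²/2, which stays bounded.
  have e : Complex.exp ((Complex.log (-Q) - t x * a x + t x / 2) ^ 2 / (2 * t x)) =
      Complex.exp ((Complex.log (-Q) + t x / 2) ^ 2 / (2 * t x)) *
        Complex.exp (-(a x * (Complex.log (-Q) + t x / 2)) + t x * a x ^ 2 / 2) := by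
    rw [← Complex.exp_add]; congr 1; field_simp; ring
  have hE := Complex.exp_ne_zero ((Complex.log (-Q) + t x / 2) ^ 2 / (2 * t x))
  simp only [Function.comp_apply, Pi.div_apply]
  rw [e]
  field_simp

/-- Ensures that for small t the q-character in `qW` is nonzero and is cancelled by its inverse in
`qGammaSide`; with totalised division the cancellation is not automatic. -/
theorem eventually_theta_ne_zero {α : Type*} {l : Filter α} {t : α → ℝ} {a : ℂ} {Q : ℂ}
    (ht : Tendsto t l (𝓝[>] 0)) (hQ : Q ∈ Complex.slitPlane) :
    ∀ᶠ x in l, theta (Real.exp (-t x)) (((Real.exp (-t x) : ℝ) : ℂ) ^ a * Q) ≠ 0 := by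
  have ht0 : Tendsto (fun x => (t x : ℂ)) l (𝓝 0) := by
    have := (Complex.continuous_ofReal.tendsto 0).comp (ht.mono_right nhdsWithin_le_nhds)
    simpa [Function.comp_def] using this
  have h2 := (tendsto_thetaDual (z := fun x => Complex.log Q - t x * a)
    (z₀ := Complex.log Q) ht (by simpa using (ht0.mul_const a).const_sub (Complex.log Q))
    (abs_im_log_lt_pi hQ)).1
  filter_upwards [(tendsto_nhdsWithin_iff.1 ht).2, h2.eventually_ne one_ne_zero]
    with x (hx : 0 < t x) hx2
  have : ((Real.exp (-t x) : ℝ) : ℂ) ^ a * Q = Complex.exp (Complex.log Q - t x * a) := by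
    rw [exp_neg_cpow, sub_eq_add_neg, Complex.exp_add,
      Complex.exp_log (Complex.slitPlane_ne_zero hQ), mul_comm]
  rw [this, theta_exp_eq_thetaDual hx]
  exact mul_ne_zero (mul_ne_zero (thetaPrefactor_ne_zero hx) (Complex.exp_ne_zero _)) hx2

theorem differentiable_theta_exp {t : ℝ} (ht : 0 < t) :
    Differentiable ℂ fun z => theta (Real.exp (-t)) (Complex.exp z) := by
  simp_rw [theta_exp_eq_thetaDual ht]
  intro z
  refine DifferentiableAt.mul ?_ (hasDerivAt_thetaDual ht z).differentiableAt
  fun_prop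

theorem differentiable_theta_cpow {t : ℝ} (ht : 0 < t) {Q : ℂ} (hQ : Q ∈ cutPlane) (b : ℂ) :
    Differentiable ℂ fun H => theta (Real.exp (-t)) (-((Real.exp (-t) : ℝ) : ℂ) ^ (H + b) * Q) := by
  simp_rw [neg_cpow_mul_eq_exp hQ]
  have h : Differentiable ℂ fun H : ℂ => Complex.log (-Q) - t * (H + b) := by fun_prop
  exact (differentiable_theta_exp ht).comp h

/-! ### Rising factorials and the Gauss multiplication formula for the factor `5` -/

/-- The rising factorial `a (a + 1) ⋯ (a + n - 1)`. -/
def rising (a : ℂ) (n : ℕ) : ℂ := ∏ l ∈ Finset.range n, (a + l)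

theorem rising_succ (a : ℂ) (n : ℕ) : rising a (n + 1) = rising a n * (a + n) :=
  Finset.prod_range_succ _ _

theorem rising_zero (a : ℂ) : rising a 0 = 1 := Finset.prod_range_zero _

theorem rising_ne_zero {a : ℂ} (ha : 0 < a.re) (n : ℕ) : rising a n ≠ 0 :=
  Finset.prod_ne_zero_iff.2 fun l _ h => by
    have := congrArg Complex.re h
    have hn : (0 : ℝ) ≤ l := l.cast_nonneg
    simp at this
    linarith

/-- The factors are sorted by the residue of m modulo 5. -/
theorem prod_range_five_mul (x : ℂ) (d : ℕ) :
    ∏ m ∈ Finset.range (5 * d), (5 * x + m) =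
      5 ^ (5 * d) * (rising x d * rising (x + 1 / 5) d * rising (x + 2 / 5) d *
        rising (x + 3 / 5) d * rising (x + 4 / 5) d) := by
  induction d with
  | zero => simp [rising]
  | succ d ih =>
    rw [show 5 * (d + 1) = 5 * d + 1 + 1 + 1 + 1 + 1 by ring]
    simp only [Finset.prod_range_succ]
    rw [ih]
    simp only [rising_succ]
    push_cast
    ring

theorem prod_Icc_one_four {M : Type*} [CommMonoid M] (f : ℕ → M) :
    ∏ i ∈ Finset.Icc 1 4, f i = f 1 * f 2 * f 3 * f 4 := by
  rw [show Finset.Icc 1 4 = {1, 2, 3, 4} by rfl]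
  simp [mul_assoc]

theorem sum_Icc_one_four {M : Type*} [AddCommMonoid M] (f : ℕ → M) :
    ∑ i ∈ Finset.Icc 1 4, f i = f 1 + f 2 + f 3 + f 4 := by
  rw [show Finset.Icc 1 4 = {1, 2, 3, 4} by rfl]
  simp [add_assoc]

theorem GammaSeq_eq_rising (s : ℂ) (n : ℕ) :
    Complex.GammaSeq s n = (n : ℂ) ^ s * n.factorial / rising s (n + 1) := rfl

/-- Finite form of the multiplication formula. The index 5n + 4 is chosen because `GammaSeq` at N
has N + 1 factors in its denominator, and 5n + 5 = 5(n+1). The dependence on s beyond the Gamma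
sequences is isolated in the exponential. -/
theorem prod_GammaSeq_five (s : ℂ) {n : ℕ} (hn : n ≠ 0) :
    Complex.GammaSeq (s + 1 / 5) n * Complex.GammaSeq (s + 2 / 5) n *
      Complex.GammaSeq (s + 3 / 5) n * Complex.GammaSeq (s + 4 / 5) n *
      Complex.GammaSeq (s + 1) n =
    Complex.GammaSeq (5 * s + 1) (5 * n + 4) *
      ((n : ℂ) ^ 3 * (n.factorial : ℂ) ^ 5 * 5 ^ (5 * (n + 1)) /
        ((5 * n + 4 : ℕ) * (5 * n + 4).factorial)) *
      Complex.exp (5 * s * (Complex.log n - Complex.log (5 * n + 4 : ℕ))) := by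
  have hn0 : (n : ℂ) ≠ 0 := by exact_mod_cast hn
  have hm0 : ((5 * n + 4 : ℕ) : ℂ) ≠ 0 := by exact_mod_cast (by omega : 5 * n + 4 ≠ 0)
  have hf : ((5 * n + 4).factorial : ℂ) ≠ 0 := by exact_mod_cast (Nat.factorial_ne_zero _)
  have hD : rising (5 * s + 1) (5 * n + 4 + 1) = 5 ^ (5 * (n + 1)) *
      (rising (s + 1 / 5) (n + 1) * rising (s + 2 / 5) (n + 1) * rising (s + 3 / 5) (n + 1) *
        rising (s + 4 / 5) (n + 1) * rising (s + 1) (n + 1)) := by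
    have h := prod_range_five_mul (s + 1 / 5) (n + 1)
    rw [rising, show 5 * n + 4 + 1 = 5 * (n + 1) by ring]
    convert h using 2
    · ring
    · ring_nf
  simp only [GammaSeq_eq_rising]
  rw [hD]
  have hpow : (n : ℂ) ^ (s + 1 / 5) * (n : ℂ) ^ (s + 2 / 5) * (n : ℂ) ^ (s + 3 / 5) *
      (n : ℂ) ^ (s + 4 / 5) * (n : ℂ) ^ (s + 1) = (n : ℂ) ^ 3 * Complex.exp (5 * s * Complex.log n) := by
    have e3 : (n : ℂ) ^ 3 = (n : ℂ) ^ (3 : ℂ) := by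
      exact_mod_cast (Complex.cpow_natCast (n : ℂ) 3).symm
    rw [e3]
    simp only [Complex.cpow_def_of_ne_zero hn0, ← Complex.exp_add]
    congr 1; ring
  have hpow2 : ((5 * n + 4 : ℕ) : ℂ) ^ (5 * s + 1) =
      ((5 * n + 4 : ℕ) : ℂ) * Complex.exp (5 * s * Complex.log (5 * n + 4 : ℕ)) := by
    rw [Complex.cpow_add _ _ hm0, Complex.cpow_one, Complex.cpow_def_of_ne_zero hm0, mul_comm]
    congr 2; ring
  rw [hpow2, mul_sub, Complex.exp_sub]
  have hE := Complex.exp_ne_zero (5 * s * Complex.log (5 * n + 4 : ℕ))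
  set R := rising (s + 1 / 5) (n + 1) * rising (s + 2 / 5) (n + 1) * rising (s + 3 / 5) (n + 1) *
        rising (s + 4 / 5) (n + 1) * rising (s + 1) (n + 1) with hR
  have hL : (n : ℂ) ^ (s + 1 / 5) * n.factorial / rising (s + 1 / 5) (n + 1) *
      ((n : ℂ) ^ (s + 2 / 5) * n.factorial / rising (s + 2 / 5) (n + 1)) *
      ((n : ℂ) ^ (s + 3 / 5) * n.factorial / rising (s + 3 / 5) (n + 1)) *
      ((n : ℂ) ^ (s + 4 / 5) * n.factorial / rising (s + 4 / 5) (n + 1)) *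
      ((n : ℂ) ^ (s + 1) * n.factorial / rising (s + 1) (n + 1)) =
      ((n : ℂ) ^ (s + 1 / 5) * (n : ℂ) ^ (s + 2 / 5) * (n : ℂ) ^ (s + 3 / 5) *
      (n : ℂ) ^ (s + 4 / 5) * (n : ℂ) ^ (s + 1)) * (n.factorial : ℂ) ^ 5 / R := by
    rw [hR]; ring
  rw [hL, hpow]
  by_cases hR0 : R = 0
  · simp [hR0]
  · field_simp

theorem Gamma_mul_five (s : ℂ) :
    Complex.Gamma (s + 1 / 5) * Complex.Gamma (s + 2 / 5) * Complex.Gamma (s + 3 / 5) *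
      Complex.Gamma (s + 4 / 5) * Complex.Gamma (s + 1) * 5 ^ (5 * s) =
    Complex.Gamma (5 * s + 1) * (Complex.Gamma (1 / 5) * Complex.Gamma (2 / 5) *
      Complex.Gamma (3 / 5) * Complex.Gamma (4 / 5)) := by
  have hsub : Tendsto (fun n : ℕ => 5 * n + 4) atTop atTop :=
    tendsto_atTop_mono (fun n => by simp only [id]; omega) tendsto_id
  have hG := fun s : ℂ =>
    ((((Complex.GammaSeq_tendsto_Gamma (s + 1 / 5)).mul
      (Complex.GammaSeq_tendsto_Gamma (s + 2 / 5))).mul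
      (Complex.GammaSeq_tendsto_Gamma (s + 3 / 5))).mul
      (Complex.GammaSeq_tendsto_Gamma (s + 4 / 5))).mul (Complex.GammaSeq_tendsto_Gamma (s + 1))
  have h5 := fun s : ℂ => (Complex.GammaSeq_tendsto_Gamma (5 * s + 1)).comp hsub
  set u : ℕ → ℂ := fun n => (n : ℂ) ^ 3 * (n.factorial : ℂ) ^ 5 * 5 ^ (5 * (n + 1)) /
        ((5 * n + 4 : ℕ) * (5 * n + 4).factorial) with hu
  -- The factor independent of s is evaluated by putting s = 0, which replaces Stirling's formula.
  have hu_lim : Tendsto u atTop (𝓝 (Complex.Gamma (1 / 5) * Complex.Gamma (2 / 5) *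
      Complex.Gamma (3 / 5) * Complex.Gamma (4 / 5))) := by
    have h1 := hG 0
    have h2 := h5 0
    simp only [zero_add, mul_zero, Complex.Gamma_one, mul_one] at h1 h2
    have h3 := h1.div h2 one_ne_zero
    rw [div_one] at h3
    refine h3.congr' ?_
    filter_upwards [eventually_ne_atTop 0, h2.eventually_ne one_ne_zero] with n hn hne
    have := prod_GammaSeq_five 0 hn
    simp only [zero_add, mul_zero, zero_mul, Complex.exp_zero, mul_one] at this
    simp only [Pi.div_apply]
    rw [this]
    exact mul_div_cancel_left₀ _ hne
  have hlog : Tendsto (fun n : ℕ => Complex.log n - Complex.log (5 * n + 4 : ℕ)) atTop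
      (𝓝 (-Complex.log 5)) := by
    have h1 : Tendsto (fun n : ℕ => -Real.log (5 + 4 * (n : ℝ)⁻¹)) atTop (𝓝 (-Real.log 5)) := by
      have := (((tendsto_inv_atTop_nhds_zero_nat (𝕜 := ℝ)).const_mul 4).const_add 5).log
        (by norm_num)
      simpa using this.neg
    have h2 := (Complex.continuous_ofReal.tendsto _).comp h1
    have e5 : ((-Real.log 5 : ℝ) : ℂ) = -Complex.log 5 := by
      push_cast [Complex.ofReal_log]; simp
    rw [e5] at h2
    refine h2.congr' ?_
    filter_upwards [eventually_ne_atTop 0] with n hn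
    have hn0 : (0 : ℝ) < n := by exact_mod_cast Nat.pos_of_ne_zero hn
    simp only [Function.comp_apply]
    have e : (5 : ℝ) + 4 * (n : ℝ)⁻¹ = (5 * n + 4 : ℕ) / n := by push_cast; field_simp
    rw [e, Real.log_div (by positivity) hn0.ne', ← Complex.natCast_log, ← Complex.natCast_log]
    push_cast; ring
  have hexp := (Complex.continuous_exp.tendsto _).comp (hlog.const_mul (5 * s))
  have hfin := ((h5 s).mul hu_lim).mul hexp
  have key := tendsto_nhds_unique (hG s) (hfin.congr' (by
    filter_upwards [eventually_ne_atTop 0] with n hn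
    exact (prod_GammaSeq_five s hn).symm))
  rw [key, mul_assoc, mul_neg, Complex.cpow_def_of_ne_zero (by norm_num), ← Complex.exp_add,
    mul_comm (Complex.log 5), neg_add_cancel, Complex.exp_zero, mul_one]

/-! ### The Gamma quotient and the normalisation of both sides. -/

/-- The Gamma quotient interpolating the coefficients of the `I`-function. -/
def gammaRatio (s : ℂ) : ℂ :=
  (∏ i ∈ Finset.Icc (1 : ℕ) 4, Complex.Gamma (s + i / 5)) / Complex.Gamma (s + 1) ^ 4

/-- The coefficient of the `k`-th solution at infinity. -/
def gCoeff (k : ℕ) : ℂ :=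
  (∏ i ∈ (Finset.Icc (1 : ℕ) 4).erase k, Complex.Gamma (((i : ℂ) - k) / 5)) /
    Complex.Gamma (1 - (k : ℂ) / 5) ^ 4

/-- The power series coefficients of the `k`-th solution at infinity. -/
def wCoeff (k n : ℕ) : ℂ :=
  rising ((k : ℂ) / 5) n ^ 4 / ∏ i ∈ Finset.Icc (1 : ℕ) 4, rising (1 + ((k : ℂ) - i) / 5) n

theorem Gamma_fifth_prod_ne_zero : Complex.Gamma (1 / 5) * Complex.Gamma (2 / 5) *
      Complex.Gamma (3 / 5) * Complex.Gamma (4 / 5) ≠ 0 := by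
  refine mul_ne_zero (mul_ne_zero (mul_ne_zero ?_ ?_) ?_) ?_ <;>
  exact Complex.Gamma_ne_zero_of_re_pos (by norm_num)

/-- The recurrence sends Γ((i-k)/5) with i < k to 5/(i-k) · Γ(1 + (i-k)/5). The arguments then run
through all j/5 except 1 - k/5, which explains the fifth power. The factors i - k with i > k
multiply to (4-k)! = Γ(5-k), and the k - 1 shifts produce 5^(k-1). -/
theorem gCoeff_eq {k : ℕ} (hk : k ∈ Finset.Icc (1 : ℕ) 4) :
    (5 : ℂ) ^ (k - 1) * Complex.Gamma (5 - (k : ℂ)) /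
        ((∏ i ∈ (Finset.Icc (1 : ℕ) 4).erase k, ((i : ℂ) - (k : ℂ))) *
          Complex.Gamma (1 - (k : ℂ) / 5) ^ 5) =
      gCoeff k / (Complex.Gamma (1 / 5) * Complex.Gamma (2 / 5) *
      Complex.Gamma (3 / 5) * Complex.Gamma (4 / 5)) := by
  have hne : ∀ x : ℂ, 0 < x.re → Complex.Gamma x ≠ 0 := fun x hx =>
    Complex.Gamma_ne_zero_of_re_pos hx
  have h1 : Complex.Gamma (1 / 5) ≠ 0 := hne _ (by norm_num)
  have h2 : Complex.Gamma (2 / 5) ≠ 0 := hne _ (by norm_num)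
  have h3 : Complex.Gamma (3 / 5) ≠ 0 := hne _ (by norm_num)
  have h4 : Complex.Gamma (4 / 5) ≠ 0 := hne _ (by norm_num)
  have m1 : Complex.Gamma (4 / 5) = -(1 / 5) * Complex.Gamma (-(1 / 5)) := by
    rw [← Complex.Gamma_add_one _ (by norm_num)]; norm_num
  have m2 : Complex.Gamma (3 / 5) = -(2 / 5) * Complex.Gamma (-(2 / 5)) := by
    rw [← Complex.Gamma_add_one _ (by norm_num)]; norm_num
  have m3 : Complex.Gamma (2 / 5) = -(3 / 5) * Complex.Gamma (-(3 / 5)) := by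
    rw [← Complex.Gamma_add_one _ (by norm_num)]; norm_num
  have m1' : Complex.Gamma (-(1 / 5)) = -5 * Complex.Gamma (4 / 5) := by rw [m1]; ring
  have m2' : Complex.Gamma (-(2 / 5)) = -(5 / 2) * Complex.Gamma (3 / 5) := by rw [m2]; ring
  have m3' : Complex.Gamma (-(3 / 5)) = -(5 / 3) * Complex.Gamma (2 / 5) := by rw [m3]; ring
  obtain ⟨hk1, hk4⟩ := Finset.mem_Icc.1 hk
  interval_cases k
  · rw [gCoeff, show (Finset.Icc 1 4).erase 1 = {2, 3, 4} by rfl]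
    norm_num
    field_simp
  · rw [gCoeff, show (Finset.Icc 1 4).erase 2 = {1, 3, 4} by rfl]
    norm_num [m1']
    field_simp
    norm_num
  · rw [gCoeff, show (Finset.Icc 1 4).erase 3 = {1, 2, 4} by rfl]
    norm_num [m1', m2']
    field_simp
    norm_num
  · rw [gCoeff, show (Finset.Icc 1 4).erase 4 = {1, 2, 3} by rfl]
    norm_num [m1', m2', m3']
    field_simp
    norm_num

theorem gammaRatio_ne_zero {H : ℂ} (hH : -(1 / 5) < H.re) : gammaRatio H ≠ 0 := by
  rw [gammaRatio, prod_Icc_one_four]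
  refine div_ne_zero (mul_ne_zero (mul_ne_zero (mul_ne_zero ?_ ?_) ?_) ?_) (pow_ne_zero _ ?_) <;>
  refine Complex.Gamma_ne_zero_of_re_pos ?_ <;> norm_num <;> linarith

theorem gammaPrefactor_eq {H : ℂ} (hH : -(1 / 5) < H.re) :
    (5 : ℂ) ^ (5 * H) * Complex.Gamma (H + 1) ^ 5 / Complex.Gamma (5 * H + 1) =
      (Complex.Gamma (1 / 5) * Complex.Gamma (2 / 5) * Complex.Gamma (3 / 5) *
        Complex.Gamma (4 / 5)) / gammaRatio H := by
  have hm := Gamma_mul_five H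
  have h0 : Complex.Gamma (5 * H + 1) ≠ 0 := Complex.Gamma_ne_zero_of_re_pos (by
    norm_num; linarith)
  have h1 : Complex.Gamma (H + 1) ≠ 0 := Complex.Gamma_ne_zero_of_re_pos (by norm_num; linarith)
  have hG := gammaRatio_ne_zero hH
  rw [div_eq_div_iff h0 hG, gammaRatio, prod_Icc_one_four]
  push_cast
  generalize Complex.Gamma (H + 1 / 5) = a at *
  generalize Complex.Gamma (H + 2 / 5) = b at *
  generalize Complex.Gamma (H + 3 / 5) = c at *
  generalize Complex.Gamma (H + 4 / 5) = d at *
  field_simp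
  linear_combination hm

theorem gammaSide_eq {H : ℂ} (hH : -(1 / 5) < H.re) (Q : ℂ) :
    gammaSide H Q = (gammaRatio H)⁻¹ * ∑ k ∈ Finset.Icc (1 : ℕ) 4, gCoeff k *
      (Real.pi * Complex.exp (-(Real.pi * Complex.I * (H + (k : ℂ) / 5))) /
        Complex.sin (Real.pi * (H + (k : ℂ) / 5))) *
      (powQ Q (-((k : ℂ) / 5)) * wTilde k (1 / Q)) := by
  have hK := Gamma_fifth_prod_ne_zero
  rw [gammaSide, gammaPrefactor_eq hH, Finset.mul_sum, Finset.mul_sum]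
  refine Finset.sum_congr rfl fun k hk => ?_
  rw [gCoeff_eq hk]
  generalize Complex.Gamma (1 / 5) * Complex.Gamma (2 / 5) * Complex.Gamma (3 / 5) *
    Complex.Gamma (4 / 5) = K at *
  field_simp

/-- The residue class of 5 in the numerator cancels one of the five powers of (H+1)_d, and the
powers of 5 absorb 5^5. -/
theorem iTerm_eq {H : ℂ} (hH : -1 < H.re) (Q : ℂ) (d : ℕ) :
    iTerm H Q d = (∏ i ∈ Finset.Icc (1 : ℕ) 4, rising (H + i / 5) d) / rising (H + 1) d ^ 4 *
      Q ^ d := by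
  have h1 : ∏ k ∈ Finset.Icc 1 (5 * d), (5 * H + (k : ℂ)) = 5 ^ (5 * d) *
      ((∏ i ∈ Finset.Icc (1 : ℕ) 4, rising (H + i / 5) d) * rising (H + 1) d) := by
    have h := prod_range_five_mul (H + 1 / 5) d
    rw [Finset.range_eq_Ico] at h
    rw [← Finset.Ico_add_one_right_eq_Icc, ← Finset.prod_Ico_add' _ 0 (5 * d) 1, prod_Icc_one_four]
    convert h using 2
    · push_cast; ring
    · push_cast; ring_nf
  have h2 : ∏ k ∈ Finset.Icc 1 d, (H + (k : ℂ)) ^ 5 = rising (H + 1) d ^ 5 := by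
    rw [Finset.prod_pow, rising, Finset.range_eq_Ico, ← Finset.Ico_add_one_right_eq_Icc,
      ← Finset.prod_Ico_add' _ 0 d 1]
    congr 1
    refine Finset.prod_congr rfl fun n _ => ?_
    push_cast; ring
  have h3 : rising (H + 1) d ≠ 0 := rising_ne_zero (by simp; linarith) d
  rw [iTerm, h1, h2, div_pow, ← pow_mul]
  field_simp

theorem wTerm_eq {k : ℕ} (hk : k ∈ Finset.Icc (1 : ℕ) 4) (w : ℂ) (d : ℕ) :
    wTerm k w d = wCoeff k d * w ^ d := by
  have h1 : ∏ l ∈ Finset.range (5 * d), ((k : ℂ) + (l : ℂ)) = 5 ^ (5 * d) *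
      (rising ((k : ℂ) / 5) d * ∏ i ∈ Finset.Icc (1 : ℕ) 4, rising (1 + ((k : ℂ) - i) / 5) d) := by
    have h := prod_range_five_mul ((k : ℂ) / 5) d
    rw [prod_Icc_one_four]
    convert h using 2
    · ring
    · push_cast; ring_nf
  have h2 : ∏ l ∈ Finset.range d, ((k : ℂ) / 5 + (l : ℂ)) ^ 5 = rising ((k : ℂ) / 5) d ^ 5 :=
    Finset.prod_pow _ _ _
  obtain ⟨hk1, hk4⟩ := Finset.mem_Icc.1 hk
  have h3 : rising ((k : ℂ) / 5) d ≠ 0 := rising_ne_zero (by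
    have : (0 : ℝ) < k := by exact_mod_cast hk1
    simpa using this) d
  rw [wTerm, h1, h2, mul_pow, ← pow_mul, wCoeff]
  field_simp

/-! ### Partial fractions -/

/-- Partial fraction expansion of a quotient of monic polynomials of equal degree, the denominator
having simple roots. -/
theorem eval_div_prod_eq_one_add_sum {ι : Type*} [DecidableEq ι] {S : Finset ι} {v : ι → ℂ}
    (hv : Set.InjOn v S) {p : Polynomial ℂ} (hp : p.Monic) (hdeg : p.natDegree = S.card) {x : ℂ}
    (hx : ∀ i ∈ S, x ≠ v i) :
    p.eval x / ∏ i ∈ S, (x - v i) =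
      1 + ∑ i ∈ S, p.eval (v i) / (∏ j ∈ S.erase i, (v i - v j)) / (x - v i) := by
  have hn0 : (Lagrange.nodal S v).eval x ≠ 0 := by
    rw [Lagrange.eval_nodal]
    exact Finset.prod_ne_zero_iff.2 fun i hi => sub_ne_zero.2 (hx i hi)
  -- Equal degrees and leading coefficients cancel, so the difference is recovered by interpolation
  -- at the roots of the denominator; the quotient p / p_nodal is 1 plus that part.
  have hd : (p - Lagrange.nodal S v).degree < S.card := by
    have h1 : p.degree = S.card := by rw [Polynomial.degree_eq_natDegree hp.ne_zero, hdeg]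
    rw [← h1]
    exact Polynomial.degree_sub_lt_left (h1.trans Lagrange.degree_nodal.symm) hp.ne_zero
      (by rw [hp.leadingCoeff, Lagrange.nodal_monic.leadingCoeff])
  have h := congrArg (Polynomial.eval x) (Lagrange.eq_interpolate hv hd)
  rw [Lagrange.eval_interpolate_not_at_node _ hx, Polynomial.eval_sub] at h
  rw [← Lagrange.eval_nodal, div_eq_iff hn0, add_mul, one_mul, ← sub_eq_iff_eq_add', h, mul_comm]
  congr 1
  refine Finset.sum_congr rfl fun i hi => ?_
  rw [Polynomial.eval_sub, Lagrange.eval_nodal_at_node hi, sub_zero, Lagrange.nodalWeight,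
    Finset.prod_inv_distrib]
  ring

theorem rising_eq_mul (x : ℂ) (m n : ℕ) : rising x (m + n) = rising x m * rising (x + m) n := by
  rw [rising, Finset.prod_range_add, rising, rising]
  congr 1
  refine Finset.prod_congr rfl fun l _ => ?_
  push_cast; ring

theorem rising_sub_self (x : ℂ) (n : ℕ) : rising (x - n) n = (-1) ^ n * rising (1 - x) n := by
  rw [rising, ← Finset.prod_range_reflect, rising]
  have h : (-1 : ℂ) ^ n = ∏ _l ∈ Finset.range n, (-1 : ℂ) := by simp
  rw [h, ← Finset.prod_mul_distrib]
  refine Finset.prod_congr rfl fun l hl => ?_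
  have h1 : l + 1 ≤ n := Finset.mem_range.1 hl
  rw [show n - 1 - l = n - (l + 1) by omega, Nat.cast_sub h1]
  push_cast; ring

theorem rising_one (n : ℕ) : rising 1 n = n.factorial := by
  rw [rising, ← Finset.prod_range_add_one_eq_factorial]
  push_cast
  exact Finset.prod_congr rfl fun _ _ => add_comm _ _

/-- The coefficient governing the truncated partial fraction expansion. -/
def rCoeff (k M : ℕ) : ℂ :=
  rising (1 - (k : ℂ) / 5) (M + 1) ^ 4 /
    ((∏ i ∈ (Finset.Icc (1 : ℕ) 4).erase k, rising (((i : ℂ) - k) / 5) (M + 1)) * M.factorial)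

theorem prod_erase_product {ι κ : Type*} [DecidableEq ι] [DecidableEq κ] {M : Type*} [CommMonoid M]
    (S : Finset ι) (T : Finset κ) {k : ι} {n : κ} (hk : k ∈ S) (f : ι × κ → M) :
    ∏ j ∈ (S ×ˢ T).erase (k, n), f j =
      (∏ i ∈ S.erase k, ∏ m ∈ T, f (i, m)) * ∏ m ∈ T.erase n, f (k, m) := by
  have h : (S ×ˢ T).erase (k, n) = (S.erase k ×ˢ T) ∪ ({k} ×ˢ T.erase n) := by
    ext ⟨i, m⟩
    simp only [Finset.mem_erase, Finset.mem_product, Finset.mem_union, Finset.mem_singleton, ne_eq,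
      Prod.mk.injEq]
    by_cases h1 : i = k
    · subst h1; simp [hk]
    · simp [h1]
  rw [h, Finset.prod_union, Finset.prod_product, Finset.prod_product, Finset.prod_singleton]
  rw [Finset.disjoint_left]
  rintro ⟨i, m⟩ h1 h2
  simp only [Finset.mem_erase, Finset.mem_product, Finset.mem_singleton] at h1 h2
  exact h1.1.1 h2.1

theorem prod_range_erase_sub {N n : ℕ} (hn : n ≤ N) :
    ∏ m ∈ (Finset.range (N + 1)).erase n, ((m : ℂ) - n) =
      (-1) ^ n * rising 1 n * (N - n).factorial := by
  have h : (Finset.range (N + 1)).erase n = Finset.range n ∪ Finset.Ico (n + 1) (N + 1) := by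
    ext m; simp only [Finset.mem_erase, Finset.mem_range, Finset.mem_union, Finset.mem_Ico]; omega
  have hd : Disjoint (Finset.range n) (Finset.Ico (n + 1) (N + 1)) := by
    rw [Finset.disjoint_left]; intro m; simp only [Finset.mem_range, Finset.mem_Ico]; omega
  have h1 := rising_sub_self 0 n
  rw [zero_sub, sub_zero, rising] at h1
  rw [h, Finset.prod_union hd, Finset.prod_Ico_eq_prod_range, ← h1, ← rising_one, rising,
    show N + 1 - (n + 1) = N - n by omega]
  congr 1
  · exact Finset.prod_congr rfl fun m _ => by ring
  · exact Finset.prod_congr rfl fun m _ => by push_cast; ring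

/-- Each residue at -(k/5 + n) splits as a factor depending on n times a factor depending on N - n
only, so the limit N → ∞ can be taken termwise. -/
theorem truncated_partial_fractions (N : ℕ) {s : ℂ}
    (hs : ∀ k ∈ Finset.Icc (1 : ℕ) 4, ∀ n : ℕ, s + k / 5 + n ≠ 0) :
    rising (s + 1) (N + 1) ^ 4 / ∏ i ∈ Finset.Icc (1 : ℕ) 4, rising (s + i / 5) (N + 1) =
      1 + ∑ k ∈ Finset.Icc (1 : ℕ) 4, ∑ n ∈ Finset.range (N + 1),
        wCoeff k n * rCoeff k (N - n) / (s + k / 5 + n) := by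
  set v : ℕ × ℕ → ℂ := fun j => -((j.1 : ℂ) / 5 + j.2) with hv
  set S := Finset.Icc (1 : ℕ) 4 ×ˢ Finset.range (N + 1) with hS
  have hinj : Set.InjOn v S := by
    rintro ⟨k, n⟩ h1 ⟨k', n'⟩ h2 h
    simp only [hS, Finset.coe_product, Set.mem_prod, Finset.mem_coe, Finset.mem_Icc] at h1 h2
    simp only [hv, neg_inj] at h
    have h3 : ((k + 5 * n : ℕ) : ℂ) = ((k' + 5 * n' : ℕ) : ℂ) := by
      push_cast; linear_combination 5 * h
    have h4 : k + 5 * n = k' + 5 * n' := by exact_mod_cast h3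
    ext <;> simp only <;> omega
  set p : Polynomial ℂ := ∏ m ∈ Finset.range (N + 1), (Polynomial.X + Polynomial.C (1 + (m : ℂ))) ^ 4
    with hp
  have hm : p.Monic := Polynomial.monic_prod_of_monic _ _ fun m _ =>
    (Polynomial.monic_X_add_C _).pow 4
  have hdeg : p.natDegree = S.card := by
    rw [hp, Polynomial.natDegree_prod_of_monic _ _ fun m _ => (Polynomial.monic_X_add_C _).pow 4]
    simp only [Polynomial.natDegree_pow, Polynomial.natDegree_X_add_C, Finset.sum_const,
      Finset.card_range, hS, Finset.card_product, Nat.card_Icc, smul_eq_mul]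
    ring
  have heval : ∀ x : ℂ, p.eval x = rising (x + 1) (N + 1) ^ 4 := by
    intro x
    rw [hp, Polynomial.eval_prod, rising, ← Finset.prod_pow]
    refine Finset.prod_congr rfl fun m _ => ?_
    simp; ring
  have hx : ∀ j ∈ S, s ≠ v j := by
    rintro ⟨k, n⟩ hj h
    rw [hS, Finset.mem_product] at hj
    refine hs k hj.1 n ?_
    rw [h]; simp only [hv]; ring
  have h := eval_div_prod_eq_one_add_sum hinj hm hdeg hx
  rw [heval, hS, Finset.prod_product, Finset.sum_product] at h
  have h1 : ∏ i ∈ Finset.Icc (1 : ℕ) 4, rising (s + i / 5) (N + 1) =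
      ∏ x ∈ Finset.Icc 1 4, ∏ y ∈ Finset.range (N + 1), (s - v (x, y)) := by
    refine Finset.prod_congr rfl fun k _ => Finset.prod_congr rfl fun n _ => ?_
    simp only [hv]; ring
  rw [h1, h]
  congr 1
  refine Finset.sum_congr rfl fun k hk => Finset.sum_congr rfl fun n hn => ?_
  have hnN : n ≤ N := by rw [Finset.mem_range] at hn; omega
  have hden : s - v (k, n) = s + k / 5 + n := by simp only [hv]; ring
  rw [hden, heval, prod_erase_product _ _ hk]
  congr 1
  -- Of the N + 1 factors starting at x - n, the first n are reflected into ascending ones; this is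
  -- what separates n from N - n.
  have split : ∀ x : ℂ, rising (x - n) (N + 1) =
      (-1) ^ n * rising (1 - x) n * rising x (N - n + 1) := by
    intro x
    rw [show N + 1 = n + (N - n + 1) by omega, rising_eq_mul, rising_sub_self, sub_add_cancel]
  have e1 : rising (v (k, n) + 1) (N + 1) = (-1) ^ n * rising ((k : ℂ) / 5) n *
      rising (1 - (k : ℂ) / 5) (N - n + 1) := by
    have := split (1 - (k : ℂ) / 5)
    rw [sub_sub_cancel] at this
    rw [← this]; congr 1; simp only [hv]; ring
  have e2 : ∀ i : ℕ, ∏ m ∈ Finset.range (N + 1), (v (k, n) - v (i, m)) =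
      (-1) ^ n * rising (1 + ((k : ℂ) - i) / 5) n * rising (((i : ℂ) - k) / 5) (N - n + 1) := by
    intro i
    have := split (((i : ℂ) - k) / 5)
    rw [show 1 - ((i : ℂ) - k) / 5 = 1 + ((k : ℂ) - i) / 5 by ring] at this
    rw [← this, rising]
    refine Finset.prod_congr rfl fun m _ => ?_
    simp only [hv]; ring
  have e3 : ∏ m ∈ (Finset.range (N + 1)).erase n, (v (k, n) - v (k, m)) =
      (-1) ^ n * rising 1 n * (N - n).factorial := by
    rw [← prod_range_erase_sub hnN]
    refine Finset.prod_congr rfl fun m _ => ?_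
    simp only [hv]; ring
  have e4 : ∏ i ∈ Finset.Icc (1 : ℕ) 4, rising (1 + ((k : ℂ) - i) / 5) n =
      (∏ i ∈ (Finset.Icc (1 : ℕ) 4).erase k, rising (1 + ((k : ℂ) - i) / 5) n) * rising 1 n := by
    rw [← Finset.prod_erase_mul _ _ hk, sub_self, zero_div, add_zero]
  rw [e1, e3, Finset.prod_congr rfl fun i _ => e2 i, Finset.prod_mul_distrib,
    Finset.prod_mul_distrib, Finset.prod_const, Finset.card_erase_of_mem hk, wCoeff, rCoeff, e4,
    show (Finset.Icc 1 4).card - 1 = 3 by rfl]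
  -- Numerator and denominator each carry (-1)^(4n): four equal factors above; below, three from i ≠
  -- k and one from i = k.
  have hsgn : (((-1 : ℂ) ^ n)) ^ 2 = 1 := by rw [← pow_mul, mul_comm, pow_mul]; simp
  have hsgn4 : (((-1 : ℂ) ^ n)) ^ 4 = 1 := by
    rw [show 4 = 2 * 2 by rfl, pow_mul, hsgn, one_pow]
  rw [mul_pow, mul_pow, hsgn4, one_mul, div_mul_div_comm]
  congr 1
  linear_combination ((∏ i ∈ (Finset.Icc (1 : ℕ) 4).erase k, rising (1 + ((k : ℂ) - i) / 5) n) *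
    (∏ i ∈ (Finset.Icc (1 : ℕ) 4).erase k, rising (((i : ℂ) - k) / 5) (N - n + 1)) *
    rising 1 n * (N - n).factorial) * hsgn4

/-! ### Asymptotics of the coefficients and the infinite partial fraction expansion. -/

theorem Gamma_ne_zero_one_sub {k : ℕ} (hk : k ∈ Finset.Icc (1 : ℕ) 4) :
    Complex.Gamma (1 - (k : ℂ) / 5) ≠ 0 := by
  refine Complex.Gamma_ne_zero_of_re_pos ?_
  have : (k : ℝ) ≤ 4 := by exact_mod_cast (Finset.mem_Icc.1 hk).2
  rw [show (1 - (k : ℂ) / 5) = ((1 - k / 5 : ℝ) : ℂ) by push_cast; rfl, Complex.ofReal_re]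
  linarith

theorem Gamma_ne_zero_div {k : ℕ} (hk : k ∈ Finset.Icc (1 : ℕ) 4) :
    Complex.Gamma ((k : ℂ) / 5) ≠ 0 := by
  refine Complex.Gamma_ne_zero_of_re_pos ?_
  have : (0 : ℝ) < k := by exact_mod_cast (Finset.mem_Icc.1 hk).1
  simpa using this

theorem tendsto_natCast_div_add_one :
    Tendsto (fun M : ℕ => (M : ℂ) / (M + 1)) atTop (𝓝 1) := by
  have := tendsto_natCast_div_add_atTop (𝕜 := ℂ) 1
  simpa using this

theorem tendsto_rCoeff_div {k : ℕ} (hk : k ∈ Finset.Icc (1 : ℕ) 4) :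
    Tendsto (fun M : ℕ => rCoeff k M / ((M : ℂ) + 1) ^ 2) atTop (𝓝 (gCoeff k)) := by
  have h1 : Tendsto (fun M => (∏ i ∈ (Finset.Icc (1 : ℕ) 4).erase k,
      Complex.GammaSeq (((i : ℂ) - k) / 5) M) / Complex.GammaSeq (1 - (k : ℂ) / 5) M ^ 4) atTop
      (𝓝 (gCoeff k)) :=
    (tendsto_finsetProd _ fun i _ => Complex.GammaSeq_tendsto_Gamma _).div
      ((Complex.GammaSeq_tendsto_Gamma _).pow 4) (pow_ne_zero _ (Gamma_ne_zero_one_sub hk))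
  have h2 := h1.mul (tendsto_natCast_div_add_one.pow 2)
  rw [one_pow, mul_one] at h2
  refine h2.congr' ?_
  filter_upwards [eventually_ne_atTop 0] with M hM
  have hM0 : (M : ℂ) ≠ 0 := by exact_mod_cast hM
  have hM1 : (M : ℂ) + 1 ≠ 0 := by exact_mod_cast M.succ_ne_zero
  have hf : (M.factorial : ℂ) ≠ 0 := by exact_mod_cast M.factorial_ne_zero
  have hsum : ∑ i ∈ (Finset.Icc (1 : ℕ) 4).erase k, ((i : ℂ) - k) / 5 = 2 - 4 * k / 5 := by
    have := Finset.sum_erase_add (Finset.Icc (1 : ℕ) 4) (fun i => ((i : ℂ) - k) / 5) hk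
    rw [sub_self, zero_div, add_zero] at this
    rw [this, sum_Icc_one_four]; push_cast; ring
  -- Counting powers of M: 4(1 - k/5) minus the sum 2 - 4k/5 of the other exponents is 2, hence the
  -- growth M².
  have hpow : (∏ i ∈ (Finset.Icc (1 : ℕ) 4).erase k, (M : ℂ) ^ (((i : ℂ) - k) / 5)) * (M : ℂ) ^ 2 =
      ((M : ℂ) ^ (1 - (k : ℂ) / 5)) ^ 4 := by
    have e2 : (M : ℂ) ^ 2 = (M : ℂ) ^ (2 : ℂ) := by
      exact_mod_cast (Complex.cpow_natCast (M : ℂ) 2).symm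
    rw [e2]
    simp only [Complex.cpow_def_of_ne_zero hM0, ← Complex.exp_sum, ← Complex.exp_add,
      ← Complex.exp_nat_mul, ← Finset.mul_sum, hsum]
    congr 1; push_cast; ring
  have hE : (M : ℂ) ^ (1 - (k : ℂ) / 5) ≠ 0 := by
    rw [Complex.cpow_def_of_ne_zero hM0]; exact Complex.exp_ne_zero _
  simp only [GammaSeq_eq_rising, Finset.prod_div_distrib, Finset.prod_mul_distrib,
    Finset.prod_const, Finset.card_erase_of_mem hk, show (Finset.Icc 1 4).card - 1 = 3 by rfl]
  rw [rCoeff, div_pow, div_pow, mul_pow, ← hpow]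
  have hP : (∏ i ∈ (Finset.Icc (1 : ℕ) 4).erase k, (M : ℂ) ^ (((i : ℂ) - k) / 5)) ≠ 0 := fun h => by
    rw [h, zero_mul] at hpow
    exact pow_ne_zero 4 hE hpow.symm
  generalize (∏ i ∈ (Finset.Icc (1 : ℕ) 4).erase k, (M : ℂ) ^ (((i : ℂ) - k) / 5)) = P at hP
  generalize (∏ i ∈ (Finset.Icc (1 : ℕ) 4).erase k, rising (((i : ℂ) - k) / 5) (M + 1)) = D
  generalize rising (1 - (k : ℂ) / 5) (M + 1) = R
  by_cases hD : D = 0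
  · simp [hD]
  by_cases hR : R = 0
  · simp [hR]
  field_simp

/-- The lower parameters exceed the upper ones by 2 in total, so `wCoeff k n` decays like n^(-2) and
is absolutely summable. The index n + 1 appears because `GammaSeq` at n contains n + 1 factors. -/
theorem tendsto_wCoeff_mul {k : ℕ} (hk : k ∈ Finset.Icc (1 : ℕ) 4) :
    Tendsto (fun n : ℕ => wCoeff k (n + 1) * (n : ℂ) ^ 2) atTop
      (𝓝 ((∏ i ∈ Finset.Icc (1 : ℕ) 4, Complex.Gamma (1 + ((k : ℂ) - i) / 5)) /
        Complex.Gamma ((k : ℂ) / 5) ^ 4)) := by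
  have h1 : Tendsto (fun M => (∏ i ∈ Finset.Icc (1 : ℕ) 4,
      Complex.GammaSeq (1 + ((k : ℂ) - i) / 5) M) / Complex.GammaSeq ((k : ℂ) / 5) M ^ 4) atTop
      (𝓝 ((∏ i ∈ Finset.Icc (1 : ℕ) 4, Complex.Gamma (1 + ((k : ℂ) - i) / 5)) /
        Complex.Gamma ((k : ℂ) / 5) ^ 4)) :=
    (tendsto_finsetProd _ fun i _ => Complex.GammaSeq_tendsto_Gamma _).div
      ((Complex.GammaSeq_tendsto_Gamma _).pow 4) (pow_ne_zero _ (Gamma_ne_zero_div hk))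
  refine h1.congr' ?_
  filter_upwards [eventually_ne_atTop 0] with M hM
  have hM0 : (M : ℂ) ≠ 0 := by exact_mod_cast hM
  have hf : (M.factorial : ℂ) ≠ 0 := by exact_mod_cast M.factorial_ne_zero
  have hpow : (∏ i ∈ Finset.Icc (1 : ℕ) 4, (M : ℂ) ^ (1 + ((k : ℂ) - i) / 5)) =
      ((M : ℂ) ^ ((k : ℂ) / 5)) ^ 4 * (M : ℂ) ^ 2 := by
    have e2 : (M : ℂ) ^ 2 = (M : ℂ) ^ (2 : ℂ) := by
      exact_mod_cast (Complex.cpow_natCast (M : ℂ) 2).symm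
    rw [e2, prod_Icc_one_four]
    simp only [Complex.cpow_def_of_ne_zero hM0, ← Complex.exp_add,
      ← Complex.exp_nat_mul]
    congr 1; push_cast; ring
  have hE : (M : ℂ) ^ ((k : ℂ) / 5) ≠ 0 := by
    rw [Complex.cpow_def_of_ne_zero hM0]; exact Complex.exp_ne_zero _
  simp only [GammaSeq_eq_rising, Finset.prod_div_distrib, Finset.prod_mul_distrib,
    Finset.prod_const, show (Finset.Icc 1 4).card = 4 by rfl]
  rw [wCoeff, div_pow, mul_pow, hpow]
  generalize (∏ i ∈ Finset.Icc (1 : ℕ) 4, rising (1 + ((k : ℂ) - i) / 5) (M + 1)) = D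
  generalize rising ((k : ℂ) / 5) (M + 1) = R
  by_cases hD : D = 0
  · simp [hD]
  by_cases hR : R = 0
  · simp [hR]
  field_simp

theorem exists_norm_le_of_tendsto {u : ℕ → ℂ} {a : ℂ} (h : Tendsto u atTop (𝓝 a)) :
    ∃ C, 0 ≤ C ∧ ∀ n, ‖u n‖ ≤ C := by
  obtain ⟨C, hC⟩ := (Metric.isBounded_range_of_tendsto u h).exists_norm_le
  exact ⟨C, (norm_nonneg _).trans (hC _ (Set.mem_range_self 0)), fun n => hC _ (Set.mem_range_self n)⟩

theorem summable_norm_wCoeff {k : ℕ} (hk : k ∈ Finset.Icc (1 : ℕ) 4) :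
    Summable fun n => ‖wCoeff k n‖ := by
  obtain ⟨C, hC0, hC⟩ := exists_norm_le_of_tendsto (tendsto_wCoeff_mul hk)
  have h2 : Summable fun n : ℕ => C * (1 / (n : ℝ) ^ 2) :=
    (Real.summable_one_div_nat_pow.2 (le_refl 2)).mul_left C
  rw [← summable_nat_add_iff 2]
  refine ((summable_nat_add_iff 1).2 h2).of_nonneg_of_le (fun _ => norm_nonneg _) fun n => ?_
  have h := hC (n + 1)
  have hn : (0 : ℝ) < ((n + 1 : ℕ) : ℝ) ^ 2 := by positivity
  rw [norm_mul, norm_pow, Complex.norm_natCast] at h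
  rw [mul_one_div, le_div_iff₀ hn]
  exact h

theorem tendsto_inv_add_natCast (x : ℂ) : Tendsto (fun n : ℕ => (x + n)⁻¹) atTop (𝓝 0) := by
  refine tendsto_inv₀_cobounded.comp ?_
  refine tendsto_norm_atTop_iff_cobounded.1 ?_
  refine tendsto_atTop_mono (f := fun n : ℕ => (n : ℝ) - ‖x‖) (fun n => ?_) ?_
  · have := norm_sub_norm_le (n : ℂ) (-x)
    rw [norm_neg, Complex.norm_natCast] at this
    rwa [show x + n = n - -x by ring]
  · exact tendsto_atTop_add_const_right _ _ tendsto_natCast_atTop_atTop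

/-- Tannery's theorem: `rCoeff k (N - n) / (N + 1)^2` is bounded uniformly in N and n, and `wCoeff
k` is summable. -/
theorem tendsto_truncated {k : ℕ} (hk : k ∈ Finset.Icc (1 : ℕ) 4) (x : ℂ) :
    Tendsto (fun N : ℕ => ∑ n ∈ Finset.range (N + 1),
        wCoeff k n * (rCoeff k (N - n) / ((N : ℂ) + 1) ^ 2) / (x + n)) atTop
      (𝓝 (∑' n, wCoeff k n * gCoeff k / (x + n))) := by
  obtain ⟨C, hC0, hC⟩ := exists_norm_le_of_tendsto (tendsto_rCoeff_div hk)
  obtain ⟨D, hD0, hD⟩ := exists_norm_le_of_tendsto (tendsto_inv_add_natCast x)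
  have hr : ∀ N n : ℕ, ‖rCoeff k (N - n) / ((N : ℂ) + 1) ^ 2‖ ≤ C := by
    intro N n
    have h1 := hC (N - n)
    rw [norm_div, norm_pow] at h1 ⊢
    have e : ∀ m : ℕ, ‖(m : ℂ) + 1‖ = m + 1 := fun m => by
      rw [← Nat.cast_succ, Complex.norm_natCast, Nat.cast_succ]
    rw [e] at h1 ⊢
    have h2 : ((N - n : ℕ) : ℝ) ≤ N := by exact_mod_cast Nat.sub_le _ _
    refine le_trans ?_ h1
    gcongr
  have e : ∀ N : ℕ, ∑ n ∈ Finset.range (N + 1),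
        wCoeff k n * (rCoeff k (N - n) / ((N : ℂ) + 1) ^ 2) / (x + n) =
      ∑' n, if n ∈ Finset.range (N + 1) then
        wCoeff k n * (rCoeff k (N - n) / ((N : ℂ) + 1) ^ 2) / (x + n) else 0 := by
    intro N
    rw [tsum_eq_sum (s := Finset.range (N + 1)) (fun n hn => if_neg hn)]
    exact Finset.sum_congr rfl fun n hn => (if_pos hn).symm
  simp_rw [e]
  refine tendsto_tsum_of_dominated_convergence (bound := fun n => ‖wCoeff k n‖ * C * D)
    (((summable_norm_wCoeff hk).mul_right C).mul_right D) (fun n => ?_) ?_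
  · have h1 : Tendsto (fun N : ℕ => rCoeff k (N - n) / (((N - n : ℕ) : ℂ) + 1) ^ 2) atTop
        (𝓝 (gCoeff k)) := (tendsto_rCoeff_div hk).comp (tendsto_sub_atTop_nat n)
    have h2 : Tendsto (fun N : ℕ => (((N - n : ℕ) : ℂ) + 1) / ((N : ℂ) + 1)) atTop (𝓝 1) := by
      have h3 : Tendsto (fun N : ℕ => 1 - (n : ℂ) * ((1 : ℂ) + N)⁻¹) atTop (𝓝 1) := by
        simpa using ((tendsto_inv_add_natCast 1).const_mul (n : ℂ)).const_sub 1
      refine h3.congr' ?_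
      filter_upwards [eventually_ge_atTop n] with N hN
      have : (N : ℂ) + 1 ≠ 0 := by exact_mod_cast N.succ_ne_zero
      have h' : (1 : ℂ) + N ≠ 0 := by rwa [add_comm]
      rw [Nat.cast_sub hN]
      field_simp
      ring
    have h4 := (((h1.mul (h2.pow 2)).const_mul (wCoeff k n)).div_const (x + n))
    rw [one_pow, mul_one] at h4
    refine h4.congr' ?_
    filter_upwards [eventually_ge_atTop n] with N hN
    have : (((N - n : ℕ) : ℂ) + 1) ≠ 0 := by exact_mod_cast (N - n).succ_ne_zero
    rw [if_pos (Finset.mem_range.2 (by omega))]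
    field_simp
  · refine Eventually.of_forall fun N n => ?_
    split_ifs
    · rw [div_eq_mul_inv, norm_mul, norm_mul]
      gcongr
      · exact hr N n
      · exact hD n
    · rw [norm_zero]; positivity

theorem gammaRatio_eq_sum {s : ℂ}
    (hs : ∀ k ∈ Finset.Icc (1 : ℕ) 4, ∀ n : ℕ, s + k / 5 + n ≠ 0) (hs1 : ∀ n : ℕ, s + 1 + n ≠ 0) :
    gammaRatio s = ∑ k ∈ Finset.Icc (1 : ℕ) 4, ∑' n, wCoeff k n * gCoeff k / (s + k / 5 + n) := by
  have hG1 : Complex.Gamma (s + 1) ≠ 0 := Complex.Gamma_ne_zero fun m h => hs1 m (by rw [h]; ring)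
  have h1 : Tendsto (fun N => (∏ i ∈ Finset.Icc (1 : ℕ) 4, Complex.GammaSeq (s + i / 5) N) /
      Complex.GammaSeq (s + 1) N ^ 4) atTop (𝓝 (gammaRatio s)) :=
    (tendsto_finsetProd _ fun i _ => Complex.GammaSeq_tendsto_Gamma _).div
      ((Complex.GammaSeq_tendsto_Gamma _).pow 4) (pow_ne_zero _ hG1)
  have h2 := h1.mul (tendsto_natCast_div_add_one.pow 2)
  rw [one_pow, mul_one] at h2
  -- Dividing the truncated expansion by (N+1)² removes the polynomial part 1 in the limit, so only
  -- principal parts remain.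
  have h3 : Tendsto (fun N : ℕ => (((1 : ℂ) + N)⁻¹) ^ 2 + ∑ k ∈ Finset.Icc (1 : ℕ) 4,
      ∑ n ∈ Finset.range (N + 1),
        wCoeff k n * (rCoeff k (N - n) / ((N : ℂ) + 1) ^ 2) / (s + k / 5 + n)) atTop
      (𝓝 (0 + ∑ k ∈ Finset.Icc (1 : ℕ) 4, ∑' n, wCoeff k n * gCoeff k / (s + k / 5 + n))) := by
    refine Tendsto.add ?_ (tendsto_finsetSum _ fun k hk => tendsto_truncated hk _)
    simpa using (tendsto_inv_add_natCast 1).pow 2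
  rw [zero_add] at h3
  refine tendsto_nhds_unique h2 (h3.congr' ?_)
  filter_upwards [eventually_ne_atTop 0] with N hN
  have hN0 : (N : ℂ) ≠ 0 := by exact_mod_cast hN
  have hN1 : (N : ℂ) + 1 ≠ 0 := by exact_mod_cast N.succ_ne_zero
  have hf : (N.factorial : ℂ) ≠ 0 := by exact_mod_cast N.factorial_ne_zero
  have ht := truncated_partial_fractions N hs
  have hpow : (∏ i ∈ Finset.Icc (1 : ℕ) 4, (N : ℂ) ^ (s + (i : ℂ) / 5)) * (N : ℂ) ^ 2 =
      ((N : ℂ) ^ (s + 1)) ^ 4 := by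
    have e2 : (N : ℂ) ^ 2 = (N : ℂ) ^ (2 : ℂ) := by
      exact_mod_cast (Complex.cpow_natCast (N : ℂ) 2).symm
    rw [e2, prod_Icc_one_four]
    simp only [Complex.cpow_def_of_ne_zero hN0, ← Complex.exp_add,
      ← Complex.exp_nat_mul]
    congr 1; push_cast; ring
  have hE : (N : ℂ) ^ (s + 1) ≠ 0 := by
    rw [Complex.cpow_def_of_ne_zero hN0]; exact Complex.exp_ne_zero _
  have hP : (∏ i ∈ Finset.Icc (1 : ℕ) 4, (N : ℂ) ^ (s + (i : ℂ) / 5)) ≠ 0 := fun h => by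
    rw [h, zero_mul] at hpow
    exact pow_ne_zero 4 hE hpow.symm
  have hL : (∏ i ∈ Finset.Icc (1 : ℕ) 4, Complex.GammaSeq (s + i / 5) N) /
      Complex.GammaSeq (s + 1) N ^ 4 * ((N : ℂ) / (N + 1)) ^ 2 =
      (rising (s + 1) (N + 1) ^ 4 / ∏ i ∈ Finset.Icc (1 : ℕ) 4, rising (s + i / 5) (N + 1)) /
        ((N : ℂ) + 1) ^ 2 := by
    simp only [GammaSeq_eq_rising, Finset.prod_div_distrib, Finset.prod_mul_distrib,
      Finset.prod_const, show (Finset.Icc 1 4).card = 4 by rfl]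
    rw [div_pow, div_pow, mul_pow, ← hpow]
    generalize (∏ i ∈ Finset.Icc (1 : ℕ) 4, (N : ℂ) ^ (s + (i : ℂ) / 5)) = P at hP
    generalize (∏ i ∈ Finset.Icc (1 : ℕ) 4, rising (s + i / 5) (N + 1)) = D
    generalize rising (s + 1) (N + 1) = R
    by_cases hD : D = 0
    · simp [hD]
    by_cases hR : R = 0
    · simp [hR]
    field_simp
  rw [hL, ht, add_div, Finset.sum_div]
  congr 1
  · rw [inv_pow, one_div, add_comm]
  · refine Finset.sum_congr rfl fun k _ => ?_
    rw [Finset.sum_div]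
    refine Finset.sum_congr rfl fun n _ => ?_
    ring

/-! ### The Lerch-type integral and its continuation -/

/-- With u = x/(1+x), the quotient (1 - xQ)/(1 + x) is the point (1-u)·1 + u·(-Q) of the segment
from 1 to -Q. That segment avoids 0 because the slit plane is star-shaped about 1, and compactness
gives a positive minimum. This one bound dominates all integrals below, locally uniformly in Q. -/
theorem exists_le_norm_one_sub_mul {Q₀ : ℂ} (hQ₀ : Q₀ ∈ cutPlane) :
    ∃ κ > 0, ∃ ε > 0, ∀ Q ∈ Metric.ball Q₀ ε, ∀ x : ℝ, 0 ≤ x →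
      κ * (1 + x) ≤ ‖1 - (x : ℂ) * Q‖ := by
  have hcont : ContinuousOn (fun u : ℝ => ‖(1 - (u : ℂ)) - u * Q₀‖) (Set.Icc 0 1) := by fun_prop
  obtain ⟨u₀, hu₀, hmin⟩ := isCompact_Icc.exists_isMinOn (Set.nonempty_Icc.2 zero_le_one) hcont
  set m := ‖(1 - (u₀ : ℂ)) - u₀ * Q₀‖ with hm
  have hm0 : 0 < m := by
    rw [hm, norm_pos_iff]
    have hmem : ((1 - u₀ : ℝ) • (1 : ℂ) + u₀ • (-Q₀)) ∈ Complex.slitPlane :=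
      Complex.starConvex_one_slitPlane hQ₀ (by linarith [hu₀.2]) hu₀.1 (by ring)
    have := Complex.slitPlane_ne_zero hmem
    convert this using 1
    simp only [Complex.real_smul]; push_cast; ring
  -- Half of the minimum m absorbs the error x‖Q - Q₀‖ from moving Q.
  refine ⟨m / 2, by positivity, m / 2, by positivity, fun Q hQ x hx => ?_⟩
  have h1 : m ≤ ‖(1 - ((x / (1 + x) : ℝ) : ℂ)) - ((x / (1 + x) : ℝ) : ℂ) * Q₀‖ := by
    refine isMinOn_iff.1 hmin (x / (1 + x)) ⟨by positivity, ?_⟩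
    rw [div_le_one (by positivity)]; linarith
  have hx1 : (0 : ℝ) < 1 + x := by linarith
  have hx1' : (1 + x : ℂ) ≠ 0 := by exact_mod_cast hx1.ne'
  have h2 : (1 - ((x / (1 + x) : ℝ) : ℂ)) - ((x / (1 + x) : ℝ) : ℂ) * Q₀ =
      (1 - x * Q₀) / ((1 + x : ℝ) : ℂ) := by
    push_cast; field_simp; ring
  rw [h2, norm_div, Complex.norm_real, Real.norm_eq_abs, abs_of_pos hx1, le_div_iff₀ hx1] at h1
  have h3 : ‖(x : ℂ) * (Q - Q₀)‖ ≤ x * (m / 2) := by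
    rw [norm_mul, Complex.norm_real, Real.norm_eq_abs, abs_of_nonneg hx]
    have : ‖Q - Q₀‖ < m / 2 := by simpa [dist_eq_norm] using hQ
    gcongr
  have h4 : 1 - (x : ℂ) * Q₀ = (1 - x * Q) + x * (Q - Q₀) := by ring
  have h5 := norm_add_le (1 - (x : ℂ) * Q) (x * (Q - Q₀))
  rw [← h4] at h5
  nlinarith

theorem one_sub_mul_ne_zero {Q : ℂ} (hQ : Q ∈ cutPlane) {x : ℝ} (hx : 0 ≤ x) :
    1 - (x : ℂ) * Q ≠ 0 := by
  obtain ⟨κ, hκ, ε, hε, h⟩ := exists_le_norm_one_sub_mul hQ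
  have := h Q (Metric.mem_ball_self hε) x hx
  intro h0
  rw [h0, norm_zero] at this
  nlinarith

theorem isOpen_cutPlane : IsOpen cutPlane :=
  Complex.isOpen_slitPlane.preimage continuous_neg

/-- The integrand `x^{a-1} / (1 - x Q)`. -/
def lerchIntegrand (a Q : ℂ) (x : ℝ) : ℂ := (x : ℂ) ^ (a - 1) / (1 - x * Q)

/-- The integral `∫_0^1 x^{a-1} / (1 - x Q) dx`. -/
def lerchInt (a Q : ℂ) : ℂ := ∫ x in Set.Ioc (0 : ℝ) 1, lerchIntegrand a Q x

theorem aestronglyMeasurable_lerchIntegrand (a Q : ℂ) (μ : MeasureTheory.Measure ℝ) :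
    MeasureTheory.AEStronglyMeasurable (lerchIntegrand a Q) μ := by
  refine Measurable.aestronglyMeasurable ?_
  unfold lerchIntegrand
  refine Measurable.div ?_ (by fun_prop)
  exact Complex.measurable_ofReal.pow_const _

theorem norm_lerchIntegrand_le {a Q : ℂ} {κ : ℝ} (hκ : 0 < κ) {x : ℝ} (hx : 0 < x)
    (h : κ * (1 + x) ≤ ‖1 - (x : ℂ) * Q‖) :
    ‖lerchIntegrand a Q x‖ ≤ κ⁻¹ * (x ^ (a.re - 1) / (1 + x)) := by
  rw [lerchIntegrand, norm_div, Complex.norm_cpow_eq_rpow_re_of_pos hx]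
  have h1 : 0 < κ * (1 + x) := by positivity
  calc x ^ (a - 1).re / ‖1 - (x : ℂ) * Q‖ ≤ x ^ (a - 1).re / (κ * (1 + x)) := by gcongr
    _ = _ := by simp; field_simp

theorem integrableOn_rpow_sub_one {σ : ℝ} (hσ : 0 < σ) :
    MeasureTheory.IntegrableOn (fun x : ℝ => x ^ (σ - 1)) (Set.Ioc 0 1) :=
  (intervalIntegrable_iff_integrableOn_Ioc_of_le zero_le_one).1
    (intervalIntegral.intervalIntegrable_rpow' (by linarith))

theorem integrableOn_rpow_div {σ : ℝ} (h0 : 0 < σ) :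
    MeasureTheory.IntegrableOn (fun x : ℝ => x ^ (σ - 1) / (1 + x)) (Set.Ioc 0 1) := by
  refine (integrableOn_rpow_sub_one h0).mono' (by
    refine Measurable.aestronglyMeasurable ?_
    fun_prop) ?_
  filter_upwards [MeasureTheory.ae_restrict_mem measurableSet_Ioc] with x hx
  have hp : 0 ≤ x ^ (σ - 1) := Real.rpow_nonneg hx.1.le _
  rw [Real.norm_of_nonneg (div_nonneg hp (by linarith [hx.1]))]
  exact div_le_self hp (by linarith [hx.1])

theorem integrableOn_rpow_div_Ioi {σ : ℝ} (h0 : 0 < σ) (h1 : σ < 1) :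
    MeasureTheory.IntegrableOn (fun x : ℝ => x ^ (σ - 1) / (1 + x)) (Set.Ioi 0) := by
  rw [← Set.Ioc_union_Ioi_eq_Ioi zero_le_one]
  refine (integrableOn_rpow_div h0).union ?_
  refine (integrableOn_Ioi_rpow_of_lt (a := σ - 2) (by linarith) one_pos).mono' (by
    refine Measurable.aestronglyMeasurable ?_
    fun_prop) ?_
  filter_upwards [MeasureTheory.ae_restrict_mem measurableSet_Ioi] with x hx
  have hx0 : (0 : ℝ) < x := one_pos.trans hx
  have hp : 0 ≤ x ^ (σ - 1) := Real.rpow_nonneg hx0.le _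
  rw [Real.norm_of_nonneg (div_nonneg hp (by linarith))]
  rw [show σ - 2 = (σ - 1) - 1 by ring, Real.rpow_sub_one hx0.ne' (σ - 1)]
  exact div_le_div_of_nonneg_left hp hx0 (by linarith)

theorem differentiableOn_lerchIntegral_right {a : ℂ} {S : Set ℝ} (hS : MeasurableSet S)
    (hS0 : S ⊆ Set.Ioi 0)
    (hint : MeasureTheory.IntegrableOn (fun x : ℝ => x ^ (a.re - 1) / (1 + x)) S) :
    DifferentiableOn ℂ (fun Q => ∫ x in S, lerchIntegrand a Q x) cutPlane := by
  refine differentiableOn_integral_of_dominated (F := fun Q x => lerchIntegrand a Q x)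
    isOpen_cutPlane
    (fun Q _ => aestronglyMeasurable_lerchIntegrand a Q _) ?_ fun Q₀ hQ₀ => ?_
  · filter_upwards [MeasureTheory.ae_restrict_mem hS] with x hx Q hQ
    have := one_sub_mul_ne_zero hQ (le_of_lt (hS0 hx))
    have h1 : DifferentiableAt ℂ (fun Q : ℂ => 1 - (x : ℂ) * Q) Q := by fun_prop
    exact ((differentiableAt_const _).div h1 this).differentiableWithinAt
  · obtain ⟨κ, hκ, ε, hε, h⟩ := exists_le_norm_one_sub_mul hQ₀
    refine ⟨_, hint.const_mul κ⁻¹, ε, hε, ?_⟩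
    filter_upwards [MeasureTheory.ae_restrict_mem hS] with x hx Q hQ
    exact norm_lerchIntegrand_le hκ (hS0 hx) (h Q hQ x (le_of_lt (hS0 hx)))

theorem differentiableOn_lerchInt_right {a : ℂ} (ha : 0 < a.re) :
    DifferentiableOn ℂ (lerchInt a) cutPlane :=
  differentiableOn_lerchIntegral_right measurableSet_Ioc (fun _ hx => hx.1)
    (integrableOn_rpow_div ha)

theorem differentiableOn_lerchInt_left {Q : ℂ} (hQ : Q ∈ cutPlane) :
    DifferentiableOn ℂ (fun a => lerchInt a Q) {a | 0 < a.re} := by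
  obtain ⟨κ, hκ, ε, hε, h⟩ := exists_le_norm_one_sub_mul hQ
  refine differentiableOn_integral_of_dominated (F := fun a x => lerchIntegrand a Q x)
    (isOpen_lt continuous_const Complex.continuous_re)
    (fun a _ => aestronglyMeasurable_lerchIntegrand a Q _) ?_ fun a₀ ha₀ => ?_
  · filter_upwards [MeasureTheory.ae_restrict_mem measurableSet_Ioc] with x hx a ha
    have hx0 : (x : ℂ) ≠ 0 := by exact_mod_cast hx.1.ne'
    have h1 : DifferentiableAt ℂ (fun a : ℂ => (x : ℂ) ^ (a - 1)) a :=
      DifferentiableAt.const_cpow (by fun_prop) (Or.inl hx0)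
    exact (h1.div_const _).differentiableWithinAt
  · have ha₀' : 0 < a₀.re := ha₀
    refine ⟨_, (integrableOn_rpow_sub_one (half_pos ha₀')).const_mul κ⁻¹, a₀.re / 2,
      half_pos ha₀', ?_⟩
    filter_upwards [MeasureTheory.ae_restrict_mem measurableSet_Ioc] with x hx a ha
    refine (norm_lerchIntegrand_le hκ hx.1 (h Q (Metric.mem_ball_self hε) x hx.1.le)).trans ?_
    have hre : a₀.re / 2 ≤ a.re := by
      have h1 : |(a - a₀).re| ≤ ‖a - a₀‖ := Complex.abs_re_le_norm _
      have h2 : ‖a - a₀‖ < a₀.re / 2 := by simpa [dist_eq_norm] using ha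
      have h3 := (abs_lt.1 (h1.trans_lt h2)).1
      rw [Complex.sub_re] at h3
      linarith
    have hp : 0 ≤ x ^ (a.re - 1) := Real.rpow_nonneg hx.1.le _
    have h4 : x ^ (a.re - 1) / (1 + x) ≤ x ^ (a₀.re / 2 - 1) :=
      (div_le_self hp (by linarith [hx.1])).trans
        (Real.rpow_le_rpow_of_exponent_ge hx.1 hx.2 (by linarith))
    gcongr

theorem norm_lerchInt_le {a Q : ℂ} (ha : 0 < a.re) {κ : ℝ} (hκ : 0 < κ)
    (h : ∀ x : ℝ, 0 ≤ x → κ * (1 + x) ≤ ‖1 - (x : ℂ) * Q‖) :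
    ‖lerchInt a Q‖ ≤ κ⁻¹ * (1 / a.re) := by
  have h1 : ∫ x in Set.Ioc (0 : ℝ) 1, κ⁻¹ * x ^ (a.re - 1) = κ⁻¹ * (1 / a.re) := by
    rw [MeasureTheory.integral_const_mul, ← intervalIntegral.integral_of_le zero_le_one,
      integral_rpow (Or.inl (by linarith))]
    simp [Real.zero_rpow ha.ne']
  rw [← h1, lerchInt]
  refine MeasureTheory.norm_integral_le_of_norm_le
    ((integrableOn_rpow_sub_one ha).const_mul κ⁻¹) ?_
  filter_upwards [MeasureTheory.ae_restrict_mem measurableSet_Ioc] with x hx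
  refine (norm_lerchIntegrand_le hκ hx.1 (h x hx.1.le)).trans ?_
  have hp : 0 ≤ x ^ (a.re - 1) := Real.rpow_nonneg hx.1.le _
  have : x ^ (a.re - 1) / (1 + x) ≤ x ^ (a.re - 1) := div_le_self hp (by linarith [hx.1])
  gcongr

/-- Power series of the Lerch integral at `Q = 0`. -/
theorem lerchInt_eq_tsum {a Q : ℂ} (ha : 0 < a.re) (hQ : ‖Q‖ < 1) :
    lerchInt a Q = ∑' d : ℕ, Q ^ d / (d + a) := by
  have hint : ∀ d : ℕ, ∫ x in Set.Ioc (0 : ℝ) 1, Q ^ d * (x : ℂ) ^ (d + a - 1) =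
      Q ^ d / (d + a) := by
    intro d
    have hd : (0 : ℝ) ≤ d := d.cast_nonneg
    have hne : (d : ℂ) + a ≠ 0 := fun h => by
      have := congrArg Complex.re h
      simp at this; linarith
    rw [MeasureTheory.integral_const_mul, ← intervalIntegral.integral_of_le zero_le_one,
      integral_cpow (Or.inl (by simp; linarith))]
    simp [hne, Complex.zero_cpow, div_eq_mul_inv]
  have hnorm : ∀ d : ℕ, ∀ x ∈ Set.Ioc (0 : ℝ) 1, ‖Q ^ d * (x : ℂ) ^ (d + a - 1)‖ ≤
      ‖Q‖ ^ d * x ^ (a.re - 1) := by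
    intro d x hx
    have hd : (0 : ℝ) ≤ d := d.cast_nonneg
    rw [norm_mul, norm_pow, Complex.norm_cpow_eq_rpow_re_of_pos hx.1]
    gcongr ?_ * ?_
    exact Real.rpow_le_rpow_of_exponent_ge hx.1 hx.2 (by simp)
  have hmeas : ∀ d : ℕ, MeasureTheory.AEStronglyMeasurable
      (fun x : ℝ => Q ^ d * (x : ℂ) ^ (d + a - 1)) (MeasureTheory.volume.restrict (Set.Ioc 0 1)) :=
    fun d => ((Complex.measurable_ofReal.pow_const _).const_mul _).aestronglyMeasurable
  have hI : ∀ d : ℕ, MeasureTheory.Integrable (fun x : ℝ => Q ^ d * (x : ℂ) ^ (d + a - 1))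
      (MeasureTheory.volume.restrict (Set.Ioc 0 1)) := fun d =>
    ((integrableOn_rpow_sub_one ha).const_mul (‖Q‖ ^ d)).mono' (hmeas d) (by
      filter_upwards [MeasureTheory.ae_restrict_mem measurableSet_Ioc] with x hx
      exact hnorm d x hx)
  have hsum : Summable fun d : ℕ => ∫ x in Set.Ioc (0 : ℝ) 1, ‖Q ^ d * (x : ℂ) ^ (d + a - 1)‖ := by
    refine ((summable_geometric_of_lt_one (norm_nonneg _) hQ).mul_right
      (∫ x in Set.Ioc (0 : ℝ) 1, x ^ (a.re - 1))).of_nonneg_of_le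
      (fun d => MeasureTheory.integral_nonneg fun x => norm_nonneg _) fun d => ?_
    rw [← MeasureTheory.integral_const_mul]
    refine MeasureTheory.setIntegral_mono_on (hI d).norm
      ((integrableOn_rpow_sub_one ha).const_mul _) measurableSet_Ioc fun x hx => hnorm d x hx
  have key := MeasureTheory.hasSum_integral_of_summable_integral_norm hI hsum
  simp_rw [hint] at key
  rw [key.tsum_eq, lerchInt]
  refine MeasureTheory.setIntegral_congr_fun measurableSet_Ioc fun x hx => ?_
  have hx0 : (x : ℂ) ≠ 0 := by exact_mod_cast hx.1.ne'
  have hxQ : ‖(x : ℂ) * Q‖ < 1 := by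
    rw [norm_mul, Complex.norm_real, Real.norm_eq_abs, abs_of_pos hx.1]
    nlinarith [hx.2, norm_nonneg Q, hx.1]
  have hg := (hasSum_geometric_of_norm_lt_one hxQ).mul_left ((x : ℂ) ^ (a - 1))
  simp only [lerchIntegrand]
  rw [div_eq_mul_inv, ← hg.tsum_eq]
  refine tsum_congr fun d => ?_
  rw [show (d : ℂ) + a - 1 = (a - 1) + d by ring, Complex.cpow_add _ _ hx0, Complex.cpow_natCast,
    mul_pow]
  ring

/-! ### The half-line integral and the behaviour of the Lerch integral for |Q| > 1. -/

/-- `∫_0^∞ y^{a-1} / (1 + y) dy = π / sin (π a)`. -/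
theorem integral_cpow_div_one_add {a : ℂ} (h0 : 0 < a.re) (h1 : a.re < 1) :
    ∫ y in Set.Ioi (0 : ℝ), (y : ℂ) ^ (a - 1) / (1 + y) =
      Real.pi / Complex.sin (Real.pi * a) := by
  have hB := Complex.Gamma_mul_Gamma_eq_betaIntegral h0 (t := 1 - a) (by simp; linarith)
  rw [add_sub_cancel, Complex.Gamma_one, one_mul, Complex.Gamma_mul_Gamma_one_sub] at hB
  rw [hB, Complex.betaIntegral, intervalIntegral.integral_of_le zero_le_one,
    MeasureTheory.integral_Ioc_eq_integral_Ioo]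
  -- The substitution x = y/(1+y) carries the integral to the Beta integral B(a, 1-a) = Γ(a)Γ(1-a),
  -- evaluated by reflection.
  have himage : (fun y : ℝ => y / (1 + y)) '' Set.Ioi 0 = Set.Ioo 0 1 := by
    ext x
    simp only [Set.mem_image, Set.mem_Ioi, Set.mem_Ioo]
    constructor
    · rintro ⟨y, hy, rfl⟩
      refine ⟨by positivity, ?_⟩
      rw [div_lt_one (by positivity)]; linarith
    · rintro ⟨hx0, hx1⟩
      have : 0 < 1 - x := by linarith
      refine ⟨x / (1 - x), by positivity, ?_⟩
      field_simp; ring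
  have hderiv : ∀ y ∈ Set.Ioi (0 : ℝ), HasDerivWithinAt (fun y : ℝ => y / (1 + y))
      (1 / (1 + y) ^ 2) (Set.Ioi 0) y := by
    intro y hy
    have hy' : (0 : ℝ) < y := hy
    have hy1 : (1 + y) ≠ 0 := by positivity
    have := (hasDerivAt_id y).div ((hasDerivAt_id y).const_add 1) hy1
    refine (this.congr_deriv ?_).hasDerivWithinAt
    simp
  have hinj : Set.InjOn (fun y : ℝ => y / (1 + y)) (Set.Ioi 0) := by
    intro y hy z hz h
    have hy' : (0 : ℝ) < y := hy
    have hz' : (0 : ℝ) < z := hz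
    simp only at h
    rw [div_eq_div_iff (by positivity) (by positivity)] at h
    linarith
  rw [← himage, MeasureTheory.integral_image_eq_integral_abs_deriv_smul measurableSet_Ioi hderiv hinj]
  refine MeasureTheory.setIntegral_congr_fun measurableSet_Ioi fun y hy => ?_
  have hy' : (0 : ℝ) < y := hy
  have hy1 : (0 : ℝ) < 1 + y := by positivity
  have e1 : (1 : ℂ) - ((y / (1 + y) : ℝ) : ℂ) = (((1 + y)⁻¹ : ℝ) : ℂ) := by
    push_cast
    have : (1 + y : ℂ) ≠ 0 := by exact_mod_cast hy1.ne'
    field_simp; ring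
  have e2 : ((y / (1 + y) : ℝ) : ℂ) = (y : ℂ) * (((1 + y)⁻¹ : ℝ) : ℂ) := by push_cast; rfl
  have hz : (((1 + y)⁻¹ : ℝ) : ℂ) ≠ 0 := by exact_mod_cast (inv_pos.2 hy1).ne'
  rw [e1, e2, Complex.mul_cpow_ofReal_nonneg hy'.le (inv_pos.2 hy1).le, mul_assoc,
    ← Complex.cpow_add _ _ hz, show a - 1 + (1 - a - 1) = -1 by ring, Complex.cpow_neg_one,
    abs_of_pos (by positivity), Complex.real_smul]
  push_cast
  have : (1 + y : ℂ) ≠ 0 := by exact_mod_cast hy1.ne'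
  field_simp

theorem isPreconnected_cutPlane : IsPreconnected cutPlane := by
  have : cutPlane = (fun z => -z) '' Complex.slitPlane := by
    ext z; simp [cutPlane]
  rw [this]
  exact (Complex.starConvex_one_slitPlane.isPathConnected
    Complex.one_mem_slitPlane).isConnected.isPreconnected.image _ continuous_neg.continuousOn

theorem integral_Ioi_lerchIntegrand_neg {a : ℂ} (h0 : 0 < a.re) (h1 : a.re < 1) {R : ℝ}
    (hR : 0 < R) :
    ∫ x in Set.Ioi (0 : ℝ), lerchIntegrand a (-R) x =
      Real.pi / Complex.sin (Real.pi * a) * Complex.exp (-(a * Complex.log R)) := by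
  have hR0 : (R : ℂ) ≠ 0 := by exact_mod_cast hR.ne'
  have hc := MeasureTheory.integral_comp_mul_left_Ioi
    (fun y : ℝ => (y : ℂ) ^ (a - 1) / (1 + y)) 0 hR
  rw [mul_zero, integral_cpow_div_one_add h0 h1] at hc
  have he : ∀ x ∈ Set.Ioi (0 : ℝ), ((R * x : ℝ) : ℂ) ^ (a - 1) / (1 + ((R * x : ℝ) : ℂ)) =
      (R : ℂ) ^ (a - 1) * lerchIntegrand a (-R) x := by
    intro x hx
    have hx' : (0 : ℝ) < x := hx
    rw [lerchIntegrand]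
    push_cast
    rw [Complex.mul_cpow_ofReal_nonneg hR.le hx'.le]
    rw [show 1 - (x : ℂ) * -R = 1 + R * x by ring]
    ring
  rw [MeasureTheory.setIntegral_congr_fun measurableSet_Ioi he,
    MeasureTheory.integral_const_mul] at hc
  have hne : (R : ℂ) ^ (a - 1) ≠ 0 := by
    rw [Complex.cpow_def_of_ne_zero hR0]; exact Complex.exp_ne_zero _
  have e : (R : ℂ) ^ (a - 1) * Complex.exp (-(a * Complex.log R)) = (R : ℂ)⁻¹ := by
    rw [Complex.cpow_def_of_ne_zero hR0, ← Complex.exp_add,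
      show Complex.log R * (a - 1) + -(a * Complex.log R) = -Complex.log R by ring,
      Complex.exp_neg, Complex.exp_log hR0]
  refine mul_left_cancel₀ hne (hc.trans ?_)
  rw [Complex.real_smul]
  push_cast
  linear_combination -(Real.pi / Complex.sin (Real.pi * a)) * e

/-- On the negative axis this is a rescaling of the previous integral; both sides are holomorphic on
the connected cut plane, so the identity theorem applies. -/
theorem integral_Ioi_lerchIntegrand {a : ℂ} (h0 : 0 < a.re) (h1 : a.re < 1) {Q : ℂ}
    (hQ : Q ∈ cutPlane) :
    ∫ x in Set.Ioi (0 : ℝ), lerchIntegrand a Q x =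
      Real.pi / Complex.sin (Real.pi * a) * Complex.exp (-(a * Complex.log (-Q))) := by
  have hf : AnalyticOnNhd ℂ (fun Q => ∫ x in Set.Ioi (0 : ℝ), lerchIntegrand a Q x) cutPlane :=
    (differentiableOn_lerchIntegral_right measurableSet_Ioi subset_rfl
      (integrableOn_rpow_div_Ioi h0 h1)).analyticOnNhd isOpen_cutPlane
  have hg : AnalyticOnNhd ℂ (fun Q : ℂ => Real.pi / Complex.sin (Real.pi * a) *
      Complex.exp (-(a * Complex.log (-Q)))) cutPlane := by
    refine DifferentiableOn.analyticOnNhd (fun Q hQ => ?_) isOpen_cutPlane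
    have h : DifferentiableAt ℂ (fun Q : ℂ => Complex.log (-Q)) Q :=
      DifferentiableAt.clog (by fun_prop) hQ
    exact (((h.const_mul a).neg.cexp).const_mul _).differentiableWithinAt
  have h1mem : (-1 : ℂ) ∈ cutPlane := by simp [cutPlane]
  refine hf.eqOn_of_preconnected_of_frequently_eq hg isPreconnected_cutPlane h1mem ?_ hQ
  have ht : Tendsto (fun R : ℝ => -(R : ℂ)) (𝓝[≠] 1) (𝓝[≠] (-1)) := by
    refine tendsto_nhdsWithin_iff.2 ⟨?_, ?_⟩
    · have h : Continuous fun R : ℝ => -(R : ℂ) := by fun_prop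
      have := (h.tendsto 1).mono_left (nhdsWithin_le_nhds (s := {1}ᶜ))
      simpa using this
    · filter_upwards [self_mem_nhdsWithin] with R hR
      simp only [Set.mem_compl_iff, Set.mem_singleton_iff, neg_inj] at hR ⊢
      exact_mod_cast hR
  refine ht.frequently (Eventually.frequently ?_)
  have : ∀ᶠ R : ℝ in 𝓝[≠] 1, 0 < R :=
    (eventually_gt_nhds one_pos).filter_mono nhdsWithin_le_nhds
  filter_upwards [this] with R hR
  rw [integral_Ioi_lerchIntegrand_neg h0 h1 hR, neg_neg]

theorem integral_Ioi_one_lerchIntegrand {a : ℂ} (h1 : a.re < 1) {Q : ℂ} (hQ : 1 < ‖Q‖) :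
    ∫ x in Set.Ioi (1 : ℝ), lerchIntegrand a Q x = -∑' m : ℕ, (1 / Q) ^ (m + 1) / (m + 1 - a) := by
  have hQ0 : Q ≠ 0 := norm_pos_iff.1 (one_pos.trans hQ)
  have hw : ‖1 / Q‖ < 1 := by
    rw [norm_div, norm_one, div_lt_one (one_pos.trans hQ)]; exact hQ
  set w := 1 / Q with hwdef
  have hre : ∀ m : ℕ, (a - 1 - (m + 1)).re = a.re - 1 - (m + 1) := fun m => by simp
  have hint : ∀ m : ℕ, ∫ x in Set.Ioi (1 : ℝ), w ^ (m + 1) * (x : ℂ) ^ (a - 1 - (m + 1)) =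
      w ^ (m + 1) / (m + 1 - a) := by
    intro m
    have hm : (0 : ℝ) ≤ m := m.cast_nonneg
    have hne : (m : ℂ) + 1 - a ≠ 0 := fun h => by
      have := congrArg Complex.re h
      simp at this; linarith
    rw [MeasureTheory.integral_const_mul, integral_Ioi_cpow_of_lt (by rw [hre]; linarith) one_pos,
      Complex.ofReal_one, Complex.one_cpow, show a - 1 - (m + 1) + 1 = -(m + 1 - a) by ring,
      neg_div_neg_eq, mul_one_div]
  have hnorm : ∀ m : ℕ, ∀ x ∈ Set.Ioi (1 : ℝ), ‖w ^ (m + 1) * (x : ℂ) ^ (a - 1 - (m + 1))‖ ≤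
      ‖w‖ ^ m * x ^ (a.re - 2) := by
    intro m x hx
    have hx1 : (1 : ℝ) < x := hx
    have hm : (0 : ℝ) ≤ m := m.cast_nonneg
    rw [norm_mul, norm_pow, Complex.norm_cpow_eq_rpow_re_of_pos (one_pos.trans hx), hre]
    have e1 : ‖w‖ ^ (m + 1) ≤ ‖w‖ ^ m := pow_le_pow_of_le_one (norm_nonneg _) hw.le (Nat.le_succ m)
    have e2 : x ^ (a.re - 1 - (m + 1)) ≤ x ^ (a.re - 2) :=
      Real.rpow_le_rpow_of_exponent_le hx1.le (by linarith)
    gcongr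
  have hmeas : ∀ m : ℕ, MeasureTheory.AEStronglyMeasurable
      (fun x : ℝ => w ^ (m + 1) * (x : ℂ) ^ (a - 1 - (m + 1)))
      (MeasureTheory.volume.restrict (Set.Ioi 1)) :=
    fun d => ((Complex.measurable_ofReal.pow_const _).const_mul _).aestronglyMeasurable
  have hbase : MeasureTheory.IntegrableOn (fun x : ℝ => x ^ (a.re - 2)) (Set.Ioi 1) :=
    integrableOn_Ioi_rpow_of_lt (by linarith) one_pos
  have hI : ∀ m : ℕ, MeasureTheory.Integrable
      (fun x : ℝ => w ^ (m + 1) * (x : ℂ) ^ (a - 1 - (m + 1)))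
      (MeasureTheory.volume.restrict (Set.Ioi 1)) := fun m =>
    (hbase.const_mul (‖w‖ ^ m)).mono' (hmeas m) (by
      filter_upwards [MeasureTheory.ae_restrict_mem measurableSet_Ioi] with x hx
      exact hnorm m x hx)
  have hsum : Summable fun m : ℕ =>
      ∫ x in Set.Ioi (1 : ℝ), ‖w ^ (m + 1) * (x : ℂ) ^ (a - 1 - (m + 1))‖ := by
    refine ((summable_geometric_of_lt_one (norm_nonneg _) hw).mul_right
      (∫ x in Set.Ioi (1 : ℝ), x ^ (a.re - 2))).of_nonneg_of_le
      (fun d => MeasureTheory.integral_nonneg fun x => norm_nonneg _) fun d => ?_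
    rw [← MeasureTheory.integral_const_mul]
    exact MeasureTheory.setIntegral_mono_on (hI d).norm
      (hbase.const_mul _) measurableSet_Ioi fun x hx => hnorm d x hx
  have key := MeasureTheory.hasSum_integral_of_summable_integral_norm hI hsum
  simp_rw [hint] at key
  rw [key.tsum_eq, ← MeasureTheory.integral_neg]
  refine MeasureTheory.setIntegral_congr_fun measurableSet_Ioi fun x hx => ?_
  have hx1 : (1 : ℝ) < x := hx
  have hx0 : (x : ℂ) ≠ 0 := by exact_mod_cast (one_pos.trans hx1).ne'
  have hxw : ‖w * (x : ℂ)⁻¹‖ < 1 := by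
    rw [norm_mul, norm_inv, Complex.norm_real, Real.norm_eq_abs, abs_of_pos (one_pos.trans hx1)]
    have : x⁻¹ < 1 := inv_lt_one_of_one_lt₀ hx1
    nlinarith [norm_nonneg w, inv_pos.2 (one_pos.trans hx1)]
  have hg := (hasSum_geometric_of_norm_lt_one hxw).mul_left ((x : ℂ) ^ (a - 1) * (w * (x : ℂ)⁻¹))
  have e : ∑' m : ℕ, w ^ (m + 1) * (x : ℂ) ^ (a - 1 - (m + 1)) =
      (x : ℂ) ^ (a - 1) * (w * (x : ℂ)⁻¹) * (1 - w * (x : ℂ)⁻¹)⁻¹ := by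
    rw [← hg.tsum_eq]
    refine tsum_congr fun m => ?_
    rw [Complex.cpow_sub _ _ hx0, show ((m : ℂ) + 1) = ((m + 1 : ℕ) : ℂ) by push_cast; rfl,
      Complex.cpow_natCast, mul_pow, inv_pow]
    field_simp
    ring
  rw [e, lerchIntegrand, hwdef]
  have h3 : 1 - w * (x : ℂ)⁻¹ ≠ 0 := fun h => by
    rw [sub_eq_zero] at h
    rw [← h, norm_one] at hxw
    exact lt_irrefl _ hxw
  have h4 : 1 - (x : ℂ) * Q = -(x * Q) * (1 - w * (x : ℂ)⁻¹) := by
    rw [hwdef]; field_simp; ring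
  rw [h4, ← hwdef, div_mul_eq_div_div]
  rw [hwdef]
  field_simp

/-- The integral over (0, 1] is that over (0, ∞) minus that over (1, ∞), the latter expanded in
powers of 1/(xQ). The half-line integral converges only for 0 < Re a < 1. -/
theorem lerchInt_eq_of_one_lt_norm_aux {a : ℂ} (h0 : 0 < a.re) (h1 : a.re < 1) {Q : ℂ}
    (hQc : Q ∈ cutPlane) (hQ : 1 < ‖Q‖) :
    lerchInt a Q = Real.pi / Complex.sin (Real.pi * a) * Complex.exp (-(a * Complex.log (-Q))) +
      ∑' m : ℕ, (1 / Q) ^ (m + 1) / (m + 1 - a) := by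
  obtain ⟨κ, hκ, ε, hε, h⟩ := exists_le_norm_one_sub_mul hQc
  have hI : MeasureTheory.IntegrableOn (lerchIntegrand a Q) (Set.Ioi 0) := by
    refine ((integrableOn_rpow_div_Ioi h0 h1).const_mul κ⁻¹).mono'
      (aestronglyMeasurable_lerchIntegrand a Q _) ?_
    filter_upwards [MeasureTheory.ae_restrict_mem measurableSet_Ioi] with x hx
    exact norm_lerchIntegrand_le hκ hx (h Q (Metric.mem_ball_self hε) x (le_of_lt hx))
  have hs := integral_Ioi_lerchIntegrand h0 h1 hQc
  rw [← Set.Ioc_union_Ioi_eq_Ioi zero_le_one] at hs hI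
  rw [MeasureTheory.setIntegral_union (Set.Ioc_disjoint_Ioi le_rfl) measurableSet_Ioi
    (hI.mono_set Set.subset_union_left) (hI.mono_set Set.subset_union_right),
    integral_Ioi_one_lerchIntegrand h1 hQ] at hs
  rw [lerchInt, ← hs]
  ring

theorem powQ_add (Q a b : ℂ) : powQ Q (a + b) = powQ Q a * powQ Q b := by
  rw [powQ, add_mul, Complex.exp_add]; rfl

theorem ne_zero_of_mem_cutPlane {Q : ℂ} (hQ : Q ∈ cutPlane) : Q ≠ 0 :=
  neg_ne_zero.1 (Complex.slitPlane_ne_zero hQ)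

theorem lerchInt_add_one {a Q : ℂ} (ha : 0 < a.re) (hQ : Q ∈ cutPlane) :
    lerchInt (a + 1) Q = (lerchInt a Q - 1 / a) / Q := by
  have hQ0 := ne_zero_of_mem_cutPlane hQ
  have ha0 : a ≠ 0 := fun h => by simp [h] at ha
  obtain ⟨κ, hκ, ε, hε, h⟩ := exists_le_norm_one_sub_mul hQ
  have hI : MeasureTheory.IntegrableOn (lerchIntegrand a Q) (Set.Ioc 0 1) := by
    refine ((integrableOn_rpow_div ha).const_mul κ⁻¹).mono'
      (aestronglyMeasurable_lerchIntegrand a Q _) ?_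
    filter_upwards [MeasureTheory.ae_restrict_mem measurableSet_Ioc] with x hx
    exact norm_lerchIntegrand_le hκ hx.1 (h Q (Metric.mem_ball_self hε) x hx.1.le)
  have hJ : MeasureTheory.IntegrableOn (fun x : ℝ => (x : ℂ) ^ (a - 1)) (Set.Ioc 0 1) :=
    (intervalIntegrable_iff_integrableOn_Ioc_of_le zero_le_one).1
      (intervalIntegral.intervalIntegrable_cpow' (by simp; linarith))
  have h1 : ∫ x in Set.Ioc (0 : ℝ) 1, (x : ℂ) ^ (a - 1) = 1 / a := by
    rw [← intervalIntegral.integral_of_le zero_le_one, integral_cpow (Or.inl (by simp; linarith))]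
    simp [ha0, Complex.zero_cpow]
  rw [lerchInt, lerchInt, ← h1, ← MeasureTheory.integral_sub hI hJ, ← MeasureTheory.integral_div]
  refine MeasureTheory.setIntegral_congr_fun measurableSet_Ioc fun x hx => ?_
  have hx0 : (x : ℂ) ≠ 0 := by exact_mod_cast hx.1.ne'
  have hne := one_sub_mul_ne_zero hQ hx.1.le
  simp only [lerchIntegrand]
  rw [show a + 1 - 1 = (a - 1) + 1 by ring, Complex.cpow_add _ _ hx0, Complex.cpow_one]
  field_simp
  ring

theorem summable_pow_div {w : ℂ} (hw : ‖w‖ < 1) (a : ℂ) :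
    Summable fun m : ℕ => w ^ (m + 1) / (m + 1 - a) := by
  obtain ⟨C, hC0, hC⟩ := exists_norm_le_of_tendsto (tendsto_inv_add_natCast (1 - a))
  refine ((summable_geometric_of_lt_one (norm_nonneg w) hw).mul_right (‖w‖ * C)).of_norm_bounded
    fun m => ?_
  rw [div_eq_mul_inv, norm_mul, norm_pow, pow_succ, mul_assoc]
  have := hC m
  rw [show 1 - a + m = (m : ℂ) + 1 - a by ring] at this
  gcongr

/-- The recurrence `lerchInt_add_one` carries the formula out of the strip 0 < Re a < 1. Keeping
sin(πb) with the unshifted b avoids tracking the sign (-1)^n. -/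
theorem lerchInt_eq_of_one_lt_norm {b : ℂ} (h0 : 0 < b.re) (h1 : b.re < 1) {Q : ℂ}
    (hQc : Q ∈ cutPlane) (hQ : 1 < ‖Q‖) (n : ℕ) :
    lerchInt (b + n) Q =
      Real.pi * Complex.exp (-(Real.pi * Complex.I * b)) / Complex.sin (Real.pi * b) *
        powQ Q (-b) * (1 / Q) ^ n + ∑' m : ℕ, (1 / Q) ^ (m + 1) / (m + 1 - (b + n)) := by
  induction n with
  | zero =>
    rw [Nat.cast_zero, add_zero, pow_zero, mul_one, lerchInt_eq_of_one_lt_norm_aux h0 h1 hQc hQ]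
    congr 1
    have : Complex.exp (-(b * Complex.log (-Q))) =
        Complex.exp (-(Real.pi * Complex.I * b)) * powQ Q (-b) := by
      rw [powQ, logQ, ← Complex.exp_add]; congr 1; ring
    rw [this]; ring
  | succ n ih =>
    have hn : (0 : ℝ) ≤ n := n.cast_nonneg
    have hQ0 := ne_zero_of_mem_cutPlane hQc
    have hw : ‖1 / Q‖ < 1 := by
      rw [norm_div, norm_one, div_lt_one (one_pos.trans hQ)]; exact hQ
    have hs := summable_pow_div hw (b + n + 1)
    have hne : b + n ≠ 0 := fun h => by
      have := congrArg Complex.re h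
      simp at this; linarith
    -- The subtracted 1/(b+n) of the recurrence, divided by Q, is exactly the m = 0 term of the new
    -- series.
    rw [Nat.cast_succ, ← add_assoc, lerchInt_add_one (by simp; linarith) hQc, ih,
      hs.tsum_eq_zero_add]
    have e : ∀ m : ℕ, (1 / Q) ^ (m + 1 + 1) / (((m + 1 : ℕ) : ℂ) + 1 - (b + n + 1)) =
        (1 / Q) * ((1 / Q) ^ (m + 1) / (m + 1 - (b + n))) := by
      intro m
      rw [pow_succ' _ (m + 1), mul_div_assoc]
      congr 2; push_cast; ring
    simp_rw [e]
    rw [tsum_mul_left]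
    have e2 : ((0 : ℕ) : ℂ) + 1 - (b + n + 1) = -(b + n) := by push_cast; ring
    rw [e2, div_eq_mul_one_div _ Q]
    generalize ∑' m : ℕ, (1 / Q) ^ (m + 1) / (m + 1 - (b + n)) = T
    generalize 1 / Q = w
    field_simp
    ring

/-! ### The continued function -/

/-- k + 5j is a nonzero integer, so k/5 + j has modulus at least 1/5, and H takes away at most 1/10.
-/
theorem one_tenth_le_norm_add {H : ℂ} (hH : ‖H‖ < 1 / 10) {k : ℕ} (hk : k ∈ Finset.Icc (1 : ℕ) 4)
    (j : ℤ) : 1 / 10 ≤ ‖H + k / 5 + j‖ := by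
  have hk' := Finset.mem_Icc.1 hk
  have h1 : (1 : ℝ) ≤ |((k + 5 * j : ℤ) : ℝ)| := by
    have : 1 ≤ |(k + 5 * j : ℤ)| := Int.one_le_abs (by omega)
    exact_mod_cast this
  have h2 : ‖((k + 5 * j : ℤ) : ℂ) / 5‖ = |((k + 5 * j : ℤ) : ℝ)| / 5 := by
    rw [norm_div, Complex.norm_intCast]; norm_num
  have h3 := norm_sub_norm_le (((k + 5 * j : ℤ) : ℂ) / 5) (-H)
  have h4 : ((k + 5 * j : ℤ) : ℂ) / 5 - -H = H + k / 5 + j := by push_cast; ring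
  rw [h4, h2, norm_neg] at h3
  linarith

theorem add_intCast_ne_zero {H : ℂ} (hH : ‖H‖ < 1 / 10) {j : ℤ} (h : H ≠ 0 ∨ j ≠ 0) :
    H + j ≠ 0 := by
  intro h0
  by_cases hj : j = 0
  · subst hj
    simp at h h0
    exact h h0
  · have h1 : (1 : ℝ) ≤ |(j : ℝ)| := by exact_mod_cast Int.one_le_abs hj
    rw [← Complex.norm_intCast, ← norm_neg, ← eq_neg_of_add_eq_zero_left h0] at h1
    linarith

theorem abs_re_lt {H : ℂ} {r : ℝ} (hH : ‖H‖ < r) : -r < H.re ∧ H.re < r :=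
  abs_lt.1 ((Complex.abs_re_le_norm H).trans_lt hH)

/-- The interchange of sums that reassembles `gammaRatio` from its principal parts. It serves twice:
with x d = H + d, u = Q inside the disc, and with x d = H - (d+1), u = 1/Q outside. -/
theorem sum_tsum_div_eq {u : ℂ} (hu : ‖u‖ < 1) {x : ℕ → ℂ}
    (hx : ∀ d, ∀ k ∈ Finset.Icc (1 : ℕ) 4, ∀ n : ℕ, 1 / 10 ≤ ‖x d + k / 5 + n‖)
    (hx1 : ∀ d n : ℕ, x d + 1 + n ≠ 0) :
    ∑ k ∈ Finset.Icc (1 : ℕ) 4, ∑' n : ℕ, wCoeff k n * gCoeff k *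
        ∑' d : ℕ, u ^ d / (x d + k / 5 + n) = ∑' d : ℕ, u ^ d * gammaRatio (x d) := by
  have hinv : ∀ d, ∀ k ∈ Finset.Icc (1 : ℕ) 4, ∀ n : ℕ, ‖(x d + k / 5 + n)⁻¹‖ ≤ 10 :=
    fun d k hk n => by
      rw [norm_inv, inv_le_comm₀ (by linarith [hx d k hk n]) (by norm_num)]
      linarith [hx d k hk n]
  have hS : ∀ k ∈ Finset.Icc (1 : ℕ) 4, Summable (Function.uncurry fun n d : ℕ =>
      wCoeff k n * gCoeff k * (u ^ d / (x d + k / 5 + n))) := by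
    intro k hk
    refine (((summable_norm_wCoeff hk).mul_right (‖gCoeff k‖ * 10)).mul_of_nonneg
      (summable_geometric_of_lt_one (norm_nonneg u) hu) (fun n => by positivity)
      fun d => by positivity).of_norm_bounded ?_
    rintro ⟨n, d⟩
    simp only [Function.uncurry]
    rw [div_eq_mul_inv, norm_mul, norm_mul, norm_mul, norm_pow]
    have := hinv d k hk n
    calc ‖wCoeff k n‖ * ‖gCoeff k‖ * (‖u‖ ^ d * ‖(x d + k / 5 + n)⁻¹‖)
        ≤ ‖wCoeff k n‖ * ‖gCoeff k‖ * (‖u‖ ^ d * 10) := by gcongr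
      _ = _ := by ring
  have h1 : ∀ k ∈ Finset.Icc (1 : ℕ) 4, ∑' n : ℕ, wCoeff k n * gCoeff k *
      ∑' d : ℕ, u ^ d / (x d + k / 5 + n) =
      ∑' d : ℕ, ∑' n : ℕ, wCoeff k n * gCoeff k * (u ^ d / (x d + k / 5 + n)) := by
    intro k hk
    simp_rw [← tsum_mul_left]
    exact ((hS k hk).tsum_comm).symm
  rw [Finset.sum_congr rfl h1, ← Summable.tsum_finsetSum fun k hk => ?_]
  · refine tsum_congr fun d => ?_
    rw [gammaRatio_eq_sum (fun k hk n h => ?_) (hx1 d), Finset.mul_sum]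
    · refine Finset.sum_congr rfl fun k _ => ?_
      rw [← tsum_mul_left]
      exact tsum_congr fun n => by ring
    · have := hx d k hk n
      rw [h, norm_zero] at this
      linarith
  · exact (hS k hk).prod_symm.prod

/-- The superposition of Lerch integrals continuing the `I`-function, up to a prefactor. -/
def lerchSum (H Q : ℂ) : ℂ :=
  ∑ k ∈ Finset.Icc (1 : ℕ) 4, ∑' n : ℕ, wCoeff k n * gCoeff k * lerchInt (H + k / 5 + n) Q

theorem lerchSum_eq_of_norm_lt_one {H Q : ℂ} (hH : ‖H‖ < 1 / 10) (hQ : ‖Q‖ < 1) :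
    lerchSum H Q = ∑' d : ℕ, Q ^ d * gammaRatio (H + d) := by
  have hre := (abs_re_lt hH).1
  rw [← sum_tsum_div_eq hQ]
  · refine Finset.sum_congr rfl fun k _ => tsum_congr fun n => ?_
    have hn : (0 : ℝ) ≤ n := n.cast_nonneg
    have hk1 : (1 : ℝ) ≤ k := by
      exact_mod_cast (Finset.mem_Icc.1 ‹_›).1
    rw [lerchInt_eq_tsum _ hQ]
    · congr 1
      exact tsum_congr fun d => by congr 1; ring
    · have e : (H + (k : ℂ) / 5 + n).re = H.re + k / 5 + n := by
        rw [show H + (k : ℂ) / 5 + n = H + ((k / 5 + n : ℝ) : ℂ) by push_cast; ring, Complex.add_re,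
          Complex.ofReal_re]
        ring
      rw [e]; linarith
  · intro d k hk n
    have := one_tenth_le_norm_add hH hk (d + n)
    convert this using 2
    push_cast; ring
  · intro d n
    have := add_intCast_ne_zero hH (j := d + 1 + n) (Or.inr (by omega))
    convert this using 1
    push_cast; ring

theorem Gamma_add_natCast {x : ℂ} (hx : 0 < x.re) (d : ℕ) :
    Complex.Gamma (x + d) = rising x d * Complex.Gamma x := by
  induction d with
  | zero => simp [rising_zero]
  | succ d ih =>
    have hd : (0 : ℝ) ≤ d := d.cast_nonneg
    have hne : x + d ≠ 0 := fun h => by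
      have := congrArg Complex.re h
      simp at this; linarith
    rw [Nat.cast_succ, ← add_assoc, Complex.Gamma_add_one _ hne, ih, rising_succ]; ring

theorem gammaRatio_add_natCast {H : ℂ} (hH : -(1 / 5) < H.re) (d : ℕ) :
    gammaRatio (H + d) = (∏ i ∈ Finset.Icc (1 : ℕ) 4, rising (H + i / 5) d) /
      rising (H + 1) d ^ 4 * gammaRatio H := by
  have h1 : Complex.Gamma (H + d + 1) = rising (H + 1) d * Complex.Gamma (H + 1) := by
    rw [← Gamma_add_natCast (by simp; linarith)]; congr 1; ring
  have h2 : ∀ i ∈ Finset.Icc (1 : ℕ) 4, Complex.Gamma (H + d + i / 5) =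
      rising (H + i / 5) d * Complex.Gamma (H + i / 5) := by
    intro i hi
    have hi1 : (1 : ℝ) ≤ i := by exact_mod_cast (Finset.mem_Icc.1 hi).1
    rw [← Gamma_add_natCast]
    · congr 1; ring
    · rw [show H + (i : ℂ) / 5 = H + ((i / 5 : ℝ) : ℂ) by push_cast; ring, Complex.add_re,
          Complex.ofReal_re]
      linarith
  rw [gammaRatio, gammaRatio, Finset.prod_congr rfl h2, Finset.prod_mul_distrib, h1, mul_pow,
    div_mul_div_comm]

theorem iFun_eq {H Q : ℂ} (hH : ‖H‖ < 1 / 10) (hQ : ‖Q‖ < 1) :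
    iFun H Q = (gammaRatio H)⁻¹ * powQ Q H * lerchSum H Q := by
  have hre := (abs_re_lt hH).1
  have hG := gammaRatio_ne_zero (H := H) (by linarith)
  have h : ∑' d : ℕ, iTerm H Q d = (gammaRatio H)⁻¹ * ∑' d : ℕ, Q ^ d * gammaRatio (H + d) := by
    rw [← tsum_mul_left]
    refine tsum_congr fun d => ?_
    rw [iTerm_eq (by linarith), gammaRatio_add_natCast (by linarith)]
    field_simp
  rw [iFun, lerchSum_eq_of_norm_lt_one hH hQ, h]
  ring

/-- The exact identity before reduction modulo H^4; the subtracted series is the obstruction to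
equality. H ≠ 0 keeps Γ(s+1) away from its poles at s = H - (m+1). -/
theorem lerchSum_eq_of_one_lt_norm {H Q : ℂ} (hH : ‖H‖ < 1 / 10) (hH0 : H ≠ 0) (hQc : Q ∈ cutPlane)
    (hQ : 1 < ‖Q‖) :
    (gammaRatio H)⁻¹ * powQ Q H * lerchSum H Q = gammaSide H Q - (gammaRatio H)⁻¹ * powQ Q H *
      (1 / Q * ∑' m : ℕ, (1 / Q) ^ m * gammaRatio (H - (m + 1))) := by
  obtain ⟨hre1, hre2⟩ := abs_re_lt hH
  have hw : ‖1 / Q‖ < 1 := by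
    rw [norm_div, norm_one, div_lt_one (one_pos.trans hQ)]; exact hQ
  have hx : ∀ d : ℕ, ∀ k ∈ Finset.Icc (1 : ℕ) 4, ∀ n : ℕ,
      1 / 10 ≤ ‖H - ((d : ℂ) + 1) + k / 5 + n‖ := by
    intro d k hk n
    have := one_tenth_le_norm_add hH hk (n - (d + 1) : ℤ)
    convert this using 2
    push_cast; ring
  have hx1 : ∀ d n : ℕ, H - ((d : ℂ) + 1) + 1 + n ≠ 0 := by
    intro d n
    have := add_intCast_ne_zero hH (j := n - d) (Or.inl hH0)
    convert this using 1
    push_cast; ring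
  rw [gammaSide_eq (by linarith), ← sum_tsum_div_eq hw hx hx1, lerchSum, Finset.mul_sum,
    Finset.mul_sum, Finset.mul_sum, Finset.mul_sum, ← Finset.sum_sub_distrib]
  refine Finset.sum_congr rfl fun k hk => ?_
  have hkk := Finset.mem_Icc.1 hk
  have hk1 : (1 : ℝ) ≤ k := by exact_mod_cast hkk.1
  have hk4 : (k : ℝ) ≤ 4 := by exact_mod_cast hkk.2
  have e : (H + (k : ℂ) / 5).re = H.re + k / 5 := by
    rw [show H + (k : ℂ) / 5 = H + ((k / 5 : ℝ) : ℂ) by push_cast; ring, Complex.add_re,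
      Complex.ofReal_re]
  have h1 : ∀ n : ℕ, wCoeff k n * gCoeff k * lerchInt (H + k / 5 + n) Q =
      gCoeff k * (Real.pi * Complex.exp (-(Real.pi * Complex.I * (H + (k : ℂ) / 5))) /
        Complex.sin (Real.pi * (H + (k : ℂ) / 5))) * powQ Q (-(H + k / 5)) *
        wTerm k (1 / Q) n -
      1 / Q * (wCoeff k n * gCoeff k *
        ∑' d : ℕ, (1 / Q) ^ d / (H - ((d : ℂ) + 1) + k / 5 + n)) := by
    intro n
    rw [lerchInt_eq_of_one_lt_norm (by rw [e]; linarith) (by rw [e]; linarith) hQc hQ, wTerm_eq hk]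
    have h2 : ∑' m : ℕ, (1 / Q) ^ (m + 1) / ((m : ℂ) + 1 - (H + k / 5 + n)) =
        -(1 / Q) * ∑' d : ℕ, (1 / Q) ^ d / (H - ((d : ℂ) + 1) + k / 5 + n) := by
      rw [← tsum_mul_left]
      refine tsum_congr fun m => ?_
      rw [show (m : ℂ) + 1 - (H + k / 5 + n) = -(H - ((m : ℂ) + 1) + k / 5 + n) by ring, div_neg,
        pow_succ]
      ring
    rw [h2]; ring
  have hs1 : Summable fun n => wTerm k (1 / Q) n := by
    simp_rw [wTerm_eq hk]
    refine (summable_norm_wCoeff hk).of_norm_bounded fun n => ?_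
    rw [norm_mul, norm_pow]
    exact mul_le_of_le_one_right (norm_nonneg _) (pow_le_one₀ (norm_nonneg _) hw.le)
  have hs2 : Summable fun n : ℕ => wCoeff k n * gCoeff k *
      ∑' d : ℕ, (1 / Q) ^ d / (H - ((d : ℂ) + 1) + k / 5 + n) := by
    have hg := summable_geometric_of_lt_one (norm_nonneg _) hw
    refine ((summable_norm_wCoeff hk).mul_right
      (‖gCoeff k‖ * ∑' d : ℕ, ‖1 / Q‖ ^ d * 10)).of_norm_bounded fun n => ?_
    rw [norm_mul, norm_mul, mul_assoc]
    gcongr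
    refine tsum_of_norm_bounded (hg.mul_right 10).hasSum fun d => ?_
    rw [div_eq_mul_inv, norm_mul, norm_pow, norm_inv]
    have h10 := hx d k hk n
    have : ‖H - ((d : ℂ) + 1) + k / 5 + n‖⁻¹ ≤ 10 := by
      rw [inv_le_comm₀ (by linarith) (by norm_num)]; linarith
    gcongr
  simp_rw [h1]
  rw [(hs1.mul_left _).tsum_sub (hs2.mul_left _), tsum_mul_left, tsum_mul_left, ← wTilde]
  have h3 : powQ Q H * powQ Q (-(H + k / 5)) = powQ Q (-(k / 5)) := by
    rw [← powQ_add]; congr 1; ring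
  rw [← h3]
  ring

/-! ### The obstruction vanishes to fourth order at H = 0. -/

theorem gammaRatio_sub_one {s : ℂ} (hs : ∀ i ∈ Finset.Icc (1 : ℕ) 4, s - 1 + i / 5 ≠ 0)
    (hs0 : s ≠ 0) :
    gammaRatio (s - 1) = gammaRatio s * s ^ 4 / ∏ i ∈ Finset.Icc (1 : ℕ) 4, (s - 1 + i / 5) := by
  have h1 : Complex.Gamma (s + 1) = s * Complex.Gamma s := Complex.Gamma_add_one _ hs0
  have h2 : ∀ i ∈ Finset.Icc (1 : ℕ) 4, Complex.Gamma (s + i / 5) =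
      (s - 1 + i / 5) * Complex.Gamma (s - 1 + i / 5) := fun i hi => by
    rw [← Complex.Gamma_add_one _ (hs i hi)]; congr 1; ring
  have hP : ∏ i ∈ Finset.Icc (1 : ℕ) 4, (s - 1 + (i : ℂ) / 5) ≠ 0 := Finset.prod_ne_zero_iff.2 hs
  rw [gammaRatio, gammaRatio, Finset.prod_congr rfl h2, Finset.prod_mul_distrib, h1,
    sub_add_cancel]
  by_cases h0 : Complex.Gamma s = 0
  · simp [h0]
  · generalize ∏ i ∈ Finset.Icc (1 : ℕ) 4, (s - 1 + (i : ℂ) / 5) = P at hP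
    field_simp

/-- The first downward step contributes H^4 over four factors of size at least 1/10, hence 10^4.
Each later step multiplies by a ratio of modulus at most 1: the numerator factors are at most m + 1
+ 1/10 and the denominator factors at least that. -/
theorem norm_gammaRatio_sub_le {H : ℂ} (hH : ‖H‖ < 1 / 10) (hH0 : H ≠ 0) (m : ℕ) :
    ‖gammaRatio (H - (m + 1))‖ ≤ 10 ^ 4 * ‖gammaRatio H‖ * ‖H‖ ^ 4 := by
  have hlow : ∀ m : ℕ, ∀ i ∈ Finset.Icc (1 : ℕ) 4, (m : ℝ) + 1 / 10 ≤ ‖H - m - 1 + i / 5‖ := by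
    intro m i hi
    have h4 : (i : ℝ) ≤ 4 := by exact_mod_cast (Finset.mem_Icc.1 hi).2
    have h1 := norm_sub_norm_le ((m + 1 - i / 5 : ℝ) : ℂ) H
    have h2 : (m : ℝ) + 1 - i / 5 ≤ ‖((m + 1 - i / 5 : ℝ) : ℂ)‖ := by
      rw [Complex.norm_real]; exact Real.le_norm_self _
    have h3 : ((m + 1 - i / 5 : ℝ) : ℂ) - H = -(H - m - 1 + i / 5) := by push_cast; ring
    rw [h3, norm_neg] at h1
    linarith
  have hm0 : ∀ m : ℕ, (0 : ℝ) < m + 1 / 10 := fun m => by positivity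
  have hrec : ∀ m : ℕ, gammaRatio (H - m - 1) = gammaRatio (H - m) * (H - m) ^ 4 /
      ∏ i ∈ Finset.Icc (1 : ℕ) 4, (H - m - 1 + (i : ℂ) / 5) := fun m =>
    gammaRatio_sub_one (fun i hi => norm_pos_iff.1 ((hm0 m).trans_le (hlow m i hi))) (by
      have := add_intCast_ne_zero hH (j := -m) (Or.inl hH0)
      push_cast at this
      rwa [← sub_eq_add_neg] at this)
  have hprod : ∀ m : ℕ, ((m : ℝ) + 1 / 10) ^ 4 ≤
      ‖∏ i ∈ Finset.Icc (1 : ℕ) 4, (H - m - 1 + (i : ℂ) / 5)‖ := by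
    intro m
    rw [norm_prod]
    have := Finset.prod_le_prod (s := Finset.Icc (1 : ℕ) 4) (fun i _ => (hm0 m).le) (hlow m)
    simpa using this
  induction m with
  | zero =>
    have h := hrec 0
    have hp := hprod 0
    simp only [Nat.cast_zero, sub_zero, zero_add] at h hp ⊢
    rw [h, norm_div, norm_mul, norm_pow, div_le_iff₀ (lt_of_lt_of_le (by norm_num) hp)]
    calc ‖gammaRatio H‖ * ‖H‖ ^ 4 = 10 ^ 4 * ‖gammaRatio H‖ * ‖H‖ ^ 4 * (1 / 10) ^ 4 := by ring
      _ ≤ _ := by gcongr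
  | succ m ih =>
    have h := hrec (m + 1)
    have hp := hprod (m + 1)
    push_cast at h hp ⊢
    have hpos : (0 : ℝ) < ((m : ℝ) + 1 + 1 / 10) ^ 4 := by positivity
    have hup : ‖H - (m + 1)‖ ≤ (m : ℝ) + 1 + 1 / 10 := by
      have := norm_sub_le H ((m : ℂ) + 1)
      have e : ‖(m : ℂ) + 1‖ = m + 1 := by
        rw [← Nat.cast_succ, Complex.norm_natCast, Nat.cast_succ]
      rw [e] at this
      linarith
    rw [← sub_sub, h, norm_div, norm_mul, norm_pow, div_le_iff₀ (hpos.trans_le hp)]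
    have h5 : ‖H - (m + 1)‖ ^ 4 ≤ ((m : ℝ) + 1 + 1 / 10) ^ 4 := by gcongr
    calc ‖gammaRatio (H - (m + 1))‖ * ‖H - (m + 1)‖ ^ 4
        ≤ (10 ^ 4 * ‖gammaRatio H‖ * ‖H‖ ^ 4) * ‖H - (m + 1)‖ ^ 4 := by gcongr
      _ ≤ _ := by gcongr; exact h5.trans hp

/-! ### Holomorphy of the continued function in H and in Q, and the connection formula. -/

theorem differentiableAt_gammaRatio {H : ℂ} (hH : -(1 / 5) < H.re) :
    DifferentiableAt ℂ gammaRatio H := by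
  have hd : ∀ x : ℂ, 0 < (H + x).re → DifferentiableAt ℂ (fun s => Complex.Gamma (s + x)) H := by
    intro x hx
    refine DifferentiableAt.comp H (f := fun s => s + x) (Complex.differentiableAt_Gamma _ fun m h => ?_)
      (by fun_prop)
    rw [h] at hx
    have : (0 : ℝ) ≤ m := m.cast_nonneg
    simp at hx
    linarith
  unfold gammaRatio
  refine DifferentiableAt.div (DifferentiableAt.fun_finsetProd fun i hi => hd _ ?_) ((hd 1 ?_).pow 4) ?_
  · have hi1 : (1 : ℝ) ≤ i := by exact_mod_cast (Finset.mem_Icc.1 hi).1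
    rw [show H + (i : ℂ) / 5 = H + ((i / 5 : ℝ) : ℂ) by push_cast; ring, Complex.add_re,
      Complex.ofReal_re]
    linarith
  · simp; linarith
  · exact pow_ne_zero _ (Complex.Gamma_ne_zero_of_re_pos (by simp; linarith))

theorem re_lerch_parameter {H : ℂ} (hH : ‖H‖ < 1 / 10) {k : ℕ} (hk : k ∈ Finset.Icc (1 : ℕ) 4)
    (n : ℕ) : 1 / 10 ≤ (H + k / 5 + n).re := by
  have hn : (0 : ℝ) ≤ n := n.cast_nonneg
  have hk1 : (1 : ℝ) ≤ k := by exact_mod_cast (Finset.mem_Icc.1 hk).1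
  rw [show H + (k : ℂ) / 5 + n = H + ((k / 5 + n : ℝ) : ℂ) by push_cast; ring, Complex.add_re,
    Complex.ofReal_re]
  linarith [(abs_re_lt hH).1]

theorem norm_lerchSum_term_le {H Q : ℂ} (hH : ‖H‖ < 1 / 10) {k : ℕ}
    (hk : k ∈ Finset.Icc (1 : ℕ) 4) (n : ℕ) {κ : ℝ} (hκ : 0 < κ)
    (h : ∀ x : ℝ, 0 ≤ x → κ * (1 + x) ≤ ‖1 - (x : ℂ) * Q‖) :
    ‖wCoeff k n * gCoeff k * lerchInt (H + k / 5 + n) Q‖ ≤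
      ‖wCoeff k n‖ * (‖gCoeff k‖ * (κ⁻¹ * 10)) := by
  have hre := re_lerch_parameter hH hk n
  rw [norm_mul, norm_mul, mul_assoc]
  have h1 := norm_lerchInt_le (lt_of_lt_of_le (by norm_num) hre) hκ h
  have h2 : 1 / (H + k / 5 + n).re ≤ 10 := by
    rw [div_le_iff₀ (lt_of_lt_of_le (by norm_num) hre)]; linarith
  have h3 : ‖lerchInt (H + k / 5 + n) Q‖ ≤ κ⁻¹ * 10 := h1.trans (by gcongr)
  gcongr

theorem differentiableOn_lerchSum_left {Q : ℂ} (hQ : Q ∈ cutPlane) :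
    DifferentiableOn ℂ (fun H => lerchSum H Q) (Metric.ball 0 (1 / 10)) := by
  obtain ⟨κ, hκ, ε, hε, h⟩ := exists_le_norm_one_sub_mul hQ
  unfold lerchSum
  refine DifferentiableOn.fun_sum fun k hk => ?_
  refine Complex.differentiableOn_tsum_of_summable_norm
    ((summable_norm_wCoeff hk).mul_right (‖gCoeff k‖ * (κ⁻¹ * 10))) (fun n => ?_) Metric.isOpen_ball
    fun n H hH => norm_lerchSum_term_le (mem_ball_zero_iff.1 hH) hk n hκ
      (h Q (Metric.mem_ball_self hε))
  refine DifferentiableOn.const_mul ?_ _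
  refine (differentiableOn_lerchInt_left hQ).comp (by fun_prop) fun H hH => ?_
  exact lt_of_lt_of_le (by norm_num) (re_lerch_parameter (mem_ball_zero_iff.1 hH) hk n)

theorem differentiableOn_lerchSum_right {H : ℂ} (hH : ‖H‖ < 1 / 10) :
    DifferentiableOn ℂ (lerchSum H) cutPlane := by
  intro Q₀ hQ₀
  obtain ⟨κ, hκ, ε, hε, h⟩ := exists_le_norm_one_sub_mul hQ₀
  have hV : IsOpen (Metric.ball Q₀ ε ∩ cutPlane) := Metric.isOpen_ball.inter isOpen_cutPlane
  have hd : DifferentiableOn ℂ (lerchSum H) (Metric.ball Q₀ ε ∩ cutPlane) := by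
    unfold lerchSum
    refine DifferentiableOn.fun_sum fun k hk => ?_
    refine Complex.differentiableOn_tsum_of_summable_norm
      ((summable_norm_wCoeff hk).mul_right (‖gCoeff k‖ * (κ⁻¹ * 10))) (fun n => ?_) hV
      fun n Q hQ => norm_lerchSum_term_le hH hk n hκ (h Q hQ.1)
    refine DifferentiableOn.const_mul ?_ _
    exact (differentiableOn_lerchInt_right
      (lt_of_lt_of_le (by norm_num) (re_lerch_parameter hH hk n))).mono Set.inter_subset_right
  exact (hd.differentiableAt (hV.mem_nhds ⟨Metric.mem_ball_self hε, hQ₀⟩)).differentiableWithinAt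

theorem norm_lerchSum_le {Q₀ : ℂ} (hQ₀ : Q₀ ∈ cutPlane) :
    ∃ C, 0 ≤ C ∧ ∀ᶠ Q in 𝓝 Q₀, ∀ H : ℂ, ‖H‖ < 1 / 10 → ‖lerchSum H Q‖ ≤ C := by
  obtain ⟨κ, hκ, ε, hε, h⟩ := exists_le_norm_one_sub_mul hQ₀
  refine ⟨∑ k ∈ Finset.Icc (1 : ℕ) 4, ∑' n, ‖wCoeff k n‖ * (‖gCoeff k‖ * (κ⁻¹ * 10)),
    Finset.sum_nonneg fun k _ => tsum_nonneg fun n => by positivity, ?_⟩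
  filter_upwards [Metric.ball_mem_nhds Q₀ hε] with Q hQ H hH
  refine norm_sum_le_of_le _ fun k hk => ?_
  exact tsum_of_norm_bounded ((summable_norm_wCoeff hk).mul_right _).hasSum fun n =>
    norm_lerchSum_term_le hH hk n hκ (h Q hQ)

/-- The function of `H` and `Q` continuing the `I`-function to the cut plane. -/
def continuedI (H Q : ℂ) : ℂ := (gammaRatio H)⁻¹ * powQ Q H * lerchSum H Q

theorem differentiable_powQ (Q : ℂ) : Differentiable ℂ (powQ Q) := by
  unfold powQ; fun_prop

theorem differentiableOn_continuedI_left {Q : ℂ} (hQ : Q ∈ cutPlane) :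
    DifferentiableOn ℂ (fun H => continuedI H Q) (Metric.ball 0 (1 / 10)) := by
  refine DifferentiableOn.mul (DifferentiableOn.mul ?_ (differentiable_powQ Q).differentiableOn)
    (differentiableOn_lerchSum_left hQ)
  intro H hH
  have hre := (abs_re_lt (mem_ball_zero_iff.1 hH)).1
  exact ((differentiableAt_gammaRatio (by linarith)).inv
    (gammaRatio_ne_zero (by linarith))).differentiableWithinAt

theorem differentiableAt_logQ {Q : ℂ} (hQ : Q ∈ cutPlane) : DifferentiableAt ℂ logQ Q := by
  unfold logQ
  exact (DifferentiableAt.clog (by fun_prop) hQ).sub_const _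

theorem differentiableOn_continuedI_right {H : ℂ} (hH : ‖H‖ < 1 / 10) :
    DifferentiableOn ℂ (continuedI H) cutPlane := by
  refine DifferentiableOn.mul (DifferentiableOn.const_mul ?_ _) (differentiableOn_lerchSum_right hH)
  intro Q hQ
  exact ((differentiableAt_logQ hQ).const_mul H).cexp.differentiableWithinAt

theorem differentiableOn_hCoeff_continuedI (i : ℕ) :
    DifferentiableOn ℂ (fun Q => hCoeff i fun H => continuedI H Q) cutPlane := by
  have hsub : Metric.closedBall (0 : ℂ) (1 / 20) ⊆ Metric.ball 0 (1 / 10) :=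
    Metric.closedBall_subset_ball (by norm_num)
  refine differentiableOn_hCoeff isOpen_cutPlane (r := 1 / 20) (by norm_num)
    (fun Q hQ => (differentiableOn_continuedI_left hQ).mono hsub)
    (fun H hH => differentiableOn_continuedI_right (mem_ball_zero_iff.1 (hsub hH)))
    (fun Q₀ hQ₀ => ?_) i
  obtain ⟨C, hC0, hC⟩ := norm_lerchSum_le hQ₀
  have hcont : ContinuousOn (fun H => (gammaRatio H)⁻¹) (Metric.closedBall (0 : ℂ) (1 / 20)) := by
    intro H hH
    have hre := (abs_re_lt (mem_ball_zero_iff.1 (hsub hH))).1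
    exact ((differentiableAt_gammaRatio (by linarith)).inv
      (gammaRatio_ne_zero (by linarith))).continuousAt.continuousWithinAt
  obtain ⟨D, hD⟩ := (isCompact_closedBall (0 : ℂ) (1 / 20)).exists_bound_of_continuousOn hcont
  have hlog : ∀ᶠ Q in 𝓝 Q₀, ‖logQ Q‖ < ‖logQ Q₀‖ + 1 :=
    (differentiableAt_logQ hQ₀).continuousAt.norm.eventually_lt_const (by linarith)
  refine ⟨D * Real.exp (‖logQ Q₀‖ + 1) * C, ?_⟩
  filter_upwards [hC, hlog] with Q h1 h2 H hH
  have hH' := mem_ball_zero_iff.1 (hsub hH)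
  rw [continuedI, norm_mul, norm_mul]
  have h3 : ‖powQ Q H‖ ≤ Real.exp (‖logQ Q₀‖ + 1) := by
    rw [powQ]
    refine (Complex.norm_exp_le_exp_norm _).trans (Real.exp_le_exp.2 ?_)
    rw [norm_mul]
    have : ‖H‖ ≤ 1 := by linarith
    calc ‖H‖ * ‖logQ Q‖ ≤ 1 * ‖logQ Q‖ := by gcongr
      _ ≤ _ := by linarith
  have h4 := hD H hH
  have hD0 : 0 ≤ D := (norm_nonneg _).trans h4
  gcongr
  exact h1 H hH'

theorem sin_ne_zero {H : ℂ} (hH : ‖H‖ < 1 / 10) {k : ℕ} (hk : k ∈ Finset.Icc (1 : ℕ) 4) :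
    Complex.sin (Real.pi * (H + k / 5)) ≠ 0 := by
  intro h
  obtain ⟨j, hj⟩ := Complex.sin_eq_zero_iff.1 h
  have hpi : (Real.pi : ℂ) ≠ 0 := by exact_mod_cast Real.pi_ne_zero
  have h1 : H + (k : ℂ) / 5 = j := mul_left_cancel₀ hpi (hj.trans (mul_comm _ _))
  have h2 := one_tenth_le_norm_add hH hk (-j)
  rw [h1] at h2
  push_cast at h2
  rw [add_neg_cancel, norm_zero] at h2
  linarith

theorem differentiableOn_gammaSide (Q : ℂ) :
    DifferentiableOn ℂ (fun H => gammaSide H Q) (Metric.ball 0 (1 / 10)) := by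
  have h : ∀ H ∈ Metric.ball (0 : ℂ) (1 / 10), gammaSide H Q = _ := fun H hH =>
    gammaSide_eq (by linarith [(abs_re_lt (mem_ball_zero_iff.1 hH)).1]) Q
  refine DifferentiableOn.congr ?_ h
  refine DifferentiableOn.mul (fun H hH => ?_) (DifferentiableOn.fun_sum fun k hk H hH => ?_)
  · have hre := (abs_re_lt (mem_ball_zero_iff.1 hH)).1
    exact ((differentiableAt_gammaRatio (by linarith)).inv
      (gammaRatio_ne_zero (by linarith))).differentiableWithinAt
  · have hs := sin_ne_zero (mem_ball_zero_iff.1 hH) hk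
    have h1 : DifferentiableAt ℂ (fun H : ℂ =>
        Real.pi * Complex.exp (-(Real.pi * Complex.I * (H + (k : ℂ) / 5)))) H := by fun_prop
    have h2 : DifferentiableAt ℂ (fun H : ℂ => Complex.sin (Real.pi * (H + (k : ℂ) / 5))) H := by
      fun_prop
    exact (((h1.fun_div h2 hs).const_mul (gCoeff k)).mul_const
      (powQ Q (-((k : ℂ) / 5)) * wTilde k (1 / Q))).differentiableWithinAt

theorem analyticAt_of_differentiableOn_ball {f : ℂ → ℂ} {r : ℝ} (hr : 0 < r)
    (h : DifferentiableOn ℂ f (Metric.ball 0 r)) : AnalyticAt ℂ f 0 :=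
  h.analyticAt (Metric.ball_mem_nhds 0 hr)

theorem hCoeff_eq_of_norm_sub_le {f g : ℂ → ℂ} (hf : AnalyticAt ℂ f 0) (hg : AnalyticAt ℂ g 0)
    {n : ℕ} {C : ℝ} (hb : ∀ᶠ z in 𝓝[≠] (0 : ℂ), ‖f z - g z‖ ≤ C * ‖z‖ ^ n) {i : ℕ} (hi : i < n) :
    hCoeff i f = hCoeff i g := by
  have h := hCoeff_eq_zero_of_norm_le (hf.sub hg) (n := n) (C := C) hb hi
  rw [hCoeff, iteratedDeriv_sub hf.contDiffAt hg.contDiffAt, sub_div, sub_eq_zero] at h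
  exact h

theorem hCoeff_continuedI_eq_gammaSide {Q : ℂ} (hQc : Q ∈ cutPlane) (hQ : 1 < ‖Q‖) {i : ℕ}
    (hi : i < 4) :
    hCoeff i (fun H => continuedI H Q) = hCoeff i (fun H => gammaSide H Q) := by
  have hw : ‖1 / Q‖ < 1 := by
    rw [norm_div, norm_one, div_lt_one (one_pos.trans hQ)]; exact hQ
  have hg := summable_geometric_of_lt_one (norm_nonneg _) hw
  refine hCoeff_eq_of_norm_sub_le
    (analyticAt_of_differentiableOn_ball (by norm_num) (differentiableOn_continuedI_left hQc))
    (analyticAt_of_differentiableOn_ball (by norm_num) (differentiableOn_gammaSide Q))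
    (C := (‖powQ Q 0‖ + 1) * (‖1 / Q‖ * ((∑' m : ℕ, ‖1 / Q‖ ^ m) * 10 ^ 4))) ?_ hi
  have hpow : ∀ᶠ H in 𝓝[≠] (0 : ℂ), ‖powQ Q H‖ < ‖powQ Q 0‖ + 1 :=
    ((differentiable_powQ Q).continuous.continuousAt.norm.eventually_lt_const
      (by linarith)).filter_mono nhdsWithin_le_nhds
  have hball : ∀ᶠ H in 𝓝[≠] (0 : ℂ), ‖H‖ < 1 / 10 := by
    have h := Metric.ball_mem_nhds (0 : ℂ) (by norm_num : (0 : ℝ) < 1 / 10)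
    filter_upwards [nhdsWithin_le_nhds h] with H hH using mem_ball_zero_iff.1 hH
  filter_upwards [hpow, hball, self_mem_nhdsWithin] with H h1 h2 (h3 : H ≠ 0)
  have hG : gammaRatio H ≠ 0 := gammaRatio_ne_zero (by linarith [(abs_re_lt h2).1])
  have hG' : 0 < ‖gammaRatio H‖ := norm_pos_iff.2 hG
  rw [continuedI, lerchSum_eq_of_one_lt_norm h2 h3 hQc hQ, sub_sub_cancel_left, norm_neg, norm_mul,
    norm_mul, norm_mul, norm_inv]
  have h4 : ‖∑' m : ℕ, (1 / Q) ^ m * gammaRatio (H - (m + 1))‖ ≤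
      (∑' m : ℕ, ‖1 / Q‖ ^ m) * (10 ^ 4 * ‖gammaRatio H‖ * ‖H‖ ^ 4) := by
    refine tsum_of_norm_bounded (hg.hasSum.mul_right _) fun m => ?_
    rw [norm_mul, norm_pow]
    gcongr
    exact norm_gammaRatio_sub_le h2 h3 m
  have hS : 0 ≤ ∑' m : ℕ, ‖1 / Q‖ ^ m := tsum_nonneg fun m => by positivity
  -- The prefactor `(gammaRatio H)⁻¹` cancels the factor `‖gammaRatio H‖` of the tail estimate,
  -- leaving a constant times ‖H‖^4.
  calc ‖gammaRatio H‖⁻¹ * ‖powQ Q H‖ * (‖1 / Q‖ * ‖∑' m : ℕ, (1 / Q) ^ m * gammaRatio (H - (m + 1))‖)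
      ≤ ‖gammaRatio H‖⁻¹ * (‖powQ Q 0‖ + 1) *
        (‖1 / Q‖ * ((∑' m : ℕ, ‖1 / Q‖ ^ m) * (10 ^ 4 * ‖gammaRatio H‖ * ‖H‖ ^ 4))) := by gcongr
    _ = _ := by field_simp

theorem hCoeff_iFun_eq {Q : ℂ} (hQ : ‖Q‖ < 1) (i : ℕ) :
    hCoeff i (fun H => iFun H Q) = hCoeff i (fun H => continuedI H Q) := by
  refine hCoeff_congr ?_ i
  filter_upwards [Metric.ball_mem_nhds (0 : ℂ) (by norm_num : (0 : ℝ) < 1 / 10)] with H hH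
  exact iFun_eq (mem_ball_zero_iff.1 hH) hQ

theorem connection_formula {i : ℕ} (hi : i < 4) : ∃ Φ : ℂ → ℂ, DifferentiableOn ℂ Φ cutPlane ∧
    (∀ Q ∈ cutPlane, ‖Q‖ < 1 → Φ Q = hCoeff i (fun H => iFun H Q)) ∧
    (∀ Q ∈ cutPlane, 1 < ‖Q‖ → Φ Q = hCoeff i (fun H => gammaSide H Q)) :=
  ⟨fun Q => hCoeff i fun H => continuedI H Q, differentiableOn_hCoeff_continuedI i,
    fun _ _ hQ => (hCoeff_iFun_eq hQ i).symm,
    fun _ hQc hQ => hCoeff_continuedI_eq_gammaSide hQc hQ hi⟩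

/-! ### Limits of quotients of `q`-shifted factorials -/

theorem le_norm_qNum {t : ℝ} (ht : 0 < t) {z w : ℂ} (hzw : z.re ≤ w.re) :
    (1 - Real.exp (-(t * z.re))) / t ≤ ‖qNum t w‖ := by
  rw [qNum, norm_div, Complex.norm_real, Real.norm_eq_abs, abs_of_pos ht]
  have h := norm_sub_norm_le (1 : ℂ) (Complex.exp (-(t * w)))
  have e : ‖Complex.exp (-(t * w))‖ = Real.exp (-(t * w.re)) := by
    rw [Complex.norm_exp]; simp
  rw [norm_one, e] at h
  have h2 : Real.exp (-(t * w.re)) ≤ Real.exp (-(t * z.re)) := by gcongr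
  gcongr
  linarith

/-- The modulus exceeds its value at Re z only through the phase, which costs E·t·|Im z| with E =
e^(-t Re z). Since E·t·Re z ≤ 1 - E, the cost is a factor independent of t. -/
theorem norm_qNum_le {t : ℝ} (ht : 0 < t) {z : ℂ} (hz : 0 < z.re) :
    ‖qNum t z‖ ≤ (1 + |z.im| / z.re) * ((1 - Real.exp (-(t * z.re))) / t) := by
  have e1 : Complex.exp (-(t * z)) = (Real.exp (-(t * z.re)) : ℝ) *
      Complex.exp (Complex.I * ((-(t * z.im) : ℝ) : ℂ)) := by
    rw [Complex.ofReal_exp, ← Complex.exp_add]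
    congr 1
    nth_rewrite 1 [← Complex.re_add_im z]
    push_cast
    ring
  set E := Real.exp (-(t * z.re)) with hE
  have hE0 : 0 < E := Real.exp_pos _
  have h1 : E * (t * z.re) ≤ 1 - E := by
    have h := mul_le_mul_of_nonneg_left (Real.add_one_le_exp (t * z.re)) hE0.le
    have h' : E * Real.exp (t * z.re) = 1 := by rw [hE, ← Real.exp_add]; simp
    linarith
  have h2 : 0 ≤ 1 - E := (by positivity : 0 ≤ E * (t * z.re)).trans h1
  have h3 : ‖1 - Complex.exp (-(t * z))‖ ≤ (1 - E) + E * (t * |z.im|) := by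
    have e2 : 1 - Complex.exp (-(t * z)) = ((1 - E : ℝ) : ℂ) -
        E * (Complex.exp (Complex.I * ((-(t * z.im) : ℝ) : ℂ)) - 1) := by
      rw [e1]; push_cast; ring
    rw [e2]
    refine (norm_sub_le _ _).trans ?_
    rw [norm_mul, Complex.norm_real, Complex.norm_real, Real.norm_eq_abs, Real.norm_eq_abs,
      abs_of_nonneg h2, abs_of_pos hE0]
    have h := Real.norm_exp_I_mul_ofReal_sub_one_le (x := -(t * z.im))
    rw [norm_neg, norm_mul, Real.norm_eq_abs, Real.norm_eq_abs, abs_of_pos ht] at h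
    gcongr
  rw [qNum, norm_div, Complex.norm_real, Real.norm_eq_abs, abs_of_pos ht, ← mul_div_assoc]
  gcongr
  refine h3.trans ?_
  have h4 : E * (t * |z.im|) = |z.im| / z.re * (E * (t * z.re)) := by field_simp
  rw [h4]
  have := mul_le_mul_of_nonneg_left h1 (by positivity : 0 ≤ |z.im| / z.re)
  linarith

theorem norm_qNum_div_le {t : ℝ} (ht : 0 < t) {z w : ℂ} (hz : 0 < z.re) (hzw : z.re ≤ w.re) :
    ‖qNum t z / qNum t w‖ ≤ 1 + |z.im| / z.re := by
  rw [norm_div, div_le_iff₀ (norm_pos_iff.2 (qNum_ne_zero ht (hz.trans_le hzw)))]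
  refine (norm_qNum_le ht hz).trans ?_
  gcongr
  exact le_norm_qNum ht hzw

theorem qPoch_div_qPoch {t : ℝ} (ht : 0 < t) (a b : ℂ) (d : ℕ) :
    qPoch (((Real.exp (-t) : ℝ) : ℂ) ^ a) (Real.exp (-t)) d /
      qPoch (((Real.exp (-t) : ℝ) : ℂ) ^ b) (Real.exp (-t)) d =
    ∏ l ∈ Finset.range d, qNum t (l + a) / qNum t (l + b) := by
  have h3 : (t : ℂ) ≠ 0 := by exact_mod_cast ht.ne'
  simp only [qPoch, one_sub_cpow_mul_pow ht, ← Finset.prod_div_distrib,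
    mul_div_mul_left _ _ h3]

/-- Each of the d factors obeys the bound for l = 0, since |Im a|/(Re a + l) decreases in l. For
real a the quotient has modulus at most 1. -/
theorem norm_qPoch_div_le {t : ℝ} (ht : 0 < t) {a b : ℂ} (ha : 0 < a.re) (hab : a.re ≤ b.re)
    (d : ℕ) :
    ‖qPoch (((Real.exp (-t) : ℝ) : ℂ) ^ a) (Real.exp (-t)) d /
      qPoch (((Real.exp (-t) : ℝ) : ℂ) ^ b) (Real.exp (-t)) d‖ ≤ (1 + |a.im| / a.re) ^ d := by
  rw [qPoch_div_qPoch ht, norm_prod]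
  refine (Finset.prod_le_prod (fun _ _ => norm_nonneg _) (g := fun _ => 1 + |a.im| / a.re)
    fun l _ => ?_).trans (by simp)
  have hl : (0 : ℝ) ≤ l := l.cast_nonneg
  refine (norm_qNum_div_le ht (by simp; linarith) (by simpa using hab)).trans ?_
  simp only [Complex.add_re, Complex.natCast_re, Complex.add_im, Complex.natCast_im, zero_add]
  gcongr
  linarith

theorem tendsto_qPoch_div {α : Type*} {l : Filter α} {t : α → ℝ} {a b : α → ℂ} {a₀ b₀ : ℂ}
    (ht : Tendsto t l (𝓝[>] 0)) (ha : Tendsto a l (𝓝 a₀)) (hb : Tendsto b l (𝓝 b₀))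
    (hb₀ : 0 < b₀.re) (d : ℕ) :
    Tendsto (fun x => qPoch (((Real.exp (-t x) : ℝ) : ℂ) ^ a x) (Real.exp (-t x)) d /
      qPoch (((Real.exp (-t x) : ℝ) : ℂ) ^ b x) (Real.exp (-t x)) d) l
      (𝓝 (rising a₀ d / rising b₀ d)) := by
  have h : Tendsto (fun x => ∏ n ∈ Finset.range d, qNum (t x) (n + a x) / qNum (t x) (n + b x)) l
      (𝓝 (∏ n ∈ Finset.range d, (n + a₀) / (n + b₀))) := by
    refine tendsto_finsetProd _ fun n _ => ?_
    refine (tendsto_qNum ht (ha.const_add _)).div (tendsto_qNum ht (hb.const_add _)) fun h => ?_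
    have := congrArg Complex.re h
    have hn : (0 : ℝ) ≤ n := n.cast_nonneg
    simp at this
    linarith
  rw [rising, rising, ← Finset.prod_div_distrib]
  simp_rw [add_comm a₀, add_comm b₀]
  refine h.congr' ?_
  filter_upwards [(tendsto_nhdsWithin_iff.1 ht).2] with x hx
  exact (qPoch_div_qPoch hx _ _ _).symm

/-! ### The left-hand side of the `q`-connection formula -/

theorem qTerm_eq (q : ℝ) (H Q : ℂ) (d : ℕ) :
    qTerm q H Q d = (∏ i ∈ Finset.Icc (1 : ℕ) 4, qPoch ((q : ℂ) ^ (H + (i : ℂ) / 5)) q d /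
      qPoch ((q : ℂ) ^ (H + 1)) q d) * Q ^ d := by
  rw [qTerm, Finset.prod_div_distrib, Finset.prod_const]
  simp

theorem re_add_fifth (H : ℂ) (i : ℕ) : (H + (i : ℂ) / 5).re = H.re + i / 5 := by
  rw [show H + (i : ℂ) / 5 = H + ((i / 5 : ℝ) : ℂ) by push_cast; ring, Complex.add_re,
    Complex.ofReal_re]

theorem im_add_fifth (H : ℂ) (i : ℕ) : (H + (i : ℂ) / 5).im = H.im := by
  rw [show H + (i : ℂ) / 5 = H + ((i / 5 : ℝ) : ℂ) by push_cast; ring, Complex.add_im,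
    Complex.ofReal_im, add_zero]

/-- Here Re(H + i/5) ≥ 1/10 and |Im H| ≤ δ, so each of the four quotients grows at most like (1 +
10δ)^d, whatever t is. -/
theorem norm_qTerm_le {t : ℝ} (ht : 0 < t) {δ : ℝ} (hδ : δ ≤ 1 / 10) {H : ℂ} (hH : ‖H‖ < δ)
    (Q : ℂ) (d : ℕ) : ‖qTerm (Real.exp (-t)) H Q d‖ ≤ ((1 + 10 * δ) ^ 4 * ‖Q‖) ^ d := by
  rw [qTerm_eq, norm_mul, norm_pow, norm_prod, mul_pow]
  have hre := (abs_re_lt hH).1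
  have h : ∀ i ∈ Finset.Icc (1 : ℕ) 4,
      ‖qPoch (((Real.exp (-t) : ℝ) : ℂ) ^ (H + (i : ℂ) / 5)) (Real.exp (-t)) d /
        qPoch (((Real.exp (-t) : ℝ) : ℂ) ^ (H + 1)) (Real.exp (-t)) d‖ ≤ (1 + 10 * δ) ^ d := by
    intro i hi
    have hi1 : (1 : ℝ) ≤ i := by exact_mod_cast (Finset.mem_Icc.1 hi).1
    have hi4 : (i : ℝ) ≤ 4 := by exact_mod_cast (Finset.mem_Icc.1 hi).2
    have hx : 1 / 10 ≤ (H + (i : ℂ) / 5).re := by rw [re_add_fifth]; linarith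
    refine (norm_qPoch_div_le ht (by linarith) ?_ d).trans ?_
    · rw [re_add_fifth, Complex.add_re, Complex.one_re]; linarith
    · rw [im_add_fifth]
      have h1 : |H.im| ≤ δ := (Complex.abs_im_le_norm H).trans hH.le
      have h2 : |H.im| / (H + (i : ℂ) / 5).re ≤ 10 * δ := by
        rw [div_le_iff₀ (by linarith)]
        have : 0 ≤ δ := (abs_nonneg _).trans h1
        nlinarith
      gcongr
  gcongr
  refine (Finset.prod_le_prod (fun _ _ => norm_nonneg _) h).trans ?_
  simp [← pow_mul, mul_comm]

/-- Shrinking the disc in H keeps the geometric majorant convergent for any given |Q| < 1. -/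
theorem exists_radius {r : ℝ} (hr : r < 1) :
    ∃ δ : ℝ, 0 < δ ∧ δ ≤ 1 / 10 ∧ (1 + 10 * δ) ^ 4 * r < 1 := by
  have h : ContinuousAt (fun δ : ℝ => (1 + 10 * δ) ^ 4 * r) 0 := by fun_prop
  have h1 : ∀ᶠ δ in 𝓝[>] (0 : ℝ), (1 + 10 * δ) ^ 4 * r < 1 :=
    (h.eventually_lt_const (by simpa using hr)).filter_mono nhdsWithin_le_nhds
  have h2 : ∀ᶠ δ in 𝓝[>] (0 : ℝ), δ ∈ Set.Ioc (0 : ℝ) (1 / 10) :=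
    Ioc_mem_nhdsGT (by norm_num)
  obtain ⟨δ, h3, h4⟩ := (h1.and h2).exists
  exact ⟨δ, h4.1, h4.2, h3⟩

theorem tendsto_qTerm {α : Type*} {l : Filter α} {t : α → ℝ} {H : α → ℂ} {H₀ : ℂ}
    (ht : Tendsto t l (𝓝[>] 0)) (hH : Tendsto H l (𝓝 H₀)) (hH₀ : -1 < H₀.re) (Q : ℂ) (d : ℕ) :
    Tendsto (fun x => qTerm (Real.exp (-t x)) (H x) Q d) l (𝓝 (iTerm H₀ Q d)) := by
  have e : iTerm H₀ Q d = (∏ i ∈ Finset.Icc (1 : ℕ) 4, rising (H₀ + i / 5) d /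
      rising (H₀ + 1) d) * Q ^ d := by
    rw [iTerm_eq hH₀, Finset.prod_div_distrib, Finset.prod_const]
    simp
  rw [e]
  simp_rw [qTerm_eq]
  refine (tendsto_finsetProd _ fun i _ => ?_).mul_const _
  exact tendsto_qPoch_div ht (hH.add_const _) (hH.add_const 1) (by simp; linarith) d

theorem norm_iTerm_le {δ : ℝ} (hδ : δ ≤ 1 / 10) {H : ℂ} (hH : ‖H‖ < δ) (Q : ℂ) (d : ℕ) :
    ‖iTerm H Q d‖ ≤ ((1 + 10 * δ) ^ 4 * ‖Q‖) ^ d :=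
  le_of_tendsto (tendsto_qTerm (l := 𝓝[>] (0 : ℝ)) (t := id) (H := fun _ => H) tendsto_id
    tendsto_const_nhds (by linarith [(abs_re_lt hH).1]) Q d).norm
    (eventually_nhdsWithin_of_forall fun _ ht => norm_qTerm_le ht hδ hH Q d)

theorem summable_geometric_radius {δ : ℝ} (hδ0 : 0 < δ) {Q : ℂ} (h : (1 + 10 * δ) ^ 4 * ‖Q‖ < 1) :
    Summable fun d : ℕ => ((1 + 10 * δ) ^ 4 * ‖Q‖) ^ d :=
  summable_geometric_of_lt_one (by positivity) h

theorem differentiableOn_exp_neg_cpow_const (t : ℝ) (c : ℂ) (U : Set ℂ) :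
    DifferentiableOn ℂ (fun H : ℂ => ((Real.exp (-t) : ℝ) : ℂ) ^ (H * c)) U := by
  simp_rw [exp_neg_cpow]
  fun_prop

theorem differentiable_qPoch_cpow (t : ℝ) (c : ℂ) (d : ℕ) :
    Differentiable ℂ fun H : ℂ =>
      qPoch (((Real.exp (-t) : ℝ) : ℂ) ^ (H + c)) (Real.exp (-t)) d := by
  simp_rw [qPoch, exp_neg_cpow]
  exact Differentiable.fun_finsetProd fun l _ => by fun_prop

theorem qPoch_ne_zero {t : ℝ} (ht : 0 < t) {a : ℂ} (ha : 0 < a.re) (d : ℕ) :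
    qPoch (((Real.exp (-t) : ℝ) : ℂ) ^ a) (Real.exp (-t)) d ≠ 0 := by
  refine Finset.prod_ne_zero_iff.2 fun l _ => ?_
  have hl : (0 : ℝ) ≤ l := l.cast_nonneg
  rw [one_sub_cpow_mul_pow ht]
  exact mul_ne_zero (by exact_mod_cast ht.ne') (qNum_ne_zero ht (by simp; linarith))

theorem differentiableOn_qSeriesSide {t : ℝ} (ht : 0 < t) {δ : ℝ} (hδ0 : 0 < δ) (hδ : δ ≤ 1 / 10)
    {Q : ℂ} (h : (1 + 10 * δ) ^ 4 * ‖Q‖ < 1) :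
    DifferentiableOn ℂ (fun H => qSeriesSide (Real.exp (-t)) H Q) (Metric.ball 0 δ) := by
  refine (differentiableOn_exp_neg_cpow_const t _ _).mul ?_
  refine Complex.differentiableOn_tsum_of_summable_norm (summable_geometric_radius hδ0 h)
    (fun d => ?_) Metric.isOpen_ball fun d H hH => norm_qTerm_le ht hδ (mem_ball_zero_iff.1 hH) Q d
  unfold qTerm
  refine DifferentiableOn.mul_const (DifferentiableOn.fun_div ?_ ?_ fun H hH => ?_) _
  · exact DifferentiableOn.fun_finsetProd fun i _ =>
      (differentiable_qPoch_cpow t _ d).differentiableOn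
  · exact ((differentiable_qPoch_cpow t 1 d).pow 4).differentiableOn
  · have := (abs_re_lt (mem_ball_zero_iff.1 hH)).1
    exact pow_ne_zero _ (qPoch_ne_zero ht (by simp; linarith) d)

theorem differentiableOn_iFun {Q : ℂ} (hQc : Q ∈ cutPlane) (hQ : ‖Q‖ < 1) :
    DifferentiableOn ℂ (fun H => iFun H Q) (Metric.ball 0 (1 / 10)) :=
  (differentiableOn_continuedI_left hQc).congr fun _ hH => iFun_eq (mem_ball_zero_iff.1 hH) hQ

theorem tendsto_qSeriesSide {Q : ℂ} (hQ : Q.im < 0) (hQ1 : ‖Q‖ < 1) (hQc : Q ∈ cutPlane) (i : ℕ) :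
    Tendsto (fun t : ℝ => hCoeff i (fun H => qSeriesSide (Real.exp (-t)) H Q)) (𝓝[>] 0)
      (𝓝 (hCoeff i (fun H => iFun H Q))) := by
  obtain ⟨δ, hδ0, hδ, h⟩ := exists_radius hQ1
  refine tendsto_hCoeff (l := 𝓝[>] (0 : ℝ)) (U := Metric.ball 0 δ) Metric.isOpen_ball (Metric.mem_ball_self hδ0)
    (eventually_nhdsWithin_of_forall fun t ht => differentiableOn_qSeriesSide ht hδ0 hδ h)
    ((differentiableOn_iFun hQc hQ1).continuousOn.mono (Metric.ball_subset_ball hδ))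
    (fun H hH => ?_) i
  have ht : Tendsto (fun p : ℝ × ℂ => p.1) (𝓝[>] 0 ×ˢ 𝓝 H) (𝓝[>] 0) := tendsto_fst
  have hs : Tendsto (fun p : ℝ × ℂ => p.2) (𝓝[>] 0 ×ˢ 𝓝 H) (𝓝 H) := tendsto_snd
  have hre := (abs_re_lt (mem_ball_zero_iff.1 hH)).1
  refine (tendsto_cpow_qLog ht hs hQ).mul ?_
  refine tendsto_tsum_of_dominated_convergence (summable_geometric_radius hδ0 h)
    (fun d => tendsto_qTerm ht hs (by linarith) Q d) ?_
  filter_upwards [(tendsto_nhdsWithin_iff.1 ht).2, hs (Metric.isOpen_ball.mem_nhds hH)]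
    with p h1 h2 d
  exact norm_qTerm_le h1 hδ (mem_ball_zero_iff.1 h2) Q d

theorem eventually_mem_ball {δ : ℝ} (hδ : 0 < δ) : ∀ᶠ H in 𝓝 (0 : ℂ), ‖H‖ < δ := by
  filter_upwards [Metric.ball_mem_nhds (0 : ℂ) hδ] with H hH using mem_ball_zero_iff.1 hH

theorem series_side_regular {Q : ℂ} (hQc : Q ∈ cutPlane) (hQ1 : ‖Q‖ < 1) :
    (∀ᶠ H in 𝓝 (0 : ℂ), Summable (iTerm H Q)) ∧ AnalyticAt ℂ (fun H => iFun H Q) 0 ∧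
      ∀ t : ℝ, 0 < t → (∀ᶠ H in 𝓝 (0 : ℂ), Summable (qTerm (Real.exp (-t)) H Q)) ∧
        AnalyticAt ℂ (fun H => qSeriesSide (Real.exp (-t)) H Q) 0 := by
  obtain ⟨δ, hδ0, hδ, h⟩ := exists_radius hQ1
  refine ⟨?_, analyticAt_of_differentiableOn_ball (by norm_num) (differentiableOn_iFun hQc hQ1),
    fun t ht => ⟨?_, analyticAt_of_differentiableOn_ball hδ0
      (differentiableOn_qSeriesSide ht hδ0 hδ h)⟩⟩
  · filter_upwards [eventually_mem_ball hδ0] with H hH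
    exact (summable_geometric_radius hδ0 h).of_norm_bounded fun d => norm_iTerm_le hδ hH Q d
  · filter_upwards [eventually_mem_ball hδ0] with H hH
    exact (summable_geometric_radius hδ0 h).of_norm_bounded fun d => norm_qTerm_le ht hδ hH Q d

/-! ### The right-hand side of the `q`-connection formula -/

theorem qWTerm_eq (q : ℝ) (k : ℕ) (w : ℂ) (d : ℕ) :
    qWTerm q k w d = (∏ i ∈ Finset.Icc (1 : ℕ) 4, qPoch ((q : ℂ) ^ ((k : ℂ) / 5)) q d /
      qPoch ((q : ℂ) ^ (1 + ((k : ℂ) - (i : ℂ)) / 5)) q d) * ((q : ℂ) ^ 2 * w) ^ d := by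
  rw [qWTerm, Finset.prod_div_distrib, Finset.prod_const]
  simp

theorem ofReal_fifth (k : ℕ) : (k : ℂ) / 5 = ((k / 5 : ℝ) : ℂ) := by push_cast; ring

theorem one_add_sub_div_five_eq (k i : ℕ) :
    1 + ((k : ℂ) - (i : ℂ)) / 5 = ((1 + (k - i) / 5 : ℝ) : ℂ) := by push_cast; ring

/-- All parameters are real and k/5 ≤ 1 + (k-i)/5 because i ≤ 4, so the quotients are at most 1; the
factor q² only helps. -/
theorem norm_qWTerm_le {t : ℝ} (ht : 0 < t) {k : ℕ} (hk : k ∈ Finset.Icc (1 : ℕ) 4) (w : ℂ)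
    (d : ℕ) : ‖qWTerm (Real.exp (-t)) k w d‖ ≤ ‖w‖ ^ d := by
  have hq := exp_neg_mem_Ioo ht
  have hk1 : (1 : ℝ) ≤ k := by exact_mod_cast (Finset.mem_Icc.1 hk).1
  rw [qWTerm_eq, norm_mul, norm_pow, norm_prod]
  have h : ∀ i ∈ Finset.Icc (1 : ℕ) 4,
      ‖qPoch (((Real.exp (-t) : ℝ) : ℂ) ^ ((k : ℂ) / 5)) (Real.exp (-t)) d /
        qPoch (((Real.exp (-t) : ℝ) : ℂ) ^ (1 + ((k : ℂ) - (i : ℂ)) / 5)) (Real.exp (-t)) d‖ ≤ 1 := by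
    intro i hi
    have hi4 : (i : ℝ) ≤ 4 := by exact_mod_cast (Finset.mem_Icc.1 hi).2
    rw [ofReal_fifth, one_add_sub_div_five_eq]
    refine (norm_qPoch_div_le ht ?_ ?_ d).trans ?_
    · rw [Complex.ofReal_re]; linarith
    · rw [Complex.ofReal_re, Complex.ofReal_re]; linarith
    · simp
  have h2 : ‖((Real.exp (-t) : ℝ) : ℂ) ^ 2 * w‖ ≤ ‖w‖ := by
    rw [norm_mul, norm_pow, Complex.norm_real, Real.norm_eq_abs, abs_of_pos hq.1]
    exact mul_le_of_le_one_left (norm_nonneg _) (pow_le_one₀ hq.1.le hq.2.le)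
  calc _ ≤ 1 * ‖w‖ ^ d := by
        gcongr
        exact Finset.prod_le_one (fun _ _ => norm_nonneg _) h
    _ = _ := one_mul _

theorem tendsto_qWTerm {α : Type*} {l : Filter α} {t : α → ℝ} (ht : Tendsto t l (𝓝[>] 0)) {k : ℕ}
    (hk : k ∈ Finset.Icc (1 : ℕ) 4) (w : ℂ) (d : ℕ) :
    Tendsto (fun x => qWTerm (Real.exp (-t x)) k w d) l (𝓝 (wTerm k w d)) := by
  have hk1 : (1 : ℝ) ≤ k := by exact_mod_cast (Finset.mem_Icc.1 hk).1
  have e : wTerm k w d = (∏ i ∈ Finset.Icc (1 : ℕ) 4, rising ((k : ℂ) / 5) d /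
      rising (1 + ((k : ℂ) - i) / 5) d) * (((1 : ℂ)) ^ 2 * w) ^ d := by
    rw [wTerm_eq hk, wCoeff, Finset.prod_div_distrib, Finset.prod_const]
    simp
  have hq : Tendsto (fun x => ((Real.exp (-t x) : ℝ) : ℂ)) l (𝓝 1) := by
    have h := (Continuous.tendsto (f := fun s : ℝ => ((Real.exp (-s) : ℝ) : ℂ)) (by fun_prop) 0).comp
      (ht.mono_right nhdsWithin_le_nhds)
    simpa [Function.comp_def] using h
  rw [e]
  simp_rw [qWTerm_eq]
  refine (tendsto_finsetProd _ fun i hi => ?_).mul (((hq.pow 2).mul_const w).pow d)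
  have hi4 : (i : ℝ) ≤ 4 := by exact_mod_cast (Finset.mem_Icc.1 hi).2
  refine tendsto_qPoch_div ht tendsto_const_nhds tendsto_const_nhds ?_ d
  rw [one_add_sub_div_five_eq, Complex.ofReal_re]
  linarith

theorem norm_one_div_lt_one {Q : ℂ} (hQ : 1 < ‖Q‖) : ‖1 / Q‖ < 1 := by
  rw [norm_div, norm_one, div_lt_one (one_pos.trans hQ)]; exact hQ

theorem tendsto_tsum_qWTerm {α : Type*} {l : Filter α} {t : α → ℝ} (ht : Tendsto t l (𝓝[>] 0))
    {k : ℕ} (hk : k ∈ Finset.Icc (1 : ℕ) 4) {w : ℂ} (hw : ‖w‖ < 1) :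
    Tendsto (fun x => ∑' d, qWTerm (Real.exp (-t x)) k w d) l (𝓝 (wTilde k w)) := by
  refine tendsto_tsum_of_dominated_convergence (summable_geometric_of_lt_one (norm_nonneg w) hw)
    (fun d => tendsto_qWTerm ht hk w d) ?_
  filter_upwards [(tendsto_nhdsWithin_iff.1 ht).2] with x hx d
  exact norm_qWTerm_le hx hk w d

theorem tendsto_qChar_inv_mul_qW {α : Type*} {l : Filter α} {t : α → ℝ}
    (ht : Tendsto t l (𝓝[>] 0)) {k : ℕ} (hk : k ∈ Finset.Icc (1 : ℕ) 4) {w : ℂ} (hw : ‖w‖ < 1)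
    (hws : w ∈ Complex.slitPlane) :
    Tendsto (fun x => (qChar (Real.exp (-t x)) (((Real.exp (-t x) : ℝ) : ℂ) ^ ((k : ℂ) / 5)) w)⁻¹ *
      qW (Real.exp (-t x)) k w) l (𝓝 (wTilde k w)) := by
  refine (tendsto_tsum_qWTerm ht hk hw).congr' ?_
  filter_upwards [eventually_theta_ne_zero (a := 0) ht hws,
    eventually_theta_ne_zero (a := (k : ℂ) / 5) ht hws] with x h0 h1
  rw [Complex.cpow_zero, one_mul] at h0
  exact (inv_mul_cancel_left₀ (div_ne_zero h0 h1) _).symm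

theorem differentiableOn_qGamma_comp {t : ℝ} (ht : 0 < t) {f : ℂ → ℂ} (hf : Differentiable ℂ f)
    {U : Set ℂ} (hU : ∀ H ∈ U, 0 < (f H).re) :
    DifferentiableOn ℂ (fun H => qGamma (Real.exp (-t)) (f H)) U :=
  (differentiableOn_qGamma ht).comp hf.differentiableOn hU

theorem re_neg_add_one_sub_fifth (H : ℂ) (k : ℕ) :
    (-H + 1 - (k : ℂ) / 5).re = -H.re + 1 - k / 5 := by
  rw [ofReal_fifth, Complex.sub_re, Complex.ofReal_re]
  simp

theorem differentiableOn_qGammaSide {t : ℝ} (ht : 0 < t) {Q : ℂ} (hQ : Q ∈ cutPlane) :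
    DifferentiableOn ℂ (fun H => qGammaSide (Real.exp (-t)) H Q) (Metric.ball 0 (1 / 10)) := by
  have hre : ∀ H ∈ Metric.ball (0 : ℂ) (1 / 10), -(1 / 10) < H.re ∧ H.re < 1 / 10 := fun H hH =>
    abs_re_lt (mem_ball_zero_iff.1 hH)
  have hpos : ∀ i ∈ Finset.Icc (1 : ℕ) 4, ∀ H ∈ Metric.ball (0 : ℂ) (1 / 10),
      0 < (H + (i : ℂ) / 5).re := fun i hi H hH => by
    have hi1 : (1 : ℝ) ≤ i := by exact_mod_cast (Finset.mem_Icc.1 hi).1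
    rw [re_add_fifth]
    linarith [(hre H hH).1]
  unfold qGammaSide
  refine ((differentiableOn_exp_neg_cpow_const t _ _).mul (DifferentiableOn.fun_div ?_ ?_ ?_)).mul
    (DifferentiableOn.fun_sum fun k hk => ?_)
  · exact (differentiableOn_qGamma_comp ht (by fun_prop) fun H hH => by
      simp; linarith [(hre H hH).1]).pow 4
  · exact DifferentiableOn.fun_finsetProd fun i hi =>
      differentiableOn_qGamma_comp ht (by fun_prop) (hpos i hi)
  · exact fun H hH => Finset.prod_ne_zero_iff.2 fun i hi => qGamma_ne_zero ht (hpos i hi H hH)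
  · have hk4 : (k : ℝ) ≤ 4 := by exact_mod_cast (Finset.mem_Icc.1 hk).2
    refine DifferentiableOn.mul_const (DifferentiableOn.mul (DifferentiableOn.const_mul
      (DifferentiableOn.mul ?_ ?_) _) (DifferentiableOn.div_const ?_ _)) _
    · exact differentiableOn_qGamma_comp ht (by fun_prop) (hpos k hk)
    · refine differentiableOn_qGamma_comp ht (by fun_prop) fun H hH => ?_
      rw [re_neg_add_one_sub_fifth]
      linarith [(hre H hH).2]
    · exact (differentiable_theta_cpow ht hQ _).differentiableOn

theorem exp_neg_mul_log_neg (Q a : ℂ) :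
    Complex.exp (-(a * Complex.log (-Q))) =
      Complex.exp (-(Real.pi * Complex.I * a)) * powQ Q (-a) := by
  rw [powQ, logQ, ← Complex.exp_add]
  congr 1
  ring

/-- Factor by factor: Γ_q(H + k/5)Γ_q(1 - H - k/5) tends to π/sin by reflection. The theta quotient
tends to (-Q)^(-(H + k/5)), whose rewriting with log(-Q) = log Q + πi supplies the phase e^(-πi(H +
k/5)). -/
theorem tendsto_qGammaSide_summand {α : Type*} {l : Filter α} {t : α → ℝ} {H : α → ℂ} {H₀ Q : ℂ}
    (ht : Tendsto t l (𝓝[>] 0)) (hH : Tendsto H l (𝓝 H₀)) (hH₀ : ‖H₀‖ < 1 / 10) (hQ : Q.im < 0)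
    (hQ1 : 1 < ‖Q‖) (hQc : Q ∈ cutPlane) {k : ℕ} (hk : k ∈ Finset.Icc (1 : ℕ) 4) :
    Tendsto (fun x =>
      (∏ i ∈ (Finset.Icc (1 : ℕ) 4).erase k, qGamma (Real.exp (-t x)) (((i : ℂ) - (k : ℂ)) / 5)) /
        qGamma (Real.exp (-t x)) (1 - (k : ℂ) / 5) ^ 4 *
      (qGamma (Real.exp (-t x)) (H x + (k : ℂ) / 5) *
        qGamma (Real.exp (-t x)) (-H x + 1 - (k : ℂ) / 5)) *
      (theta (Real.exp (-t x)) (-((Real.exp (-t x) : ℝ) : ℂ) ^ (H x + (k : ℂ) / 5) * Q) /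
        theta (Real.exp (-t x)) (-Q)) *
      ((qChar (Real.exp (-t x)) (((Real.exp (-t x) : ℝ) : ℂ) ^ ((k : ℂ) / 5)) (1 / Q))⁻¹ *
        qW (Real.exp (-t x)) k (1 / Q))) l
      (𝓝 (gCoeff k * (Real.pi / Complex.sin (Real.pi * (H₀ + (k : ℂ) / 5))) *
        (Complex.exp (-(Real.pi * Complex.I * (H₀ + (k : ℂ) / 5))) *
          powQ Q (-(H₀ + (k : ℂ) / 5))) * wTilde k (1 / Q))) := by
  have hre := abs_re_lt hH₀
  have hk1 : (1 : ℝ) ≤ k := by exact_mod_cast (Finset.mem_Icc.1 hk).1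
  have hk4 : (k : ℝ) ≤ 4 := by exact_mod_cast (Finset.mem_Icc.1 hk).2
  have hws : 1 / Q ∈ Complex.slitPlane := by
    refine Or.inr ?_
    have hQ0 : Q ≠ 0 := ne_zero_of_mem_cutPlane hQc
    rw [one_div, Complex.inv_im]
    exact div_ne_zero (neg_ne_zero.2 hQ.ne) (Complex.normSq_pos.2 hQ0).ne'
  refine (((Tendsto.div ?_ ?_ (pow_ne_zero 4 (Gamma_ne_zero_one_sub hk))).mul ?_).mul ?_).mul
    (tendsto_qChar_inv_mul_qW ht hk (norm_one_div_lt_one hQ1) hws)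
  · refine tendsto_finsetProd _ fun i hi => tendsto_qGamma ht tendsto_const_nhds ?_ ?_
    · have hi1 : (1 : ℝ) ≤ i := by
        exact_mod_cast (Finset.mem_Icc.1 (Finset.mem_of_mem_erase hi)).1
      rw [show ((i : ℂ) - k) / 5 = (((i - k) / 5 : ℝ) : ℂ) by push_cast; ring, Complex.ofReal_re]
      linarith
    · refine div_ne_zero (sub_ne_zero.2 ?_) (by norm_num)
      exact_mod_cast Finset.ne_of_mem_erase hi
  · refine (tendsto_qGamma_of_re_pos ht tendsto_const_nhds ?_).pow 4
    rw [ofReal_fifth, Complex.sub_re, Complex.ofReal_re, Complex.one_re]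
    linarith
  · rw [← Complex.Gamma_mul_Gamma_one_sub, show 1 - (H₀ + (k : ℂ) / 5) = -H₀ + 1 - k / 5 by ring]
    refine (tendsto_qGamma_of_re_pos ht (hH.add_const _) ?_).mul
      (tendsto_qGamma_of_re_pos ht ((hH.neg.add_const 1).sub_const _) ?_)
    · rw [re_add_fifth]; linarith
    · rw [re_neg_add_one_sub_fifth]; linarith
  · rw [← exp_neg_mul_log_neg]
    exact tendsto_theta_div ht (hH.add_const _) hQc

theorem tendsto_qGammaSide_joint {α : Type*} {l : Filter α} {t : α → ℝ} {H : α → ℂ} {H₀ Q : ℂ}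
    (ht : Tendsto t l (𝓝[>] 0)) (hH : Tendsto H l (𝓝 H₀)) (hH₀ : ‖H₀‖ < 1 / 10) (hQ : Q.im < 0)
    (hQ1 : 1 < ‖Q‖) (hQc : Q ∈ cutPlane) :
    Tendsto (fun x => qGammaSide (Real.exp (-t x)) (H x) Q) l (𝓝 (gammaSide H₀ Q)) := by
  have hre := abs_re_lt hH₀
  have hpos : ∀ i ∈ Finset.Icc (1 : ℕ) 4, 0 < (H₀ + (i : ℂ) / 5).re := fun i hi => by
    have hi1 : (1 : ℝ) ≤ i := by exact_mod_cast (Finset.mem_Icc.1 hi).1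
    rw [re_add_fifth]
    linarith
  have hG : ∏ i ∈ Finset.Icc (1 : ℕ) 4, Complex.Gamma (H₀ + (i : ℂ) / 5) ≠ 0 :=
    Finset.prod_ne_zero_iff.2 fun i hi => Complex.Gamma_ne_zero_of_re_pos (hpos i hi)
  have h1 := (tendsto_qGamma_of_re_pos ht (hH.add_const 1) (by simp; linarith)).pow 4
  have h2 : Tendsto (fun x => ∏ i ∈ Finset.Icc (1 : ℕ) 4,
      qGamma (Real.exp (-t x)) (H x + (i : ℂ) / 5)) l
      (𝓝 (∏ i ∈ Finset.Icc (1 : ℕ) 4, Complex.Gamma (H₀ + (i : ℂ) / 5))) :=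
    tendsto_finsetProd _ fun i hi => tendsto_qGamma_of_re_pos ht (hH.add_const _) (hpos i hi)
  have h3 := ((tendsto_cpow_qLog ht hH hQ).mul (h1.div h2 hG)).mul
    (tendsto_finsetSum _ fun k hk => tendsto_qGammaSide_summand ht hH hH₀ hQ hQ1 hQc hk)
  refine h3.trans_eq ?_
  rw [gammaSide_eq (by linarith), mul_comm (powQ Q H₀), mul_assoc, Finset.mul_sum, gammaRatio,
    inv_div]
  congr 2
  refine Finset.sum_congr rfl fun k _ => ?_
  -- The factor Q^H from P^(ℓ_q(Q)) combines with Q^(-(H + k/5)) to leave Q^(-k/5).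
  rw [show -((k : ℂ) / 5) = H₀ + -(H₀ + k / 5) by ring, powQ_add]
  ring

theorem tendsto_qGammaSide {Q : ℂ} (hQ : Q.im < 0) (hQ1 : 1 < ‖Q‖) (hQc : Q ∈ cutPlane) (i : ℕ) :
    Tendsto (fun t : ℝ => hCoeff i (fun H => qGammaSide (Real.exp (-t)) H Q)) (𝓝[>] 0)
      (𝓝 (hCoeff i (fun H => gammaSide H Q))) :=
  tendsto_hCoeff (l := 𝓝[>] (0 : ℝ)) (U := Metric.ball 0 (1 / 10)) Metric.isOpen_ball
    (Metric.mem_ball_self (by norm_num))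
    (eventually_nhdsWithin_of_forall fun _ ht => differentiableOn_qGammaSide ht hQc)
    (differentiableOn_gammaSide Q).continuousOn
    (fun _ hH => tendsto_qGammaSide_joint tendsto_fst tendsto_snd (mem_ball_zero_iff.1 hH)
      hQ hQ1 hQc) i

theorem gamma_side_regular {Q : ℂ} (hQc : Q ∈ cutPlane) (hQ1 : 1 < ‖Q‖) :
    (∀ k ∈ Finset.Icc (1 : ℕ) 4, Summable (wTerm k (1 / Q))) ∧
      AnalyticAt ℂ (fun H => gammaSide H Q) 0 ∧
      ∀ t : ℝ, 0 < t →
        (∀ k ∈ Finset.Icc (1 : ℕ) 4, Summable (qWTerm (Real.exp (-t)) k (1 / Q))) ∧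
        AnalyticAt ℂ (fun H => qGammaSide (Real.exp (-t)) H Q) 0 := by
  have hg := summable_geometric_of_lt_one (norm_nonneg _) (norm_one_div_lt_one hQ1)
  refine ⟨fun k hk => hg.of_norm_bounded fun d => ?_,
    analyticAt_of_differentiableOn_ball (by norm_num) (differentiableOn_gammaSide Q),
    fun t ht => ⟨fun k hk => hg.of_norm_bounded fun d => norm_qWTerm_le ht hk _ d,
      analyticAt_of_differentiableOn_ball (by norm_num) (differentiableOn_qGammaSide ht hQc)⟩⟩
  exact le_of_tendsto (tendsto_qWTerm (l := 𝓝[>] (0 : ℝ)) (t := id) tendsto_id hk _ d).norm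
    (eventually_nhdsWithin_of_forall fun _ ht => norm_qWTerm_le ht hk _ d)

theorem mem_cutPlane_of_im_neg {Q : ℂ} (hQ : Q.im < 0) : Q ∈ cutPlane :=
  Or.inr (by rw [Complex.neg_im]; exact neg_ne_zero.2 hQ.ne)

end QuinticConfluence

end

theorem mainTheorem2 :
    -- the connection formula modulo `H ^ 4`: the coefficients of `H ^ i`, `i < 4`, of the
    -- two sides are restrictions of one holomorphic function on the cut plane
    (∀ i < 4, ∃ Φ : ℂ → ℂ,
      DifferentiableOn ℂ Φ QuinticConfluence.cutPlane ∧
      (∀ Q ∈ QuinticConfluence.cutPlane, ‖Q‖ < 1 →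
        Φ Q = QuinticConfluence.hCoeff i (fun H => QuinticConfluence.iFun H Q)) ∧
      (∀ Q ∈ QuinticConfluence.cutPlane, 1 < ‖Q‖ →
        Φ Q = QuinticConfluence.hCoeff i (fun H => QuinticConfluence.gammaSide H Q))) ∧
    -- the left-hand side of the `q`-formula tends to the left-hand side as `q = e^{-t} → 1`
    (∀ Q : ℂ, Q.im < 0 → ‖Q‖ < 1 → ∀ i < 4,
      Tendsto (fun t : ℝ => QuinticConfluence.hCoeff i
          (fun H => QuinticConfluence.qSeriesSide (Real.exp (-t)) H Q))
        (𝓝[>] 0)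
        (𝓝 (QuinticConfluence.hCoeff i (fun H => QuinticConfluence.iFun H Q)))) ∧
    -- the right-hand side of the `q`-formula tends to the right-hand side
    (∀ Q : ℂ, Q.im < 0 → 1 < ‖Q‖ → ∀ i < 4,
      Tendsto (fun t : ℝ => QuinticConfluence.hCoeff i
          (fun H => QuinticConfluence.qGammaSide (Real.exp (-t)) H Q))
        (𝓝[>] 0)
        (𝓝 (QuinticConfluence.hCoeff i (fun H => QuinticConfluence.gammaSide H Q)))) ∧
    -- all series converge and all functions of `H` are holomorphic at `0`
    (∀ Q ∈ QuinticConfluence.cutPlane, ‖Q‖ < 1 →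
      (∀ᶠ H in 𝓝 (0 : ℂ), Summable (QuinticConfluence.iTerm H Q)) ∧
      AnalyticAt ℂ (fun H => QuinticConfluence.iFun H Q) 0 ∧
      ∀ t : ℝ, 0 < t →
        (∀ᶠ H in 𝓝 (0 : ℂ), Summable (QuinticConfluence.qTerm (Real.exp (-t)) H Q)) ∧
        AnalyticAt ℂ (fun H => QuinticConfluence.qSeriesSide (Real.exp (-t)) H Q) 0) ∧
    (∀ Q ∈ QuinticConfluence.cutPlane, 1 < ‖Q‖ →
      (∀ k ∈ Finset.Icc (1 : ℕ) 4, Summable (QuinticConfluence.wTerm k (1 / Q))) ∧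
      AnalyticAt ℂ (fun H => QuinticConfluence.gammaSide H Q) 0 ∧
      ∀ t : ℝ, 0 < t →
        (∀ k ∈ Finset.Icc (1 : ℕ) 4,
          Summable (QuinticConfluence.qWTerm (Real.exp (-t)) k (1 / Q))) ∧
        AnalyticAt ℂ (fun H => QuinticConfluence.qGammaSide (Real.exp (-t)) H Q) 0) :=
  ⟨fun _ hi => QuinticConfluence.connection_formula hi,
    fun _ hQ hQ1 i _ => QuinticConfluence.tendsto_qSeriesSide hQ hQ1
      (QuinticConfluence.mem_cutPlane_of_im_neg hQ) i,
    fun _ hQ hQ1 i _ => QuinticConfluence.tendsto_qGammaSide hQ hQ1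
      (QuinticConfluence.mem_cutPlane_of_im_neg hQ) i,
    fun _ hQc hQ1 => QuinticConfluence.series_side_regular hQc hQ1,
    fun _ hQc hQ1 => QuinticConfluence.gamma_side_regular hQc hQ1⟩
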